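/- **Conventions.** $\mathbf{Top}^*$ is the category of pointed topological spaces and base point preserving continuous maps; $\simeq$ is pointed homotopy equivalence; $\wedge$, $\vee$, $\mathrm{susp}$ are the smash product, the wedge and the reduced suspension; $X/A$ is the quotient space of $X$ in which $A$ is collapsed into the base point. For a positive integer $n$ and $x\in\{-1,0,1\}^n$ let $\mathrm{Plus}(x)=\{i: x_i=1\}$, $\mathrm{Minus}(x)=\{i:x_i=-1\}$. For $S\subseteq\{-1,0,1\}^n$ we also write $\operatorname{span}S$ for $\operatorname{span}_{\mathbb R}(S)\cap\{-1,0,1\}^n$. **Resonance category.** An $n$-cut is a set $S\subseteq\{-1,0,1\}^n$ with $\operatorname{span} S=S$ such that $\mathrm{Plus}(x)\ne\emptyset\ne\mathrm{Minus}(x)$ for every $x\in S\setminus\{0\}$. For an ordered set partition $\pi=(\pi_1,\dots,\pi_m)$ of $[n]$, $\pi S$ is the $m$-cut of all $t\in\{-1,0,1\}^m$ such that the vector equal to $t_j$ on $\pi_j$ (all $j$) lies in $S$; $\mathrm{un}(\pi)$ is the underlying unordered partition. The objects of $\mathcal R$ are the $n$-cuts, $n\ge1$; the morphisms from an $m$-cut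 $S$ to an $n$-cut $T$ are the ordered set partitions $\pi$ of $[n]$ with $m$ parts and $S\subseteq\pi T$; composition is composition of ordered set partitions. The morphism $\pi S\to S$ given by $\pi$ is denoted $\pi S\hookrightarrow S$. **Relative cuts.** Let $P(n)$ be the set of set partitions of $[n]$. For $\pi\in P(n)$ and a cut $S$, $\pi\downarrow S$ is the set of all $\tau\in P(n)$ that can be reached from $\pi$ in the set of finite collections of multisubsets of $[n]$ by the moves $\{B_1,B_2,B_3,\dots\}\mapsto\{B_1+B_2,B_3,\dots\}$ and $\{B_1,B_2,\dots\}\mapsto\{(B_1\setminus\mathrm{Plus}(x))+\mathrm{Minus}(x),B_2,\dots\}$ for $x\in S$ with $\mathrm{Plus}(x)\subseteq B_1$ (sums and differences of multisets). A set $\Pi\subseteq P(n)$ is $S$-closed if $\bigcup_{\pi\in\Pi}\pi\downarrow S=\Pi$. Let $S\setminus\Pi$ be the set of those $s\in S$ for which the partition with blocks $\mathrm{Plus}(s)$, $\mathrm{Minus}(s)$ and singletons is not in $\Pi$. A relative $n$-cut is a pair $(S,\Pi)$, $S\subseteq\{-1,0,1\}^n$, $\Pi\subseteq P(n)$, such that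 $\operatorname{span}S$ is a cut, $\Pi$ is $(\operatorname{span} S)$-closed and $(\operatorname{span}S)\setminus\Pi=S$. For a cut $S$ and an $S$-closed $\Pi$, $Q(S,\Pi)=(S\setminus\Pi,\Pi)$; $[Q(S,\Pi)]$ is its orbit under permutations of coordinates. For a relative $n$-cut $(S,\Pi)$ and a relative $m$-cut $(T,\Lambda)$, $(S,\Pi)\times(T,\Lambda)=(S\times T,\Theta)$, where $\Theta$ consists of the partitions of $[n+m]$ whose restriction to the first $n$ elements is in $\Pi$ or whose restriction to the last $m$ elements is in $\Lambda$. **Resonance functors.** For a functor $\mathcal F:\mathcal R\to\mathbf{Top}^*$ put $$\mathcal F(Q(S,\Pi))=\mathcal F(S)\Big/\bigcup_{\mathrm{un}(\pi)\in\Pi}\operatorname{Im}\mathcal F(\pi S\hookrightarrow S),$$ and $\mathcal F(S,\Pi)=\mathcal F(Q(\operatorname{span}S,\Pi))$ for a relative cut $(S,\Pi)$. $\mathcal F$ is a resonance functor if all spaces $\mathcal F(S)$ are well pointed (the inclusion of the base point is a closed cofibration) and * (A1) every $\mathcal F(\pi S\hookrightarrow S)$ is an inclusion, that is, a closed cofibration,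 and $\mathcal F(S)/\operatorname{Im}\mathcal F(\pi S\hookrightarrow S)\simeq\mathcal F(Q(S,\mathrm{un}(\pi)\downarrow S))$; * (A2) if $[Q(S,\Pi)]=[Q(T,\Lambda)]$, then $\mathcal F(Q(S,\Pi))\simeq\mathcal F(Q(T,\Lambda))$; * (A3) $\mathcal F(S,\Pi)\wedge\mathcal F(T,\Lambda)\simeq\mathcal F((S,\Pi)\times(T,\Lambda))$ for all relative cuts. **Partitions.** For a number partition $\lambda=(\lambda_1\le\dots\le\lambda_n)$ with positive integer parts, $\mathcal F(\lambda)$ is the value of $\mathcal F$ on the cut $\{x\in\{-1,0,1\}^n:\sum x_i\lambda_i=0\}$. $\lambda$ is sequential if, whenever $A,B\subseteq[n]$, $\sum_{i\in A}\lambda_i=\sum_{j\in B}\lambda_j$ and $q=\max(A\cup B)\in A$, there is $\widetilde B\subseteq B$ with $\lambda_q=\sum_{j\in\widetilde B}\lambda_j$. Let $mm(\lambda)=|\{i:\lambda_i=\lambda_n\}|$. Let $I(\lambda)$ be the largest set $I\subseteq[n]$ with $|I|\ge2$ and $\sum_{i\in I}\lambda_i=\lambda_n$, if there is one, where $A$ is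 larger than $B\neq A$ if the largest element of the symmetric difference of $A$ and $B$ is in $A$. A sequential $\lambda$ is strongly sequential if either $I(\lambda)$ does not exist, or, with $q=\max I(\lambda)$, there is $J\subseteq I(\lambda)\setminus\{q\}$ with $\lambda_q=\sum_{i\in J}\lambda_i$. **Theorem.** Let $\mathcal F$ be a resonance functor such that $\mathcal F(1^l)$ is contractible for all $l\ge2$, and let $\lambda=(\lambda_1\le\dots\le\lambda_n)$ be a sequential partition for which $I(\lambda)$ exists. 1. If $mm(\lambda)\ge2$, then $\mathcal F(\lambda)$ is contractible. 2. Suppose $mm(\lambda)=1$. Let $T$ be the cut of $(\lambda_1,\dots,\lambda_{n-1})$, let $\nu$ be the partition of $[n-1]$ whose only nonsingleton block is $I(\lambda)$, and let $\mu=(\lambda_{j_1},\dots,\lambda_{j_t})$ with $\{j_1<\dots<j_t\}=[n]\setminus I(\lambda)$. Then $\mathcal F(\lambda)\simeq\mathcal F(Q(T,\nu\downarrow T))\wedge\mathcal F(1)$, and there is an inclusion triple $\mathcal F(\mu)\xrightarrow{i}\mathcal F(\lambda_1,\dots,\lambda_{n-1})\xrightarrow{p}\mathcal F(Q(T,\nu\downarrow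 T))$: here $i$ is $\mathcal F$ of the inclusion morphism that glues $I(\lambda)$ to one block (its sum $\lambda_n$ is the last part of $\mu$), $i$ is a closed cofibration, and $p$ is the projection onto $\mathcal F(\lambda_1,\dots,\lambda_{n-1})/\operatorname{Im} i$ followed by a pointed homotopy equivalence. If moreover $\lambda$ is strongly sequential, then $i$ is homotopic, through pointed maps, to the trivial map, and $$\mathcal F(\lambda)\simeq\bigl(\mathcal F(1)\wedge\mathcal F(\lambda_1,\dots,\lambda_{n-1})\bigr)\vee\mathrm{susp}\bigl(\mathcal F(1)\wedge\mathcal F(\mu)\bigr).$$ -/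

import Mathlib

open CategoryTheory

universe u

namespace Resonance

/-! ### Pointed spaces and pointed homotopy theory -/

/-- Pointed topological spaces. -/
structure PTop : Type (u + 1) where
  /-- the underlying set -/
  carrier : Type u
  [top : TopologicalSpace carrier]
  /-- the base point -/
  pt : carrier

attribute [instance] PTop.top

instance : CoeSort PTop.{u} (Type u) := ⟨PTop.carrier⟩

/-- Base point preserving continuous maps. -/
@[ext]
structure PTop.Hom (X Y : PTop.{u}) where
  /-- the underlying continuous map -/
  map : C(X, Y)
  map_pt : map X.pt = Y.pt

instance : Category PTop.{u} where
  Hom := PTop.Hom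
  id X := ⟨ContinuousMap.id X, rfl⟩
  comp f g := ⟨g.map.comp f.map, by simp [f.map_pt, g.map_pt]⟩

/-- Two pointed maps are homotopic through pointed maps. -/
def PHomotopic {X Y : PTop.{u}} (f g : X ⟶ Y) : Prop :=
  ContinuousMap.HomotopicRel f.map g.map {X.pt}

/-- `f` is a pointed homotopy equivalence. -/
def IsPHE {X Y : PTop.{u}} (f : X ⟶ Y) : Prop :=
  ∃ g : Y ⟶ X, PHomotopic (f ≫ g) (𝟙 X) ∧ PHomotopic (g ≫ f) (𝟙 Y)

/-- `X ≃ Y`: the pointed spaces `X` and `Y` have the same (pointed) homotopy type. -/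
def PHE (X Y : PTop.{u}) : Prop := ∃ f : X ⟶ Y, IsPHE f

/-- The trivial map, sending everything to the base point. -/
def trivialMap (X Y : PTop.{u}) : X ⟶ Y := PTop.Hom.mk (ContinuousMap.const X Y.pt) rfl

/-- A closed (Hurewicz) cofibration: a closed embedding with the homotopy extension property. -/
def IsClosedCofibration {A X : Type u} [TopologicalSpace A] [TopologicalSpace X]
    (i : C(A, X)) : Prop :=
  Topology.IsClosedEmbedding i ∧
    ∀ (Z : Type u) [TopologicalSpace Z] (f : C(X, Z)) (H : C(A × unitInterval, Z)),
      (∀ a, H (a, 0) = f (i a)) →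
        ∃ K : C(X × unitInterval, Z), (∀ x, K (x, 0) = f x) ∧ ∀ a t, K (i a, t) = H (a, t)

/-- The base point of `X` is closed and nondegenerate. -/
def WellPointed (X : PTop.{u}) : Prop :=
  IsClosedCofibration (ContinuousMap.const PUnit.{u + 1} X.pt)

/-- The equivalence relation on `X` that collapses `A` and the base point to one class. -/
def collapseSetoid (X : PTop.{u}) (A : Set X) : Setoid X where
  r x y := x = y ∨ (x ∈ insert X.pt A ∧ y ∈ insert X.pt A)
  iseqv :=
    { refl := fun _ => Or.inl rfl
      symm := by
        rintro x y (h | ⟨h, h'⟩)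
        · exact Or.inl h.symm
        · exact Or.inr ⟨h', h⟩
      trans := by
        rintro x y z (rfl | ⟨h, h'⟩) (rfl | ⟨k, k'⟩)
        · exact Or.inl rfl
        · exact Or.inr ⟨k, k'⟩
        · exact Or.inr ⟨h, h'⟩
        · exact Or.inr ⟨h, k'⟩ }

/-- The quotient space `X / A` in pointed spaces (with the quotient topology); `A` is collapsed
into the base point, so `X / ∅` is `X`. -/
def collapse (X : PTop.{u}) (A : Set X) : PTop.{u} where
  carrier := Quotient (collapseSetoid X A)
  pt := Quotient.mk _ X.pt

/-- The projection `X → X / A`. -/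
def collapseProj (X : PTop.{u}) (A : Set X) : X ⟶ collapse X A :=
  PTop.Hom.mk ⟨Quotient.mk (collapseSetoid X A), continuous_quotient_mk'⟩ rfl

/-- The smash product `X ∧ Y = (X × Y) / (X ∨ Y)`. -/
def smash (X Y : PTop.{u}) : PTop.{u} :=
  collapse ⟨X × Y, (X.pt, Y.pt)⟩ {p : X × Y | p.1 = X.pt ∨ p.2 = Y.pt}

/-- The wedge `X ∨ Y`: the disjoint union with the two base points identified. -/
def wedge (X Y : PTop.{u}) : PTop.{u} :=
  collapse ⟨X ⊕ Y, Sum.inl X.pt⟩ {Sum.inr Y.pt}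

/-- The (reduced) suspension `X × [0,1] / (X × {0,1} ∪ {pt} × [0,1])`. -/
def susp (X : PTop.{u}) : PTop.{u} :=
  collapse ⟨X × unitInterval, (X.pt, 0)⟩ {p : X × unitInterval | p.1 = X.pt ∨ p.2 = 0 ∨ p.2 = 1}

/-- `A → X → C` is an inclusion triple: `i` is an inclusion (a closed cofibration), and `p` is,
up to a pointed homotopy equivalence `X / A ≃ C`, the projection `X → X / A`. -/
def IsInclusionTriple {A X C : PTop.{u}} (i : A ⟶ X) (p : X ⟶ C) : Prop :=
  IsClosedCofibration i.map ∧
    ∃ e : collapse X (Set.range i.map) ⟶ C, IsPHE e ∧ p = collapseProj X (Set.range i.map) ≫ e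

/-! ### Cuts -/

/-- A point of `{-1,0,1}^n` as a vector of `ℝ^n`. -/
def vec {n : ℕ} (x : Fin n → SignType) : Fin n → ℝ := fun i => (x i : ℝ)

/-- `span(S) ∩ {-1,0,1}^n`. -/
def cubeSpan {n : ℕ} (S : Set (Fin n → SignType)) : Set (Fin n → SignType) :=
  {x | vec x ∈ Submodule.span ℝ (vec '' S)}

/-- `Plus(x)`. -/
def plus {n : ℕ} (x : Fin n → SignType) : Finset (Fin n) := Finset.univ.filter fun i => x i = 1

/-- `Minus(x)`. -/
def minus {n : ℕ} (x : Fin n → SignType) : Finset (Fin n) := Finset.univ.filter fun i => x i = -1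

/-- Every element other than the origin has both a positive and a negative coordinate. -/
def Balanced {n : ℕ} (S : Set (Fin n → SignType)) : Prop :=
  ∀ x ∈ S, x ≠ 0 → (plus x).Nonempty ∧ (minus x).Nonempty

/-- An `n`-cut, `n` a positive integer. -/
@[ext]
structure Cut (n : ℕ) where
  /-- the underlying subset of `{-1,0,1}^n` -/
  carrier : Set (Fin n → SignType)
  pos : 0 < n
  span_closed : cubeSpan carrier = carrier
  balanced : Balanced carrier

/-- An ordered set partition of `[n]` with `m` parts: the surjection sending an element to the
number of its block. -/
@[ext]
structure OrdPart (n m : ℕ) where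
  /-- the number of the block of an element -/
  block : Fin n → Fin m
  surj : Function.Surjective block

/-- The composition `π ∘ ν`. -/
def OrdPart.comp {n m k : ℕ} (π : OrdPart m k) (ν : OrdPart n m) : OrdPart n k :=
  ⟨π.block ∘ ν.block, π.surj.comp ν.surj⟩

/-- The set partition underlying an ordered set partition. Set partitions of `[n]` are given by
their equivalence relations on `Fin n`. -/
def OrdPart.un {n m : ℕ} (π : OrdPart n m) : Setoid (Fin n) := Setoid.ker π.block

theorem subset_cubeSpan {n : ℕ} (S : Set (Fin n → SignType)) : S ⊆ cubeSpan S :=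
  fun x hx => Submodule.subset_span ⟨x, hx, rfl⟩

theorem vec_comp_mem_span {n m : ℕ} (f : Fin n → Fin m) {A : Set (Fin m → SignType)}
    {B : Set (Fin n → SignType)} (h : ∀ x ∈ A, x ∘ f ∈ B) {x : Fin m → SignType}
    (hx : x ∈ cubeSpan A) : x ∘ f ∈ cubeSpan B := by
  have h1 := Submodule.mem_map_of_mem (f := LinearMap.funLeft ℝ ℝ f)
    (show vec x ∈ Submodule.span ℝ (vec '' A) from hx)
  rw [Submodule.map_span] at h1
  refine Submodule.span_mono ?_ h1
  rintro _ ⟨_, ⟨y, hy, rfl⟩, rfl⟩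
  exact ⟨y ∘ f, h y hy, rfl⟩

/-- The cut `π S` consists of those `t` for which the vector that is constantly `t_j` on the
block `π_j` lies in `S`. -/
def Cut.act {n m : ℕ} (π : OrdPart n m) (S : Cut n) : Cut m where
  carrier := {t | t ∘ π.block ∈ S.carrier}
  pos := (π.block ⟨0, S.pos⟩).pos
  span_closed := by
    refine Set.Subset.antisymm (fun t ht => ?_) (subset_cubeSpan _)
    have := vec_comp_mem_span π.block (B := S.carrier) (fun x hx => hx) ht
    rwa [S.span_closed] at this
  balanced := by
    intro t ht h0
    have h1 : t ∘ π.block ≠ 0 := by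
      intro h
      apply h0
      funext j
      obtain ⟨i, rfl⟩ := π.surj j
      exact congrFun h i
    obtain ⟨⟨i, hi⟩, ⟨j, hj⟩⟩ := S.balanced _ ht h1
    simp only [plus, minus, Finset.mem_filter, Finset.mem_univ, true_and,
      Function.comp_apply] at hi hj
    exact ⟨⟨_, by simpa [plus] using hi⟩, ⟨_, by simpa [minus] using hj⟩⟩

/-! ### The resonance category -/

/-- Objects of the resonance category: all `n`-cuts for all positive integers `n`. -/
structure ResCat where
  /-- the number of coordinates -/
  n : ℕ
  /-- the cut -/
  cut : Cut n

/-- A morphism from `S` to `T`: an ordered set partition `π` with `S ⊆ π T`. -/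
@[ext]
structure ResCat.Hom (S T : ResCat) where
  /-- the ordered set partition of the coordinates of `T` -/
  part : OrdPart T.n S.n
  le : S.cut.carrier ⊆ (T.cut.act part).carrier

instance : Category ResCat where
  Hom := ResCat.Hom
  id S := ⟨⟨id, Function.surjective_id⟩, fun _ h => h⟩
  comp f g := ⟨f.part.comp g.part, fun _ hx => g.le (f.le hx)⟩

/-- A cut as an object of the resonance category. -/
def Cut.obj {n : ℕ} (S : Cut n) : ResCat := ⟨n, S⟩

/-- The inclusion morphism `π S ↪ S`. -/
def Cut.incl {n m : ℕ} (S : Cut n) (π : OrdPart n m) : (S.act π).obj ⟶ S.obj :=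
  ResCat.Hom.mk π (fun _ h => h)

/-! ### Relative resonances -/

/-- The collection of the blocks of a set partition of `[n]`, as an element of the set of
collections of multisubsets of `[n]`. -/
noncomputable def blocks {n : ℕ} (τ : Setoid (Fin n)) : Multiset (Multiset (Fin n)) := by
  classical
  exact ((Finset.univ.image fun i => Finset.univ.filter fun j => τ i j).val).map Finset.val

/-- `Reach S A B`: the collection `B` belongs to the closure `A ⇓ S`. -/
inductive Reach {n : ℕ} (S : Set (Fin n → SignType)) (A : Multiset (Multiset (Fin n))) :
    Multiset (Multiset (Fin n)) → Prop
  | refl : Reach S A A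
  | merge (B₁ B₂ : Multiset (Fin n)) (C : Multiset (Multiset (Fin n))) :
      Reach S A (B₁ ::ₘ B₂ ::ₘ C) → Reach S A ((B₁ + B₂) ::ₘ C)
  | move (B : Multiset (Fin n)) (C : Multiset (Multiset (Fin n))) (x : Fin n → SignType) :
      Reach S A (B ::ₘ C) → x ∈ S → (plus x).val ≤ B →
        Reach S A ((B - (plus x).val + (minus x).val) ::ₘ C)

/-- `Π ↓ S`, the union of the sets `π ↓ S = (π ⇓ S) ∩ P(n)` over `π ∈ Π`. -/
def down {n : ℕ} (S : Set (Fin n → SignType)) (P : Set (Setoid (Fin n))) :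
    Set (Setoid (Fin n)) :=
  {τ | ∃ π ∈ P, Reach S (blocks π) (blocks τ)}

/-- `Π` is `S`-closed. -/
def IsDownClosed {n : ℕ} (S : Set (Fin n → SignType)) (P : Set (Setoid (Fin n))) : Prop :=
  down S P = P

/-- The set partition with blocks `Minus(s)`, `Plus(s)` and singletons. -/
def signPart {n : ℕ} (s : Fin n → SignType) : Setoid (Fin n) where
  r i j := i = j ∨ (s i = s j ∧ s i ≠ 0)
  iseqv :=
    { refl := fun _ => Or.inl rfl
      symm := by
        rintro i j (h | ⟨h, h'⟩)
        · exact Or.inl h.symm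
        · exact Or.inr ⟨h.symm, h ▸ h'⟩
      trans := by
        rintro i j k (rfl | ⟨h, h'⟩) (rfl | ⟨l, l'⟩)
        · exact Or.inl rfl
        · exact Or.inr ⟨l, l'⟩
        · exact Or.inr ⟨h, h'⟩
        · exact Or.inr ⟨h.trans l, h'⟩ }

/-- `S ∖ Π`. -/
def remove {n : ℕ} (S : Set (Fin n → SignType)) (P : Set (Setoid (Fin n))) :
    Set (Fin n → SignType) :=
  {s | s ∈ S ∧ signPart s ∉ P}

/-- A relative `n`-cut `(S, Π)`; here `span S` stands for the cut `span(S) ∩ {-1,0,1}^n`. -/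
structure RelCut (n : ℕ) where
  /-- the surviving elements -/
  surv : Set (Fin n → SignType)
  /-- the partitions at infinity -/
  inf : Set (Setoid (Fin n))
  pos : 0 < n
  balanced : Balanced (cubeSpan surv)
  remove_eq : remove (cubeSpan surv) inf = surv
  closed : IsDownClosed (cubeSpan surv) inf

theorem cubeSpan_idem {n : ℕ} (S : Set (Fin n → SignType)) :
    cubeSpan (cubeSpan S) = cubeSpan S := by
  refine Set.Subset.antisymm (fun x hx => ?_) (subset_cubeSpan _)
  have h : Submodule.span ℝ (vec '' cubeSpan S) ≤ Submodule.span ℝ (vec '' S) := by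
    refine Submodule.span_le.2 ?_
    rintro _ ⟨y, hy, rfl⟩
    exact hy
  exact h hx

/-- The cut `span(S) ∩ {-1,0,1}^n` of a relative cut `(S, Π)`. -/
def RelCut.span {n : ℕ} (R : RelCut n) : Cut n where
  carrier := cubeSpan R.surv
  pos := R.pos
  span_closed := cubeSpan_idem _
  balanced := R.balanced

/-- `[S, Π] = [T, Λ]`: the two pairs lie in one orbit of the symmetric group. -/
def SameResonance {n : ℕ} (S : Set (Fin n → SignType)) (P : Set (Setoid (Fin n)))
    (T : Set (Fin n → SignType)) (L : Set (Setoid (Fin n))) : Prop :=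
  ∃ σ : Equiv.Perm (Fin n),
    T = {x | x ∘ σ ∈ S} ∧ L = {τ | Setoid.comap σ τ ∈ P}

/-- `S × T ⊆ {-1,0,1}^(n+m)`. -/
def prodSet {n m : ℕ} (S : Set (Fin n → SignType)) (T : Set (Fin m → SignType)) :
    Set (Fin (n + m) → SignType) :=
  {x | x ∘ Fin.castAdd m ∈ S ∧ x ∘ Fin.natAdd n ∈ T}

/-- `(Π × P(m)) ∪ (P(n) × Λ)`: the partitions whose restriction to the first `n` elements lies
in `Π`, or whose restriction to the last `m` elements lies in `Λ`. -/
def prodInf {n m : ℕ} (P : Set (Setoid (Fin n))) (L : Set (Setoid (Fin m))) :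
    Set (Setoid (Fin (n + m))) :=
  {τ | Setoid.comap (Fin.castAdd m) τ ∈ P ∨ Setoid.comap (Fin.natAdd n) τ ∈ L}

/-- The cut spanned by the surviving elements `S × T` of the direct product
`(S, Π) × (T, Λ)` of relative cuts. -/
def RelCut.prodSpan {n m : ℕ} (A : RelCut n) (B : RelCut m) : Cut (n + m) where
  carrier := cubeSpan (prodSet A.surv B.surv)
  pos := Nat.add_pos_left A.pos m
  span_closed := cubeSpan_idem _
  balanced := by
    intro x hx h0
    have h1 := vec_comp_mem_span (Fin.castAdd m) (B := A.surv) (fun y hy => hy.1) hx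
    have h2 := vec_comp_mem_span (Fin.natAdd n) (B := B.surv) (fun y hy => hy.2) hx
    by_cases hA : x ∘ Fin.castAdd m = 0
    · have hB : x ∘ Fin.natAdd n ≠ 0 := by
        intro hB
        apply h0
        funext i
        induction i using Fin.addCases with
        | left i => exact congrFun hA i
        | right i => exact congrFun hB i
      obtain ⟨⟨i, hi⟩, ⟨j, hj⟩⟩ := B.balanced _ h2 hB
      simp only [plus, minus, Finset.mem_filter, Finset.mem_univ, true_and,
        Function.comp_apply] at hi hj
      exact ⟨⟨_, by simpa [plus] using hi⟩, ⟨_, by simpa [minus] using hj⟩⟩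
    · obtain ⟨⟨i, hi⟩, ⟨j, hj⟩⟩ := A.balanced _ h1 hA
      simp only [plus, minus, Finset.mem_filter, Finset.mem_univ, true_and,
        Function.comp_apply] at hi hj
      exact ⟨⟨_, by simpa [plus] using hi⟩, ⟨_, by simpa [minus] using hj⟩⟩

/-! ### Resonance functors -/

/-- `F(Q(S, Π))`: the quotient of `F(S)` by the union of the images of `F(π S ↪ S)` over all
ordered set partitions `π` with `un(π) ∈ Π`. -/
def quot (F : ResCat ⥤ PTop.{u}) {n : ℕ} (S : Cut n) (P : Set (Setoid (Fin n))) : PTop.{u} :=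
  collapse (F.obj S.obj)
    (⋃ (m : ℕ) (π : OrdPart n m) (_ : π.un ∈ P), Set.range (F.map (S.incl π)).map)

/-- Resonance functors. Inclusions of pointed spaces are closed cofibrations, base points are
nondegenerate, `≃` is pointed homotopy equivalence, and the product of pointed spaces is the
smash product. -/
structure IsResonanceFunctor (F : ResCat ⥤ PTop.{u}) : Prop where
  wellPointed : ∀ S : ResCat, WellPointed (F.obj S)
  inclusion : ∀ {n m : ℕ} (S : Cut n) (π : OrdPart n m),
    IsClosedCofibration (F.map (S.incl π)).map
  inclusion_quot : ∀ {n m : ℕ} (S : Cut n) (π : OrdPart n m),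
    PHE (collapse (F.obj S.obj) (Set.range (F.map (S.incl π)).map))
      (quot F S (down S.carrier {π.un}))
  relative : ∀ {n : ℕ} (S T : Cut n) (P L : Set (Setoid (Fin n))),
    IsDownClosed S.carrier P → IsDownClosed T.carrier L →
    SameResonance (remove S.carrier P) P (remove T.carrier L) L →
    PHE (quot F S P) (quot F T L)
  product : ∀ {n m : ℕ} (A : RelCut n) (B : RelCut m),
    PHE (smash (quot F A.span A.inf) (quot F B.span B.inf))
      (quot F (A.prodSpan B) (prodInf A.inf B.inf))

/-! ### Number partitions -/

/-- A number partition `λ_1 ≤ ... ≤ λ_n` with `n ≥ 1` positive parts. -/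
structure NumPart (n : ℕ) where
  /-- the parts -/
  part : Fin n → ℕ
  len_pos : 0 < n
  part_pos : ∀ i, 0 < part i
  mono : Monotone part

/-- The cut of all elements of `{-1,0,1}^n` orthogonal to `(λ_1, ..., λ_n)`. -/
def NumPart.cut {n : ℕ} (lam : NumPart n) : Cut n where
  carrier := {x | ∑ i, vec x i * (lam.part i : ℝ) = 0}
  pos := lam.len_pos
  span_closed := by
    refine Set.Subset.antisymm (fun x hx => ?_) (subset_cubeSpan _)
    let φ : (Fin n → ℝ) →ₗ[ℝ] ℝ := Fintype.linearCombination ℝ (fun i => (lam.part i : ℝ))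
    have h : Submodule.span ℝ (vec '' {x | ∑ i, vec x i * (lam.part i : ℝ) = 0}) ≤
        LinearMap.ker φ := by
      refine Submodule.span_le.2 ?_
      rintro _ ⟨y, hy, rfl⟩
      simpa [φ, Fintype.linearCombination_apply] using hy
    have := h hx
    simpa [φ, Fintype.linearCombination_apply] using this
  balanced := by
    intro x hx h0
    obtain ⟨i, hi⟩ : ∃ i, x i ≠ 0 := by
      by_contra h
      push Not at h
      exact h0 (funext h)
    have hpos : ∀ j, (0 : ℝ) < lam.part j := fun j => Nat.cast_pos.2 (lam.part_pos j)
    constructor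
    · by_contra hne
      have hle : ∀ j, vec x j ≤ 0 := by
        intro j
        have hj : x j ≠ 1 := fun hj => hne ⟨j, by simp [plus, hj]⟩
        unfold vec
        cases hx : x j <;> simp_all
      have hall := (Finset.sum_eq_zero_iff_of_nonpos
        (fun j _ => mul_nonpos_of_nonpos_of_nonneg (hle j) (hpos j).le)).1 hx i
        (Finset.mem_univ i)
      have : vec x i = 0 := (mul_eq_zero.1 hall).resolve_right (hpos i).ne'
      apply hi
      unfold vec at this
      cases hx : x i <;> simp_all
    · by_contra hne
      have hle : ∀ j, 0 ≤ vec x j := by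
        intro j
        have hj : x j ≠ -1 := fun hj => hne ⟨j, by simp [minus, hj]⟩
        unfold vec
        cases hx : x j <;> simp_all
      have hall := (Finset.sum_eq_zero_iff_of_nonneg
        (fun j _ => mul_nonneg (hle j) (hpos j).le)).1 hx i
        (Finset.mem_univ i)
      have : vec x i = 0 := (mul_eq_zero.1 hall).resolve_right (hpos i).ne'
      apply hi
      unfold vec at this
      cases hx : x i <;> simp_all

/-- `F(λ)`. -/
def NumPart.space (F : ResCat ⥤ PTop.{u}) {n : ℕ} (lam : NumPart n) : PTop.{u} :=
  F.obj lam.cut.obj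

/-- The partition `1^l`. -/
def NumPart.ones (l : ℕ) (hl : 0 < l) : NumPart l where
  part _ := 1
  len_pos := hl
  part_pos _ := Nat.one_pos
  mono := monotone_const

/-- Sequential partitions. -/
def NumPart.IsSequential {n : ℕ} (lam : NumPart n) : Prop :=
  ∀ A B : Finset (Fin n), ∑ i ∈ A, lam.part i = ∑ j ∈ B, lam.part j →
    ∀ q ∈ A, (∀ i ∈ A ∪ B, i ≤ q) → ∃ B' ⊆ B, lam.part q = ∑ j ∈ B', lam.part j

/-- `mm(λ)`, the number of parts equal to the largest one. -/
def NumPart.mm {n : ℕ} (lam : NumPart (n + 1)) : ℕ :=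
  (Finset.univ.filter fun i => lam.part i = lam.part (Fin.last n)).card

/-- `J = I(λ)`: among the sets with at least two elements whose parts sum up to the largest part
of `λ`, the set `J` is maximal in the lexicographic order that compares the largest elements
first. -/
structure NumPart.IsI {n : ℕ} (lam : NumPart (n + 1)) (J : Finset (Fin (n + 1))) : Prop where
  two_le : 2 ≤ J.card
  sum_eq : lam.part (Fin.last n) = ∑ i ∈ J, lam.part i
  max : ∀ B : Finset (Fin (n + 1)), 2 ≤ B.card →
    lam.part (Fin.last n) = ∑ i ∈ B, lam.part i → toColex B ≤ toColex J

/-- Strongly sequential partitions: sequential, and if `I(λ)` exists and `q = max I(λ)`, then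
`λ_q` is a sum of parts indexed by a subset of `I(λ) ∖ {q}`. -/
def NumPart.IsStronglySequential {n : ℕ} (lam : NumPart (n + 1)) : Prop :=
  lam.IsSequential ∧ ∀ J, lam.IsI J → ∀ q ∈ J, (∀ i ∈ J, i ≤ q) →
    ∃ B ⊆ J \ {q}, lam.part q = ∑ j ∈ B, lam.part j

/-- The set partition whose only nonsingleton block is `B` (if `B` has two elements or more). -/
def blockPart {n : ℕ} (B : Finset (Fin n)) : Setoid (Fin n) where
  r i j := i = j ∨ (i ∈ B ∧ j ∈ B)
  iseqv :=
    { refl := fun _ => Or.inl rfl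
      symm := by
        rintro i j (h | ⟨h, h'⟩)
        · exact Or.inl h.symm
        · exact Or.inr ⟨h', h⟩
      trans := by
        rintro i j k (rfl | ⟨h, h'⟩) (rfl | ⟨l, l'⟩)
        · exact Or.inl rfl
        · exact Or.inr ⟨l, l'⟩
        · exact Or.inr ⟨h, h'⟩
        · exact Or.inr ⟨h, l'⟩ }

section

variable {n : ℕ} {lam : NumPart (n + 1)} {J : Finset (Fin (n + 1))}

theorem NumPart.IsI.last_notMem (hJ : lam.IsI J) : Fin.last n ∉ J := by
  intro h
  obtain ⟨i, hi, hne⟩ := Finset.exists_mem_ne (s := J) (by have := hJ.two_le; omega) (Fin.last n)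
  have h1 : ∑ j ∈ {i, Fin.last n}, lam.part j ≤ ∑ j ∈ J, lam.part j :=
    Finset.sum_le_sum_of_subset (by
      intro k hk
      simp only [Finset.mem_insert, Finset.mem_singleton] at hk
      rcases hk with rfl | rfl <;> assumption)
  rw [Finset.sum_pair hne, ← hJ.sum_eq] at h1
  have := lam.part_pos i
  omega

theorem NumPart.IsI.pos (hJ : lam.IsI J) : 0 < n := by
  have h1 := hJ.two_le
  have h2 := Finset.card_le_univ J
  simp only [Fintype.card_fin] at h2
  omega

theorem NumPart.IsI.compl_card_pos (hJ : lam.IsI J) : 0 < Jᶜ.card :=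
  Finset.card_pos.2 ⟨Fin.last n, by simpa using hJ.last_notMem⟩

/-- `(λ_1, ..., λ_n)`, for a partition `λ` with `n + 1` parts, `n ≥ 1`. -/
def NumPart.init (lam : NumPart (n + 1)) (hn : 0 < n) : NumPart n where
  part i := lam.part i.castSucc
  len_pos := hn
  part_pos _ := lam.part_pos _
  mono _ _ h := lam.mono (Fin.castSucc_le_castSucc_iff.2 h)

/-- `μ = (λ_{j_1}, ..., λ_{j_t})`, where `j_1 < ... < j_t` are the indices outside `J`. -/
def NumPart.delete (lam : NumPart (n + 1)) (J : Finset (Fin (n + 1))) (h : 0 < Jᶜ.card) :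
    NumPart Jᶜ.card where
  part s := lam.part (Jᶜ.orderEmbOfFin rfl s)
  len_pos := h
  part_pos _ := lam.part_pos _
  mono _ _ h := lam.mono ((Jᶜ.orderEmbOfFin rfl).monotone h)

/-- The part of `J` below the last index, as a subset of the first `n` indices. -/
def initSet (J : Finset (Fin (n + 1))) : Finset (Fin n) :=
  Finset.univ.filter fun i => i.castSucc ∈ J

/-- The number `s` of an index `j = j_s` outside `J`. -/
def complIndex (J : Finset (Fin (n + 1))) (j : Fin (n + 1)) (hj : j ∉ J) : Fin Jᶜ.card :=
  (Jᶜ.orderIsoOfFin rfl).symm ⟨j, by simpa using hj⟩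

theorem orderEmb_complIndex (J : Finset (Fin (n + 1))) (j : Fin (n + 1)) (hj : j ∉ J) :
    Jᶜ.orderEmbOfFin rfl (complIndex J j hj) = j := by
  rw [← Finset.coe_orderIsoOfFin_apply, complIndex, OrderIso.apply_symm_apply]

theorem orderEmb_notMem (J : Finset (Fin (n + 1))) (s : Fin Jᶜ.card) :
    Jᶜ.orderEmbOfFin rfl s ∉ J :=
  Finset.mem_compl.1 (Finset.orderEmbOfFin_mem Jᶜ rfl s)

theorem complIndex_orderEmb (J : Finset (Fin (n + 1))) (s : Fin Jᶜ.card) :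
    complIndex J (Jᶜ.orderEmbOfFin rfl s) (orderEmb_notMem J s) = s :=
  (Jᶜ.orderEmbOfFin rfl).injective (orderEmb_complIndex _ _ _)

/-- The ordered set partition of the first `n` indices that glues `J` to one block: the block of
`j_s ∉ J` has number `s`, and the block `J` has the number of the last index, whose part is the
sum of the parts indexed by `J`. -/
def NumPart.IsI.glue (hJ : lam.IsI J) : OrdPart n Jᶜ.card where
  block i := if h : i.castSucc ∈ J then complIndex J (Fin.last n) hJ.last_notMem
    else complIndex J i.castSucc h
  surj := by
    intro s
    have hs : Jᶜ.orderEmbOfFin rfl s ∉ J := orderEmb_notMem J s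
    by_cases hl : Jᶜ.orderEmbOfFin rfl s = Fin.last n
    · obtain ⟨i, hi⟩ : J.Nonempty := Finset.card_pos.1 (by have := hJ.two_le; omega)
      have hil : i ≠ Fin.last n := fun h => hJ.last_notMem (h ▸ hi)
      refine ⟨i.castPred hil, ?_⟩
      change dite _ _ _ = _
      rw [dif_pos (by simpa using hi)]
      refine (Jᶜ.orderEmbOfFin rfl).injective ?_
      rw [orderEmb_complIndex, hl]
    · refine ⟨(Jᶜ.orderEmbOfFin rfl s).castPred hl, ?_⟩
      change dite _ _ _ = _
      rw [dif_neg (by simpa using hs)]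
      refine (Jᶜ.orderEmbOfFin rfl).injective ?_
      rw [orderEmb_complIndex, Fin.castSucc_castPred]

/-- With `ρ` the gluing partition of `J = I(λ)`, the cut `ρ T` of the cut `T` of
`(λ_1, ..., λ_n)` is the cut of `μ`. -/
theorem NumPart.IsI.glue_act (hJ : lam.IsI J) :
    (lam.init hJ.pos).cut.act hJ.glue = (lam.delete J hJ.compl_card_pos).cut := by
  have key : ∀ t : Fin Jᶜ.card → ℝ,
      ∑ i : Fin n, t (hJ.glue.block i) * (lam.part i.castSucc : ℝ) =
        ∑ s, t s * (lam.part (Jᶜ.orderEmbOfFin rfl s) : ℝ) := by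
    intro t
    let x : Fin (n + 1) → ℝ := fun k =>
      if h : k ∈ J then t (complIndex J (Fin.last n) hJ.last_notMem) else t (complIndex J k h)
    have h1 : ∀ i : Fin n, t (hJ.glue.block i) = x i.castSucc := by
      intro i
      change t (dite _ _ _) = dite _ _ _
      split_ifs <;> rfl
    have h2 := Fin.sum_univ_castSucc fun k => x k * (lam.part k : ℝ)
    have h3 := Finset.sum_add_sum_compl J fun k => x k * (lam.part k : ℝ)
    have h4 : ∑ k ∈ J, x k * (lam.part k : ℝ) = x (Fin.last n) * (lam.part (Fin.last n) : ℝ) := by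
      rw [hJ.sum_eq, Nat.cast_sum, Finset.mul_sum]
      refine Finset.sum_congr rfl fun k hk => ?_
      simp only [x, dif_pos hk, dif_neg hJ.last_notMem]
    have h5 : ∑ k ∈ Jᶜ, x k * (lam.part k : ℝ) =
        ∑ s, t s * (lam.part (Jᶜ.orderEmbOfFin rfl s) : ℝ) := by
      rw [← Finset.sum_coe_sort,
        ← Equiv.sum_comp (Jᶜ.orderIsoOfFin rfl).toEquiv]
      refine Finset.sum_congr rfl fun s _ => ?_
      have h6 : ((Jᶜ.orderIsoOfFin rfl).toEquiv s : Fin (n + 1)) = Jᶜ.orderEmbOfFin rfl s := rfl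
      rw [h6]
      simp only [x, dif_neg (orderEmb_notMem J s), complIndex_orderEmb]
    simp only [h1]
    linarith
  refine Cut.ext (Set.ext fun t => ?_)
  have := key (vec t)
  change (∑ i : Fin n, vec t (hJ.glue.block i) * (lam.part i.castSucc : ℝ) = 0) ↔
    (∑ s, vec t s * (lam.part (Jᶜ.orderEmbOfFin rfl s) : ℝ) = 0)
  rw [this]

/-- The inclusion morphism from the cut of `μ` to the cut of `(λ_1, ..., λ_n)`. -/
def NumPart.IsI.glueHom (hJ : lam.IsI J) :
    (lam.delete J hJ.compl_card_pos).cut.obj ⟶ (lam.init hJ.pos).cut.obj :=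
  ResCat.Hom.mk hJ.glue (by
    intro t ht
    rw [← hJ.glue_act] at ht
    exact ht)

end

end Resonance

open Resonance

namespace Resonance

open Topology

/-! ### Pointed homotopies -/

section Homotopy

variable {X Y Z X' Y' : PTop.{u}}

/-! The argument runs over the cuts `ortho w` of positive weight vectors, a class stable under
gluing: the weights of a block add up. Fix a weight `c` and let `theta w c` consist of the
partitions in which some block contains a decomposition of `c` into two or more weights. Two
conditions, `Exchange` and `Splits`, carry the induction; for the largest part of a sequential
partition both follow from sequentiality. `Exchange` makes every decomposition of `c` reachable from
the lexicographically largest one, `J`, and `Splits` makes `theta w c` closed, so the partition with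
block `J` generates exactly `theta w c` (`IsMaxRep.down_eq`). By (A1), collapsing the image of the
cut with `J` glued gives the quotient by `theta w c`. A sign vector that survives outside `theta w
c` has equally many elements of weight `c` on its two sides, so (A2) and (A3) turn this quotient
into a smash product with `F(1^m)`, where `m` is the multiplicity of `c`
(`IsResonanceFunctor.quot_theta_phe_smash`).

Gluing `J` preserves both conditions and raises `m` by one. If `m ≥ 2`, induction on the number of
coordinates makes the collapsed subspace contractible, so the value is a smash product with the
contractible space `F(1^m)` (`IsResonanceFunctor.pContractible_of_splits`). With `c` the largest
part this is the first claim. If the largest part occurs once, gluing `J` makes it occur twice, so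
the collapsed subspace is contractible again, and the smash decomposition with `F(1)` follows.

In the strongly sequential case, glue only a subset of `I(λ) ∖ {q}` of sum `λ_q`, where `q = max
I(λ)`. Now `λ_q` occurs at least twice, and `Splits` holds for it although heavier parts are
present; this is where the maximality of `I(λ)` enters (`NumPart.IsI.exists_subset_of_balance`). The
value on this intermediate cut is contractible, and the map `i` factors through it, hence is
null-homotopic. The cofibre of a null-homotopic cofibration splits as a wedge with a suspension, and
smashing with `F(1)` distributes over the wedge and the suspension. The spaces are arbitrary, so
these last facts need care with quotient topologies. -/

theorem PHomotopic.of_fun {f g : X ⟶ Y} (H : X × unitInterval → Y) (hc : Continuous H)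
    (h0 : ∀ x, H (x, 0) = f.map x) (h1 : ∀ x, H (x, 1) = g.map x)
    (hpt : ∀ t, H (X.pt, t) = Y.pt) : PHomotopic f g :=
  ⟨{ toFun := fun p => H (p.2, p.1)
     continuous_toFun := hc.comp (continuous_snd.prodMk continuous_fst)
     map_zero_left := h0
     map_one_left := h1
     prop' := by
       rintro t _ rfl
       exact (hpt t).trans f.map_pt.symm }⟩

theorem PHomotopic.exists_fun {f g : X ⟶ Y} (h : PHomotopic f g) :
    ∃ H : X × unitInterval → Y, Continuous H ∧ (∀ x, H (x, 0) = f.map x) ∧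
      (∀ x, H (x, 1) = g.map x) ∧ ∀ t, H (X.pt, t) = Y.pt := by
  obtain ⟨H⟩ := h
  refine ⟨fun p => H (p.2, p.1), by fun_prop, fun x => H.apply_zero x, fun x => H.apply_one x,
    fun t => ?_⟩
  exact (H.eq_fst t rfl).trans f.map_pt

theorem PHomotopic.refl (f : X ⟶ Y) : PHomotopic f f := ContinuousMap.HomotopicRel.refl _

theorem PHomotopic.symm {f g : X ⟶ Y} (h : PHomotopic f g) : PHomotopic g f :=
  ContinuousMap.HomotopicRel.symm h

theorem PHomotopic.trans {f g h : X ⟶ Y} (h₁ : PHomotopic f g) (h₂ : PHomotopic g h) :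
    PHomotopic f h := ContinuousMap.HomotopicRel.trans h₁ h₂

theorem PHomotopic.of_eq {f g : X ⟶ Y} (h : ∀ x, f.map x = g.map x) : PHomotopic f g := by
  have : f = g := PTop.Hom.ext (ContinuousMap.ext h)
  exact this ▸ PHomotopic.refl f

theorem PHomotopic.comp_left (f : X ⟶ Y) {g h : Y ⟶ Z} (H : PHomotopic g h) :
    PHomotopic (f ≫ g) (f ≫ h) := by
  obtain ⟨K, hK, h0, h1, hp⟩ := H.exists_fun
  refine .of_fun (fun p => K (f.map p.1, p.2)) (by fun_prop) (fun x => h0 _) (fun x => h1 _) ?_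
  intro t
  simp only [f.map_pt, hp]

theorem PHomotopic.comp_right {f g : X ⟶ Y} (H : PHomotopic f g) (h : Y ⟶ Z) :
    PHomotopic (f ≫ h) (g ≫ h) := by
  obtain ⟨K, hK, h0, h1, hp⟩ := H.exists_fun
  refine .of_fun (fun p => h.map (K p)) (by fun_prop) (fun x => congrArg h.map (h0 x))
    (fun x => congrArg h.map (h1 x)) ?_
  intro t
  simp only [h.map_pt, hp]

theorem IsPHE.of_inverse {f : X ⟶ Y} {g : Y ⟶ X} (h₁ : ∀ x, g.map (f.map x) = x)
    (h₂ : ∀ y, f.map (g.map y) = y) : IsPHE f :=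
  ⟨g, .of_eq h₁, .of_eq h₂⟩

theorem IsPHE.comp {f : X ⟶ Y} {g : Y ⟶ Z} (hf : IsPHE f) (hg : IsPHE g) : IsPHE (f ≫ g) := by
  obtain ⟨f', h₁, h₂⟩ := hf
  obtain ⟨g', h₃, h₄⟩ := hg
  refine ⟨g' ≫ f', ?_, ?_⟩
  · have := (h₃.comp_left f).comp_right f'
    simp only [Category.assoc, Category.comp_id] at this ⊢
    exact this.trans h₁
  · have := (h₂.comp_left g').comp_right g
    simp only [Category.assoc, Category.comp_id] at this ⊢
    exact this.trans h₄

theorem PHE.refl (X : PTop.{u}) : PHE X X := ⟨𝟙 X, .of_inverse (g := 𝟙 X) (fun _ => rfl) fun _ => rfl⟩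

theorem PHE.symm (h : PHE X Y) : PHE Y X := by
  obtain ⟨f, g, h₁, h₂⟩ := h
  exact ⟨g, f, h₂, h₁⟩

theorem PHE.trans (h : PHE X Y) (k : PHE Y Z) : PHE X Z := by
  obtain ⟨f, hf⟩ := h
  obtain ⟨g, hg⟩ := k
  exact ⟨f ≫ g, hf.comp hg⟩

/-- The identity is homotopic, through pointed maps, to the trivial map. -/
def PContractible (X : PTop.{u}) : Prop := PHomotopic (𝟙 X) (trivialMap X X)

theorem PContractible.of_phe (hX : PContractible X) (h : PHE X Y) : PContractible Y := by
  obtain ⟨f, g, -, h₂⟩ := h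
  have h₃ := (PHomotopic.comp_left g hX).comp_right f
  rw [Category.comp_id] at h₃
  exact (h₂.symm.trans h₃).trans (.of_eq fun y => f.map_pt)

theorem PContractible.contractibleSpace (hX : PContractible X) : ContractibleSpace X := by
  rw [contractible_iff_id_nullhomotopic]
  obtain ⟨H⟩ := hX
  exact ⟨X.pt, ⟨H.toHomotopy⟩⟩

/-- Used with `Y` the value on an intermediate cut through which the gluing morphism factors. -/
theorem PContractible.comp_phomotopic_trivialMap (hY : PContractible Y) (f : X ⟶ Y) (g : Y ⟶ Z) :
    PHomotopic (f ≫ g) (trivialMap X Z) := by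
  have h := (PHomotopic.comp_left f hY).comp_right g
  rw [Category.comp_id] at h
  exact h.trans (.of_eq fun x => g.map_pt)

end Homotopy

/-! ### Maps out of quotients -/

section Collapse

variable {X Y Z : PTop.{u}} {A : Set X}

theorem collapseProj_isQuotientMap (X : PTop.{u}) (A : Set X) :
    IsQuotientMap (collapseProj X A).map := isQuotientMap_quot_mk

theorem collapse_surj (x : collapse X A) : ∃ y, (collapseProj X A).map y = x :=
  Quotient.exists_rep x

theorem collapseProj_eq_pt {x : X} (h : x ∈ A) :
    (collapseProj X A).map x = (collapse X A).pt :=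
  Quotient.sound (Or.inr ⟨Set.mem_insert_of_mem _ h, Set.mem_insert _ _⟩)

theorem collapseProj_eq_iff {x y : X} :
    (collapseProj X A).map x = (collapseProj X A).map y ↔
      x = y ∨ (x ∈ insert X.pt A ∧ y ∈ insert X.pt A) := Quotient.eq

/-- The pointed map out of `X / A` induced by a map that is trivial on `A`. -/
def collapseDesc (f : X ⟶ Y) (h : ∀ x ∈ A, f.map x = Y.pt) : collapse X A ⟶ Y :=
  PTop.Hom.mk
    ⟨Quotient.lift f.map (by
      have hA : ∀ x ∈ insert X.pt A, f.map x = Y.pt := by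
        rintro x (rfl | hx)
        · exact f.map_pt
        · exact h x hx
      rintro x y (rfl | ⟨hx, hy⟩)
      · rfl
      · rw [hA x hx, hA y hy]), f.map.continuous.quotient_lift _⟩ f.map_pt

/-- A continuous map on `X × P`, `P` locally compact, that is constant on `A × {p}` for all `p`,
factors through `X / A × P`. -/
theorem exists_collapse_prod_lift {P Z : Type*} [TopologicalSpace P] [LocallyCompactSpace P]
    [TopologicalSpace Z] (H : X × P → Z) (hH : Continuous H)
    (hA : ∀ x ∈ A, ∀ t, H (x, t) = H (X.pt, t)) :
    ∃ K : collapse X A × P → Z, Continuous K ∧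
      ∀ x t, K ((collapseProj X A).map x, t) = H (x, t) := by
  refine ⟨fun p => Quotient.lift (fun x => H (x, p.2)) ?_ p.1, ?_, fun _ _ => rfl⟩
  · have hA' : ∀ x ∈ insert X.pt A, ∀ t, H (x, t) = H (X.pt, t) := by
      rintro x (rfl | hx) t
      · rfl
      · exact hA x hx t
    rintro x y (rfl | ⟨hx, hy⟩)
    · rfl
    · simp only [hA' x hx, hA' y hy]
  -- The product of a quotient map with the identity of a locally compact space is again a quotient
  -- map.
  · exact (collapseProj_isQuotientMap X A).continuous_lift_prod_left hH

/-- The homotopies on smash products, wedges and suspensions are all built on representatives in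
this way. -/
theorem PHomotopic.of_collapse {f g : collapse X A ⟶ Y} (H : X × unitInterval → Y)
    (hc : Continuous H) (h0 : ∀ x, H (x, 0) = f.map ((collapseProj X A).map x))
    (h1 : ∀ x, H (x, 1) = g.map ((collapseProj X A).map x))
    (hpt : ∀ t, H (X.pt, t) = Y.pt) (hA : ∀ x ∈ A, ∀ t, H (x, t) = Y.pt) : PHomotopic f g := by
  obtain ⟨K, hK, hK'⟩ := exists_collapse_prod_lift H hc (A := A)
    fun x hx t => (hA x hx t).trans (hpt t).symm
  refine .of_fun K hK ?_ ?_ fun t => (hK' X.pt t).trans (hpt t)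
  · intro x
    obtain ⟨x, rfl⟩ := collapse_surj x
    rw [hK', h0]
  · intro x
    obtain ⟨x, rfl⟩ := collapse_surj x
    rw [hK', h1]

theorem PHE.collapse_empty (X : PTop.{u}) : PHE (collapse X ∅) X := by
  refine ⟨collapseDesc (𝟙 X) (by simp), .of_inverse (g := collapseProj X ∅) ?_ fun (_ : X) => rfl⟩
  intro x
  obtain ⟨x, rfl⟩ := collapse_surj x
  rfl

end Collapse

/-! ### Smash products, wedges and suspensions -/

section Constructions

variable {X Y Z X' Y' : PTop.{u}}

/-- The map of smash products induced by two pointed maps. -/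
def smashMap (f : X ⟶ X') (g : Y ⟶ Y') : smash X Y ⟶ smash X' Y' :=
  collapseDesc (PTop.Hom.mk ⟨fun p => (collapseProj _ _).map (f.map p.1, g.map p.2),
      (collapseProj _ _).map.continuous.comp (by fun_prop)⟩
      (collapseProj_eq_pt (Or.inl f.map_pt))) (by
    rintro ⟨x, y⟩ (h | h)
    · exact collapseProj_eq_pt (Or.inl ((congrArg f.map h).trans f.map_pt))
    · exact collapseProj_eq_pt (Or.inr ((congrArg g.map h).trans g.map_pt)))

theorem PHomotopic.smash {f f' : X ⟶ X'} {g g' : Y ⟶ Y'} (hf : PHomotopic f f')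
    (hg : PHomotopic g g') : PHomotopic (smashMap f g) (smashMap f' g') := by
  obtain ⟨K, hK, h0, h1, hp⟩ := hf.exists_fun
  obtain ⟨K', hK', h0', h1', hp'⟩ := hg.exists_fun
  have hA : ∀ p : X × Y, p.1 = X.pt ∨ p.2 = Y.pt → ∀ t, (collapseProj ⟨X' × Y', (X'.pt, Y'.pt)⟩
      {p : X' × Y' | p.1 = X'.pt ∨ p.2 = Y'.pt}).map (K (p.1, t), K' (p.2, t)) =
        (Resonance.smash X' Y').pt := by
    rintro ⟨x, y⟩ (h | h) t
    · exact collapseProj_eq_pt (Or.inl (by simp only at h; simp only [h, hp]))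
    · exact collapseProj_eq_pt (Or.inr (by simp only at h; simp only [h, hp']))
  refine .of_collapse (fun p => (collapseProj _ _).map (K (p.1.1, p.2), K' (p.1.2, p.2)))
    ((collapseProj _ _).map.continuous.comp (by fun_prop)) ?_ ?_ ?_ ?_
  · rintro ⟨x, y⟩
    simp only [h0, h0']
    rfl
  · rintro ⟨x, y⟩
    simp only [h1, h1']
    rfl
  · exact hA (X.pt, Y.pt) (Or.inl rfl)
  · exact hA

theorem smashMap_comp_phomotopic_id {f : X ⟶ X'} {f' : X' ⟶ X} {g : Y ⟶ Y'} {g' : Y' ⟶ Y}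
    (hf : PHomotopic (f ≫ f') (𝟙 X)) (hg : PHomotopic (g ≫ g') (𝟙 Y)) :
    PHomotopic (smashMap f g ≫ smashMap f' g') (𝟙 (smash X Y)) := by
  refine PHomotopic.trans (.of_eq ?_) ((hf.smash hg).trans (.of_eq ?_)) <;>
  · intro x
    obtain ⟨x, rfl⟩ := collapse_surj x
    rfl

theorem PHE.smash (h : PHE X X') (k : PHE Y Y') : PHE (smash X Y) (smash X' Y') := by
  obtain ⟨f, f', h₁, h₂⟩ := h
  obtain ⟨g, g', k₁, k₂⟩ := k
  exact ⟨smashMap f g, smashMap f' g', smashMap_comp_phomotopic_id h₁ k₁,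
    smashMap_comp_phomotopic_id h₂ k₂⟩

/-- The symmetry of the smash product. -/
def smashSwap (X Y : PTop.{u}) : smash X Y ⟶ smash Y X :=
  collapseDesc (PTop.Hom.mk ⟨fun p => (collapseProj _ _).map (p.2, p.1),
      (collapseProj _ _).map.continuous.comp (by fun_prop)⟩ rfl) (by
    rintro ⟨x, y⟩ h
    exact collapseProj_eq_pt (Or.symm h))

theorem PHE.smash_comm (X Y : PTop.{u}) : PHE (Resonance.smash X Y) (Resonance.smash Y X) := by
  refine ⟨smashSwap X Y, .of_inverse (g := smashSwap Y X) ?_ ?_⟩ <;>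
  · intro x
    obtain ⟨x, rfl⟩ := collapse_surj x
    rfl

theorem PContractible.smash_right (hY : PContractible Y) (X : PTop.{u}) :
    PContractible (smash X Y) := by
  refine PHomotopic.trans (.of_eq ?_) (((PHomotopic.refl (𝟙 X)).smash hY).trans (.of_eq ?_))
  · intro x
    obtain ⟨x, rfl⟩ := collapse_surj x
    rfl
  · intro x
    obtain ⟨x, rfl⟩ := collapse_surj x
    exact collapseProj_eq_pt (Or.inr rfl)

/-- The inclusion of the first summand of a wedge. -/
def wedgeInl (X Y : PTop.{u}) : X ⟶ wedge X Y :=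
  PTop.Hom.mk ⟨fun x => (collapseProj _ _).map (Sum.inl x),
    (collapseProj _ _).map.continuous.comp continuous_inl⟩ rfl

/-- The inclusion of the second summand of a wedge. -/
def wedgeInr (X Y : PTop.{u}) : Y ⟶ wedge X Y :=
  PTop.Hom.mk ⟨fun x => (collapseProj _ _).map (Sum.inr x),
    (collapseProj _ _).map.continuous.comp continuous_inr⟩ (collapseProj_eq_pt rfl)

/-- The map out of a wedge with given restrictions to the summands. -/
def wedgeDesc (f : X ⟶ Z) (g : Y ⟶ Z) : wedge X Y ⟶ Z :=
  collapseDesc (PTop.Hom.mk ⟨Sum.elim f.map g.map,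
      continuous_sum_dom.2 ⟨f.map.continuous, g.map.continuous⟩⟩ f.map_pt) (by
    rintro _ rfl
    exact g.map_pt)

theorem wedge_cases (p : wedge X Y) :
    (∃ x, (wedgeInl X Y).map x = p) ∨ ∃ y, (wedgeInr X Y).map y = p := by
  obtain ⟨x | y, rfl⟩ := collapse_surj p
  · exact Or.inl ⟨x, rfl⟩
  · exact Or.inr ⟨y, rfl⟩

theorem PHomotopic.of_wedge {f g : Resonance.wedge X Y ⟶ Z}
    (h : PHomotopic (wedgeInl X Y ≫ f) (wedgeInl X Y ≫ g))
    (k : PHomotopic (wedgeInr X Y ≫ f) (wedgeInr X Y ≫ g)) : PHomotopic f g := by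
  obtain ⟨K, hK, h0, h1, hp⟩ := h.exists_fun
  obtain ⟨K', hK', h0', h1', hp'⟩ := k.exists_fun
  refine .of_collapse (fun p => Sum.elim (fun x => K (x, p.2)) (fun y => K' (y, p.2)) p.1)
    ?_ ?_ ?_ hp ?_
  -- Curried, the homotopy is a map from a disjoint union to a path space, so continuity is checked
  -- on each summand.
  · have h1 : Continuous (Sum.elim (ContinuousMap.curry ⟨K, hK⟩) (ContinuousMap.curry ⟨K', hK'⟩)) :=
      continuous_sum_dom.2 ⟨ContinuousMap.continuous _, ContinuousMap.continuous _⟩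
    have h2 := ContinuousMap.continuous_uncurry_of_continuous ⟨_, h1⟩
    refine h2.congr ?_
    rintro ⟨x | y, t⟩ <;> rfl
  · rintro (x | y)
    · exact h0 x
    · exact h0' y
  · rintro (x | y)
    · exact h1 x
    · exact h1' y
  · rintro _ rfl t
    exact hp' t

theorem PHE.wedge (h : PHE X X') (k : PHE Y Y') :
    PHE (Resonance.wedge X Y) (Resonance.wedge X' Y') := by
  obtain ⟨f, f', h₁, h₂⟩ := h
  obtain ⟨g, g', k₁, k₂⟩ := k
  exact ⟨wedgeDesc (f ≫ wedgeInl _ _) (g ≫ wedgeInr _ _),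
    wedgeDesc (f' ≫ wedgeInl _ _) (g' ≫ wedgeInr _ _),
    .of_wedge (h₁.comp_right (wedgeInl X Y)) (k₁.comp_right (wedgeInr X Y)),
    .of_wedge (h₂.comp_right (wedgeInl X' Y')) (k₂.comp_right (wedgeInr X' Y'))⟩

end Constructions

/-! ### Cofibrations -/

/-- The retraction of the real line onto the unit interval. -/
noncomputable def clamp (r : ℝ) : unitInterval := Set.projIcc 0 1 zero_le_one r

@[fun_prop]
theorem continuous_clamp : Continuous clamp := continuous_projIcc (h := zero_le_one)

theorem clamp_of_le_zero {r : ℝ} (h : r ≤ 0) : clamp r = 0 := Set.projIcc_of_le_left _ h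

theorem clamp_of_one_le {r : ℝ} (h : 1 ≤ r) : clamp r = 1 := Set.projIcc_of_right_le _ h

theorem clamp_coe (t : unitInterval) : clamp t = t := Set.projIcc_val _ t

/-- A homotopy whose restriction to the cofibrant subspace `A` is a family of null-homotopic loops
can be replaced by a homotopy with the same ends that is stationary on `A`. -/
theorem IsClosedCofibration.exists_stationary {A X Z : Type u} [TopologicalSpace A]
    [TopologicalSpace X] [TopologicalSpace Z] {i : C(A, X)} (hi : IsClosedCofibration i)
    (G : X × unitInterval → Z) (hG : Continuous G)
    (D : (A × unitInterval) × unitInterval → Z) (hD : Continuous D) (z : A → Z)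
    (h0 : ∀ a t, D ((a, 0), t) = G (i a, t)) (h1 : ∀ a t, D ((a, 1), t) = z a)
    (hl : ∀ a s, D ((a, s), 0) = z a) (hr : ∀ a s, D ((a, s), 1) = z a) :
    ∃ H : X × unitInterval → Z, Continuous H ∧ (∀ x, H (x, 0) = G (x, 0)) ∧
      (∀ x, H (x, 1) = G (x, 1)) ∧ ∀ a t, H (i a, t) = z a := by
  -- The homotopy extension property is applied to maps into the path space of `Z`: the deformation
  -- `D` of the paths over `A` extends to a deformation of all the paths of `G`.
  obtain ⟨K, hK0, hK1⟩ := hi.2 C(unitInterval, Z) (ContinuousMap.curry ⟨G, hG⟩)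
    (ContinuousMap.curry ⟨D, hD⟩) (fun a => ContinuousMap.ext fun t => h0 a t)
  have hKG : ∀ x t, K (x, 0) t = G (x, t) := fun x t => by rw [hK0]; rfl
  have hKD : ∀ a s t, K (i a, s) t = D ((a, s), t) := fun a s t => by rw [hK1]; rfl
  -- Run along the other three sides of the parameter square: up at time `0`, across at stage `1`,
  -- down at time `1`. Over `A` all three sides are constant.
  refine ⟨fun p => K (p.1, clamp (min (3 * p.2) (3 - 3 * p.2))) (clamp (3 * p.2 - 1)), ?_, ?_, ?_,
    ?_⟩
  · have h := ContinuousMap.continuous_uncurry_of_continuous K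
    exact h.comp (f := fun p : X × unitInterval =>
      ((p.1, clamp (min (3 * p.2) (3 - 3 * p.2))), clamp (3 * p.2 - 1))) (by fun_prop)
  · intro x
    rw [← hKG]
    simp only [Set.Icc.coe_zero]
    rw [clamp_of_le_zero (by norm_num), clamp_of_le_zero (by norm_num)]
  · intro x
    rw [← hKG]
    simp only [Set.Icc.coe_one]
    rw [clamp_of_le_zero (by norm_num), clamp_of_one_le (by norm_num)]
  · intro a t
    simp only [hKD]
    rcases le_total (3 * (t : ℝ)) 1 with h | h
    · rw [clamp_of_le_zero (r := 3 * (t : ℝ) - 1) (by linarith), hl]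
    · rcases le_total (3 * (t : ℝ)) 2 with h' | h'
      · rw [clamp_of_one_le (le_min h (by linarith)), h1]
      · rw [clamp_of_one_le (r := 3 * (t : ℝ) - 1) (by linarith), hr]

/-- A free contraction moves the base point along a path. Running that path backwards afterwards
brings the end to the base point, and the base point has then described a null-homotopic loop, which
`IsClosedCofibration.exists_stationary` removes. -/
theorem WellPointed.pContractible {X : PTop.{u}} (hX : WellPointed X) [h : ContractibleSpace X] :
    PContractible X := by
  rw [contractible_iff_id_nullhomotopic] at h
  obtain ⟨p, ⟨H⟩⟩ := h
  have hH0 : ∀ x, H (0, x) = x := H.apply_zero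
  have hH1 : ∀ x, H (1, x) = p := H.apply_one
  obtain ⟨K, hK, hK0, hK1, hKA⟩ := IsClosedCofibration.exists_stationary hX
    (fun q => if (q.2 : ℝ) ≤ 1 / 2 then H (clamp (2 * q.2), q.1) else
      H (clamp (2 - 2 * q.2), X.pt))
    (by
      refine Continuous.if_le (by fun_prop) (by fun_prop) (by fun_prop) (by fun_prop) ?_
      intro q hq
      rw [hq, clamp_of_one_le (by norm_num), clamp_of_one_le (by norm_num), hH1, hH1])
    -- The null-homotopy of the loop: travel ever shorter initial pieces of the track and return.
    (fun q => H (clamp ((1 - q.1.2) * min (2 * (q.2 : ℝ)) (2 - 2 * q.2)), X.pt)) (by fun_prop)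
    (fun _ => X.pt)
    (by
      intro a t
      simp only [Set.Icc.coe_zero, sub_zero, one_mul, ContinuousMap.const_apply]
      split_ifs with h
      · rw [min_eq_left (by linarith)]
      · rw [min_eq_right (by linarith)])
    (by
      intro a t
      simp only [Set.Icc.coe_one, sub_self, zero_mul]
      rw [clamp_of_le_zero le_rfl, hH0])
    (by
      intro a t
      simp only [Set.Icc.coe_zero]
      rw [clamp_of_le_zero (by norm_num), hH0])
    (by
      intro a t
      simp only [Set.Icc.coe_one]
      rw [clamp_of_le_zero (by norm_num), hH0])
  refine .of_fun K hK ?_ ?_ (hKA PUnit.unit)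
  · intro x
    rw [hK0]
    simp only [Set.Icc.coe_zero]
    rw [if_pos (by norm_num), clamp_of_le_zero (by norm_num), hH0]
    rfl
  · intro x
    rw [hK1]
    simp only [Set.Icc.coe_one]
    rw [if_neg (by norm_num), clamp_of_le_zero (by norm_num), hH0]
    rfl

/-- Extend the contraction of `A` to a homotopy of the identity of `X`. Its end sends the image of
`A` to the base point, and the induced map on the quotient is the homotopy inverse. -/
theorem isPHE_collapseProj {A X : PTop.{u}} (i : A ⟶ X) (hi : IsClosedCofibration i.map)
    (hA : PContractible A) : IsPHE (collapseProj X (Set.range i.map)) := by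
  obtain ⟨h, hc, h0, h1, hp⟩ := hA.exists_fun
  obtain ⟨K, hK0, hK1⟩ := hi.2 X (ContinuousMap.id X) ⟨fun p => i.map (h p), by fun_prop⟩
    (fun a => congrArg i.map (h0 a))
  simp only [ContinuousMap.coe_mk] at hK1
  have hKp : ∀ t, K (X.pt, t) = X.pt := by
    intro t
    rw [← i.map_pt, hK1, hp]
  have hKA : ∀ x ∈ Set.range i.map, K (x, 1) = X.pt := by
    rintro _ ⟨a, rfl⟩
    rw [hK1, h1, ← i.map_pt]
    rfl
  refine ⟨collapseDesc (PTop.Hom.mk ⟨fun x => K (x, 1), by fun_prop⟩ (hKp 1)) hKA, ?_, ?_⟩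
  · exact (PHomotopic.of_fun K K.continuous hK0 (fun _ => rfl) hKp).symm
  · refine (PHomotopic.of_collapse (fun p => (collapseProj _ _).map (K p))
      ((collapseProj _ _).map.continuous.comp K.continuous) ?_ ?_ ?_ ?_).symm
    · intro x
      simp only [hK0]
      rfl
    · intro x
      rfl
    · intro t
      simp only [hKp]
      rfl
    · rintro _ ⟨a, rfl⟩ t
      rw [hK1]
      exact collapseProj_eq_pt ⟨_, rfl⟩

/-! ### Splitting the cofibre of a null-homotopic cofibration -/

/-- Over `A`, a point of `Y` can be dragged along the null-homotopy to the base point and then once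
through the suspension. Extended to `Y`, this drag ends in a map that kills `A`; the inverse is the
projection on `Y` and the reversed null-homotopy on the suspension. -/
theorem PHE.collapse_of_phomotopic_trivialMap {A Y : PTop.{u}} (i : A ⟶ Y)
    (hi : IsClosedCofibration i.map) (hn : PHomotopic i (trivialMap A Y)) :
    PHE (collapse Y (Set.range i.map)) (Resonance.wedge Y (susp A)) := by
  obtain ⟨N, hN, hN0, hN1, hNp⟩ := hn.exists_fun
  replace hN1 : ∀ a, N (a, 1) = Y.pt := hN1
  let π := collapseProj Y (Set.range i.map)
  let σ := collapseProj (⟨A × unitInterval, (A.pt, 0)⟩ : PTop.{u})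
    {p : A × unitInterval | p.1 = A.pt ∨ p.2 = 0 ∨ p.2 = 1}
  have hσ : ∀ p : A × unitInterval, p.1 = A.pt ∨ p.2 = 0 ∨ p.2 = 1 → σ.map p = (susp A).pt :=
    fun p hp => collapseProj_eq_pt hp
  have hπ : ∀ a, π.map (i.map a) = (collapse Y (Set.range i.map)).pt :=
    fun a => collapseProj_eq_pt ⟨a, rfl⟩
  let W := Resonance.wedge Y (susp A)
  -- The drag: parameters in `[0,1]` follow `N` inside `Y`, those in `[1,2]` cross the suspension.
  let P : A × ℝ → W := fun q => if q.2 ≤ 1 then (wedgeInl Y (susp A)).map (N (q.1, clamp q.2)) else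
    (wedgeInr Y (susp A)).map (σ.map (q.1, clamp (q.2 - 1)))
  have hPl : ∀ a u, u ≤ 1 → P (a, u) = (wedgeInl Y (susp A)).map (N (a, clamp u)) :=
    fun a u hu => if_pos hu
  have hP1 : ∀ a, P (a, 1) = W.pt := fun a => by
    rw [hPl a 1 le_rfl, clamp_of_one_le le_rfl, hN1, PTop.Hom.map_pt]
  have hPr : ∀ a u, 1 ≤ u → P (a, u) =
      (wedgeInr Y (susp A)).map (σ.map (a, clamp (u - 1))) := by
    intro a u hu
    rcases hu.eq_or_lt with rfl | hu
    · rw [hP1, clamp_of_le_zero (by norm_num), hσ _ (Or.inr (Or.inl rfl)), PTop.Hom.map_pt]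
    · exact if_neg (not_le.2 hu)
  have hP2 : ∀ a, P (a, 2) = W.pt := fun a => by
    rw [hPr a 2 (by norm_num), clamp_of_one_le (by norm_num), hσ _ (Or.inr (Or.inr rfl)),
      PTop.Hom.map_pt]
  have hPp : ∀ u, P (A.pt, u) = W.pt := by
    intro u
    rcases le_total u 1 with hu | hu
    · rw [hPl _ _ hu, hNp, PTop.Hom.map_pt]
    · rw [hPr _ _ hu, hσ _ (Or.inl rfl), PTop.Hom.map_pt]
  have hP : Continuous P := by
    refine Continuous.if_le ((wedgeInl _ _).map.continuous.comp (by fun_prop))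
      ((wedgeInr _ _).map.continuous.comp (σ.map.continuous.comp (by fun_prop))) (by fun_prop)
      (by fun_prop) ?_
    rintro ⟨a, u⟩ hu
    simp only at hu
    rw [← hPl a u hu.le, ← hPr a u hu.ge]
  obtain ⟨M, hM0, hM1⟩ := hi.2 W (wedgeInl Y (susp A)).map
    ⟨fun p => P (p.1, 2 * (p.2 : ℝ)), by fun_prop⟩ (fun a => by
      change P (a, 2 * (0 : unitInterval)) = _
      rw [Set.Icc.coe_zero, mul_zero, hPl a 0 zero_le_one, clamp_of_le_zero le_rfl, hN0])
  replace hM1 : ∀ a (t : unitInterval), M (i.map a, t) = P (a, 2 * (t : ℝ)) := hM1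
  have hMp : ∀ t, M (Y.pt, t) = W.pt := by
    intro t
    rw [← i.map_pt, hM1, hPp]
  have hMA : ∀ a, M (i.map a, 1) = W.pt := fun a => by
    rw [hM1, Set.Icc.coe_one, mul_one, hP2]
  let m : collapse Y (Set.range i.map) ⟶ W :=
    collapseDesc (PTop.Hom.mk ⟨fun y => M (y, 1), by fun_prop⟩ (hMp 1)) (by
      rintro _ ⟨a, rfl⟩
      exact hMA a)
  -- Both ends of the path go to the base point: `N` ends there, and it starts in the image of `A`,
  -- which is collapsed.
  let e' : susp A ⟶ collapse Y (Set.range i.map) :=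
    collapseDesc (PTop.Hom.mk ⟨fun p => π.map (N (p.1, clamp (1 - p.2))),
        π.map.continuous.comp (by fun_prop)⟩ (congrArg π.map (hNp _))) (by
      rintro ⟨a, t⟩ (h | h | h)
      · obtain rfl : a = A.pt := h
        exact congrArg π.map (hNp _)
      · obtain rfl : t = 0 := h
        change π.map (N (a, clamp (1 - (0 : unitInterval)))) = _
        rw [clamp_of_one_le (by simp), hN1]
        rfl
      · obtain rfl : t = 1 := h
        change π.map (N (a, clamp (1 - (1 : unitInterval)))) = _
        rw [clamp_of_le_zero (by simp), hN0, hπ])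
  let e : W ⟶ collapse Y (Set.range i.map) := wedgeDesc π e'
  have heP : ∀ a u, e.map (P (a, u)) = π.map (N (a, clamp (min u (2 - u)))) := by
    intro a u
    rcases le_total u 1 with hu | hu
    · rw [hPl _ _ hu, min_eq_left (by linarith)]
      rfl
    · rw [hPr _ _ hu, min_eq_right (by linarith)]
      change π.map (N (a, clamp (1 - (clamp (u - 1) : ℝ)))) = _
      rcases le_total u 2 with hu' | hu'
      · have : (clamp (u - 1) : ℝ) = u - 1 := by
          rw [clamp, Set.projIcc_of_mem _ ⟨by linarith, by linarith⟩]
        rw [this]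
        congr 4
        ring
      · rw [clamp_of_one_le (r := u - 1) (by linarith), clamp_of_le_zero (r := 2 - u) (by linarith),
          clamp_of_le_zero (by simp)]
  refine ⟨m, e, ?_, ?_⟩
  -- By `heP` the homotopy runs out along `N` and back over `A`; such loops contract, so it can be
  -- made stationary there and descends to the quotient.
  · obtain ⟨H, hH, hH0, hH1, hHA⟩ := hi.exists_stationary (fun p => e.map (M p)) (by fun_prop)
      (fun p => π.map (N (p.1.1, clamp ((1 - p.1.2) * min (2 * (p.2 : ℝ)) (2 - 2 * p.2)))))
      (π.map.continuous.comp (by fun_prop)) (fun _ => (collapse Y (Set.range i.map)).pt)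
      (fun a t => by simp only [hM1, heP, Set.Icc.coe_zero, sub_zero, one_mul])
      (fun a t => by
        simp only [Set.Icc.coe_one, sub_self, zero_mul]
        rw [clamp_of_le_zero le_rfl, hN0, hπ])
      (fun a s => by
        simp only [Set.Icc.coe_zero]
        rw [clamp_of_le_zero (by norm_num), hN0, hπ])
      (fun a s => by
        simp only [Set.Icc.coe_one]
        rw [clamp_of_le_zero (by norm_num), hN0, hπ])
    refine (PHomotopic.of_collapse H hH ?_ ?_ ?_ ?_).symm
    · intro y
      rw [hH0, hM0]
      rfl
    · intro y
      rw [hH1]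
      rfl
    · intro t
      rw [← i.map_pt]
      exact hHA _ t
    · rintro _ ⟨a, rfl⟩ t
      exact hHA a t
  · refine .of_wedge (.symm (.of_fun M M.continuous hM0 (fun y => rfl) hMp)) ?_
    -- `θ` runs from `1` down to `0` and then up to `2`: back along `N`, then the whole drag.
    let θ : unitInterval → ℝ := fun t => max (1 - 2 * (t : ℝ)) (4 * t - 2)
    have hθ : Continuous θ := by fun_prop
    have hθ0 : θ 0 = 1 := by
      simp only [θ, Set.Icc.coe_zero]
      norm_num
    have hθ1 : θ 1 = 2 := by
      simp only [θ, Set.Icc.coe_one]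
      norm_num
    let g : susp A ⟶ W :=
      collapseDesc (PTop.Hom.mk ⟨fun p => P (p.1, θ p.2), by fun_prop⟩ (hPp _)) (by
        rintro ⟨a, t⟩ (h | h | h)
        · obtain rfl : a = A.pt := h
          exact hPp _
        · obtain rfl : t = 0 := h
          change P (a, θ 0) = _
          rw [hθ0, hP1]
        · obtain rfl : t = 1 := h
          change P (a, θ 1) = _
          rw [hθ1, hP2])
    refine PHomotopic.trans (g := g) ?_ ?_
    · have h1 : ∀ r : unitInterval, M (N (A.pt, clamp (1 - r)), r) = W.pt := fun r => by
        rw [hNp, hMp]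
      -- In the square of the parameters of `N` and `M`, the straight edge at stage `1` of `M` is
      -- deformed to the two other edges that join its ends via stage `0`.
      refine .of_collapse
        (fun p => M (N (p.1.1, clamp (1 - ((1 - p.2) * (p.1.2 : ℝ) + p.2 * min (2 * (p.1.2 : ℝ)) 1))),
          clamp ((1 - p.2) + p.2 * max 0 (2 * (p.1.2 : ℝ) - 1)))) (by fun_prop) ?_ ?_ ?_ ?_
      · rintro ⟨a, t⟩
        simp only [Set.Icc.coe_zero, sub_zero, one_mul, zero_mul, add_zero]
        rw [clamp_of_one_le le_rfl]
        rfl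
      · rintro ⟨a, t⟩
        simp only [Set.Icc.coe_one, sub_self, one_mul, zero_mul, zero_add]
        change _ = P (a, θ t)
        rcases le_total (2 * (t : ℝ)) 1 with h | h
        · rw [min_eq_left h, max_eq_left (by linarith), clamp_of_le_zero le_rfl, hM0]
          have : θ t = 1 - 2 * t := max_eq_left (by linarith)
          rw [this, hPl _ _ (by linarith [t.2.1])]
        · rw [min_eq_right h, max_eq_right (by linarith), clamp_of_le_zero (r := 1 - 1) (by simp),
            hN0, hM1]
          have : θ t = 4 * t - 2 := max_eq_right (by linarith)
          rw [this, clamp, Set.projIcc_of_mem _ ⟨by linarith, by linarith [t.2.2]⟩]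
          congr 2
          ring
      · intro t
        simp only [hNp, hMp]
      · rintro ⟨a, t⟩ (h | h | h) r
        · obtain rfl : a = A.pt := h
          simp only [hNp, hMp]
        · obtain rfl : t = 0 := h
          simp only [Set.Icc.coe_zero, mul_zero, add_zero, min_eq_left zero_le_one, sub_zero]
          rw [clamp_of_one_le le_rfl, hN1, hMp]
        · obtain rfl : t = 1 := h
          simp only [Set.Icc.coe_one, mul_one]
          rw [min_eq_right (by norm_num), max_eq_right (by norm_num),
            clamp_of_le_zero (r := 1 - _) (by linarith), clamp_of_one_le (by linarith), hN0, hMA]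
    -- The parameter path `θ` is straightened to `1 + t`, with ends fixed at `1` and `2`; this
    -- cancels the backtracking.
    · refine .of_collapse (fun p => P (p.1.1, (1 - p.2) * θ p.1.2 + p.2 * (1 + p.1.2)))
        (by fun_prop) ?_ ?_ ?_ ?_
      · rintro ⟨a, t⟩
        simp only [Set.Icc.coe_zero, sub_zero, one_mul, zero_mul, add_zero]
        rfl
      · rintro ⟨a, t⟩
        simp only [Set.Icc.coe_one, sub_self, one_mul, zero_mul, zero_add]
        rw [hPr _ _ (by linarith [t.2.1]), add_sub_cancel_left, clamp_coe]
        rfl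
      · intro t
        exact hPp _
      · rintro ⟨a, t⟩ (h | h | h) r
        · obtain rfl : a = A.pt := h
          exact hPp _
        · obtain rfl : t = 0 := h
          simp only [hθ0, Set.Icc.coe_zero]
          have : (1 - (r : ℝ)) * 1 + r * (1 + 0) = 1 := by ring
          rw [this, hP1]
        · obtain rfl : t = 1 := h
          simp only [hθ1, Set.Icc.coe_one]
          have : (1 - (r : ℝ)) * 2 + r * (1 + 1) = 2 := by ring
          rw [this, hP2]

/-! ### Distributivity of the smash product -/

section Smash

variable {X Y Z A : PTop.{u}}

theorem WellPointed.isClosed_pt (hX : WellPointed X) : IsClosed {X.pt} := by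
  have := hX.1.isClosed_range
  rwa [show Set.range (ContinuousMap.const PUnit.{u + 1} X.pt) = {X.pt} from Set.range_const]
    at this

/-- The saturation of a closed set is either the set itself or its union with the collapsed set. -/
theorem collapseProj_isClosedMap {B : Set X} (hB : IsClosed (insert X.pt B)) :
    IsClosedMap (collapseProj X B).map := by
  intro C hC
  rw [← (collapseProj_isQuotientMap X B).isClosed_preimage]
  by_cases h : (C ∩ insert X.pt B).Nonempty
  · convert hC.union hB using 1
    ext x
    simp only [Set.mem_preimage, Set.mem_image, collapseProj_eq_iff]
    obtain ⟨y, hy, hy'⟩ := h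
    constructor
    · rintro ⟨z, hz, rfl | ⟨h1, h2⟩⟩
      · exact Or.inl hz
      · exact Or.inr h2
    · rintro (hx | hx)
      · exact ⟨x, hx, Or.inl rfl⟩
      · exact ⟨y, hy, Or.inr ⟨hy', hx⟩⟩
  · convert hC using 1
    ext x
    simp only [Set.mem_preimage, Set.mem_image, collapseProj_eq_iff]
    constructor
    · rintro ⟨z, hz, rfl | ⟨h1, h2⟩⟩
      · exact hz
      · exact absurd ⟨z, hz, h1⟩ h
    · exact fun hx => ⟨x, hx, Or.inl rfl⟩

theorem wedge_collapse_isClosed (hY : IsClosed {Y.pt}) (hZ : IsClosed {Z.pt}) :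
    IsClosed (insert (Sum.inl Y.pt) {Sum.inr Z.pt} : Set (Y ⊕ Z)) := by
  have h1 : IsClosed ({Sum.inl Y.pt} : Set (Y ⊕ Z)) := by
    simpa using IsClosedEmbedding.inl.isClosedMap _ hY
  have h2 : IsClosed ({Sum.inr Z.pt} : Set (Y ⊕ Z)) := by
    simpa using IsClosedEmbedding.inr.isClosedMap _ hZ
  exact h1.union h2

theorem wedgeInl_isClosedEmbedding (hY : IsClosed {Y.pt}) (hZ : IsClosed {Z.pt}) :
    IsClosedEmbedding (wedgeInl Y Z).map := by
  refine .of_continuous_injective_isClosedMap (wedgeInl Y Z).map.continuous ?_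
    ((collapseProj_isClosedMap (X := ⟨Y ⊕ Z, Sum.inl Y.pt⟩)
      (wedge_collapse_isClosed hY hZ)).comp IsClosedEmbedding.inl.isClosedMap)
  intro x y h
  rcases collapseProj_eq_iff.1 h with h | ⟨h1, h2⟩
  · exact Sum.inl_injective h
  · rcases h1 with h1 | h1 <;> rcases h2 with h2 | h2 <;> simp_all

theorem wedgeInr_isClosedEmbedding (hY : IsClosed {Y.pt}) (hZ : IsClosed {Z.pt}) :
    IsClosedEmbedding (wedgeInr Y Z).map := by
  refine .of_continuous_injective_isClosedMap (wedgeInr Y Z).map.continuous ?_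
    ((collapseProj_isClosedMap (X := ⟨Y ⊕ Z, Sum.inl Y.pt⟩)
      (wedge_collapse_isClosed hY hZ)).comp IsClosedEmbedding.inr.isClosedMap)
  intro x y h
  rcases collapseProj_eq_iff.1 h with h | ⟨h1, h2⟩
  · exact Sum.inr_injective h
  · rcases h1 with h1 | h1 <;> rcases h2 with h2 | h2 <;> simp_all

/-- The map `Y → X ∧ Y` given by a point of `X`. -/
def smashSlice (x : X) (Y : PTop.{u}) : Y ⟶ smash X Y :=
  PTop.Hom.mk ⟨fun y => (collapseProj _ _).map (x, y),
    (collapseProj _ _).map.continuous.comp (by fun_prop)⟩ (collapseProj_eq_pt (Or.inr rfl))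

theorem smashSlice_pt (y : Y) : (smashSlice X.pt Y).map y = (smash X Y).pt :=
  collapseProj_eq_pt (Or.inl rfl)

theorem smash_cases (p : smash X Y) : ∃ x y, (smashSlice x Y).map y = p := by
  obtain ⟨⟨x, y⟩, rfl⟩ := collapse_surj p
  exact ⟨x, y, rfl⟩

theorem continuous_smashSlice : Continuous fun p : X × Y => (smashSlice p.1 Y).map p.2 :=
  (collapseProj (⟨X × Y, (X.pt, Y.pt)⟩ : PTop.{u})
    {p : X × Y | p.1 = X.pt ∨ p.2 = Y.pt}).map.continuous

/-- The map out of a smash product given by a separately pointed function. -/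
def smashDesc (f : X × Y → Z) (hf : Continuous f) (h1 : ∀ y, f (X.pt, y) = Z.pt)
    (h2 : ∀ x, f (x, Y.pt) = Z.pt) : smash X Y ⟶ Z :=
  collapseDesc (PTop.Hom.mk ⟨f, hf⟩ (h1 _)) (by
    rintro ⟨x, y⟩ (h | h)
    · obtain rfl : x = X.pt := h
      exact h1 y
    · obtain rfl : y = Y.pt := h
      exact h2 x)

/-- The obvious bijection is a homeomorphism once `X × (Y ∨ Z)` is known to carry the quotient
topology from the two products. Closed base points suffice: the inclusions of the summands are
closed embeddings, hence proper, and remain closed after taking the product with `X`. -/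
theorem PHE.smash_wedge (X : PTop.{u}) (hY : IsClosed {Y.pt}) (hZ : IsClosed {Z.pt}) :
    PHE (Resonance.smash X (Resonance.wedge Y Z))
      (Resonance.wedge (Resonance.smash X Y) (Resonance.smash X Z)) := by
  let φ : (X × Y) ⊕ (X × Z) → X × Resonance.wedge Y Z :=
    Sum.elim (Prod.map id (wedgeInl Y Z).map) (Prod.map id (wedgeInr Y Z).map)
  have hφ : IsQuotientMap φ := by
    have h1 : IsClosedMap φ := by
      refine IsClosedMap.sumElim ?_ ?_
      · exact (isProperMap_id.prodMap (wedgeInl_isClosedEmbedding hY hZ).isProperMap).isClosedMap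
      · exact (isProperMap_id.prodMap (wedgeInr_isClosedEmbedding hY hZ).isProperMap).isClosedMap
    refine h1.isQuotientMap ?_ ?_
    · exact continuous_sum_dom.2 ⟨continuous_id.prodMap (wedgeInl Y Z).map.continuous,
        continuous_id.prodMap (wedgeInr Y Z).map.continuous⟩
    · rintro ⟨x, p⟩
      rcases wedge_cases p with ⟨y, rfl⟩ | ⟨z, rfl⟩
      · exact ⟨Sum.inl (x, y), rfl⟩
      · exact ⟨Sum.inr (x, z), rfl⟩
  let g : X × Resonance.wedge Y Z → Resonance.wedge (Resonance.smash X Y) (Resonance.smash X Z) :=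
    fun p => (wedgeDesc (smashSlice p.1 Y ≫ wedgeInl _ _) (smashSlice p.1 Z ≫ wedgeInr _ _)).map p.2
  have hg : Continuous g := by
    rw [hφ.continuous_iff]
    refine continuous_sum_dom.2 ⟨?_, ?_⟩
    · exact (wedgeInl _ _).map.continuous.comp continuous_smashSlice
    · exact (wedgeInr _ _).map.continuous.comp continuous_smashSlice
  refine ⟨smashDesc g hg ?_ (fun x => PTop.Hom.map_pt _), .of_inverse
    (g := wedgeDesc (smashMap (𝟙 X) (wedgeInl Y Z)) (smashMap (𝟙 X) (wedgeInr Y Z))) ?_ ?_⟩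
  · intro p
    rcases wedge_cases p with ⟨y, rfl⟩ | ⟨z, rfl⟩
    · exact (congrArg (wedgeInl _ _).map (smashSlice_pt y)).trans (PTop.Hom.map_pt _)
    · exact (congrArg (wedgeInr _ _).map (smashSlice_pt z)).trans (PTop.Hom.map_pt _)
  · intro q
    obtain ⟨x, p, rfl⟩ := smash_cases q
    rcases wedge_cases p with ⟨y, rfl⟩ | ⟨z, rfl⟩ <;> rfl
  · intro q
    rcases wedge_cases q with ⟨p, rfl⟩ | ⟨p, rfl⟩ <;> obtain ⟨x, y, rfl⟩ := smash_cases p <;> rfl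

/-- The points of a suspension. -/
def suspMk (X : PTop.{u}) : C(X × unitInterval, susp X) :=
  (collapseProj (⟨X × unitInterval, (X.pt, 0)⟩ : PTop.{u})
    {p : X × unitInterval | p.1 = X.pt ∨ p.2 = 0 ∨ p.2 = 1}).map

theorem suspMk_eq_pt {p : X × unitInterval} (h : p.1 = X.pt ∨ p.2 = 0 ∨ p.2 = 1) :
    suspMk X p = (susp X).pt := collapseProj_eq_pt h

theorem suspMk_eq_pt_iff {p : X × unitInterval} :
    suspMk X p = (susp X).pt ↔ p.1 = X.pt ∨ p.2 = 0 ∨ p.2 = 1 := by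
  refine ⟨fun h => ?_, suspMk_eq_pt⟩
  rcases collapseProj_eq_iff.1 h with h | ⟨h | h, -⟩
  · exact Or.inl (congrArg Prod.fst h)
  · exact Or.inl (congrArg Prod.fst h)
  · exact h

theorem suspMk_surjective : Function.Surjective (suspMk X) := fun p => collapse_surj p

theorem suspMk_isQuotientMap : IsQuotientMap (suspMk X) := collapseProj_isQuotientMap _ _

theorem susp_collapse_isClosed (hX : IsClosed {X.pt}) :
    IsClosed {p : X × unitInterval | p.1 = X.pt ∨ p.2 = 0 ∨ p.2 = 1} :=
  (hX.preimage continuous_fst).union ((isClosed_singleton.preimage continuous_snd).union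
    (isClosed_singleton.preimage continuous_snd))

theorem susp_isClosed_pt (hX : IsClosed {X.pt}) : IsClosed {(susp X).pt} := by
  rw [← suspMk_isQuotientMap.isClosed_preimage]
  convert susp_collapse_isClosed hX using 1
  ext p
  exact suspMk_eq_pt_iff

/-- The map out of a suspension given by a function on the cylinder. -/
def suspDesc (f : X × unitInterval → Y) (hf : Continuous f)
    (h : ∀ p : X × unitInterval, p.1 = X.pt ∨ p.2 = 0 ∨ p.2 = 1 → f p = Y.pt) : susp X ⟶ Y :=
  collapseDesc (PTop.Hom.mk ⟨f, hf⟩ (h _ (Or.inl rfl))) h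

theorem clamp_stretch (r t : unitInterval) (h : t = 0 ∨ t = 1) :
    clamp ((1 - r) * (t : ℝ) + r * (3 * t - 1)) = t := by
  rcases h with rfl | rfl
  · exact clamp_of_le_zero (by simp [r.2.1])
  · exact clamp_of_one_le (by simp only [Set.Icc.coe_one]; linarith [r.2.1])

/-- The endomorphism of a suspension that stretches the middle third of the suspension
coordinate. -/
noncomputable def suspStretch (X : PTop.{u}) : susp X ⟶ susp X :=
  suspDesc (fun p => suspMk X (p.1, clamp (3 * p.2 - 1))) (by fun_prop) (by
    rintro ⟨x, t⟩ (h | h | h)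
    · exact suspMk_eq_pt (Or.inl h)
    · obtain rfl : t = 0 := h
      exact suspMk_eq_pt (Or.inr (Or.inl (clamp_of_le_zero (by simp))))
    · obtain rfl : t = 1 := h
      exact suspMk_eq_pt (Or.inr (Or.inr (clamp_of_one_le (by norm_num)))))

theorem suspStretch_phomotopic (X : PTop.{u}) : PHomotopic (suspStretch X) (𝟙 (susp X)) := by
  refine (PHomotopic.of_collapse (fun p : (X × unitInterval) × unitInterval => suspMk X (p.1.1,
    clamp ((1 - p.2) * (p.1.2 : ℝ) + p.2 * (3 * p.1.2 - 1)))) (by fun_prop) ?_ ?_ ?_ ?_).symm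
  · rintro ⟨x, t⟩
    simp only [Set.Icc.coe_zero, sub_zero, one_mul, zero_mul, add_zero, clamp_coe]
    rfl
  · rintro ⟨x, t⟩
    simp only [Set.Icc.coe_one, sub_self, one_mul, zero_mul, zero_add]
    rfl
  · intro t
    exact suspMk_eq_pt (Or.inl rfl)
  · rintro ⟨x, t⟩ (h | h) r
    · exact suspMk_eq_pt (Or.inl h)
    · refine suspMk_eq_pt (Or.inr ?_)
      simp only at h ⊢
      rwa [clamp_stretch r t h]

/-- The product with `X` need not preserve the quotient map onto the suspension, so the obvious map
to `susp (X ∧ A)` may fail to be continuous at the base point. Stretching the suspension coordinate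
sends whole neighbourhoods of both ends to the base point and repairs this; both composites are then
stretchings, homotopic to the identity. -/
theorem PHE.smash_susp (X : PTop.{u}) (hA : IsClosed {A.pt}) :
    PHE (Resonance.smash X (susp A)) (susp (Resonance.smash X A)) := by
  let f : (X × A) × unitInterval → susp (Resonance.smash X A) := fun p =>
    suspMk _ ((smashSlice p.1.1 A).map p.1.2, clamp (3 * p.2 - 1))
  have hf : Continuous f := by
    refine (suspMk _).continuous.comp (Continuous.prodMk ?_ (by fun_prop))
    exact continuous_smashSlice.comp continuous_fst
  let g : X × susp A → susp (Resonance.smash X A) := fun p =>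
    (suspDesc (fun q => f ((p.1, q.1), q.2)) (by fun_prop) (by
      rintro ⟨a, t⟩ (h | h | h)
      · obtain rfl : a = A.pt := h
        exact suspMk_eq_pt (Or.inl (PTop.Hom.map_pt _))
      · obtain rfl : t = 0 := h
        exact suspMk_eq_pt (Or.inr (Or.inl (clamp_of_le_zero (by simp))))
      · obtain rfl : t = 1 := h
        exact suspMk_eq_pt (Or.inr (Or.inr (clamp_of_one_le (by norm_num)))))).map p.2
  have hg : Continuous g := by
    refine continuous_def.2 fun W hW => ?_
    have hO : IsOpen (f ⁻¹' W) := hW.preimage hf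
    rw [isOpen_prod_iff]
    intro x s hs
    obtain ⟨⟨a, t⟩, rfl⟩ := suspMk_surjective s
    by_cases hp : a = A.pt ∨ t = 0 ∨ t = 1
    · have hpt : suspMk A (a, t) = (susp A).pt := suspMk_eq_pt hp
      rw [hpt] at hs ⊢
      have hW0 : (susp (Resonance.smash X A)).pt ∈ W := by
        have : g (x, (susp A).pt) = (susp (Resonance.smash X A)).pt := PTop.Hom.map_pt _
        exact this ▸ hs
      -- At the base point, compactness of the interval gives a neighbourhood that works for all
      -- suspension coordinates at once.
      obtain ⟨U, V, hU, hV, hxU, hV1, hUV⟩ := generalized_tube_lemma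
        (isCompact_singleton (x := (x, A.pt))) (isCompact_univ (X := unitInterval)) hO (by
          rintro ⟨⟨y, b⟩, r⟩ ⟨h1, -⟩
          obtain ⟨rfl, rfl⟩ := Prod.mk.inj (show (y, b) = (x, A.pt) from h1)
          change f ((y, A.pt), r) ∈ W
          rwa [show f ((y, A.pt), r) = (susp (Resonance.smash X A)).pt from
            suspMk_eq_pt (Or.inl (PTop.Hom.map_pt _))])
      obtain ⟨u, v, hu, hv, hxu, hav, huv⟩ := isOpen_prod_iff.1 hU x A.pt (hxU rfl)
      refine ⟨u, suspMk A '' {q | q.1 ∈ v ∨ (q.2 : ℝ) < 1 / 3 ∨ 2 / 3 < (q.2 : ℝ)}, hu, ?_, hxu,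
        ⟨(A.pt, 0), Or.inl hav, suspMk_eq_pt (Or.inl rfl)⟩, ?_⟩
      · rw [← suspMk_isQuotientMap.isOpen_preimage]
        -- This open set contains everything that is collapsed, so its image is open in the
        -- suspension.
        have hopen : IsOpen {q : A × unitInterval |
            q.1 ∈ v ∨ (q.2 : ℝ) < 1 / 3 ∨ 2 / 3 < (q.2 : ℝ)} := by
          refine (hv.preimage continuous_fst).union (.union ?_ ?_)
          · exact isOpen_lt (continuous_subtype_val.comp continuous_snd) continuous_const
          · exact isOpen_lt continuous_const (continuous_subtype_val.comp continuous_snd)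
        convert hopen using 1
        ext q
        refine ⟨?_, fun h => ⟨q, h, rfl⟩⟩
        rintro ⟨q', hq', h⟩
        rcases collapseProj_eq_iff.1 h with rfl | ⟨-, h | h | h | h⟩
        · exact hq'
        · rw [h]
          exact Or.inl hav
        · refine Or.inl ?_
          rwa [h]
        · refine Or.inr (Or.inl ?_)
          rw [h]
          norm_num
        · refine Or.inr (Or.inr ?_)
          rw [h]
          norm_num
      · rintro ⟨y, _⟩ ⟨hy, ⟨⟨b, r⟩, hb, rfl⟩⟩
        change f ((y, b), r) ∈ W
        rcases hb with hb | hb | hb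
        · exact hUV (Set.mk_mem_prod (huv (Set.mk_mem_prod hy hb)) (hV1 trivial))
        · rwa [show f ((y, b), r) = (susp (Resonance.smash X A)).pt from
            suspMk_eq_pt (Or.inr (Or.inl (clamp_of_le_zero (by simp only at hb ⊢; linarith))))]
        · rwa [show f ((y, b), r) = (susp (Resonance.smash X A)).pt from
            suspMk_eq_pt (Or.inr (Or.inr (clamp_of_one_le (by simp only at hb ⊢; linarith))))]
    -- Away from the base point, an open set disjoint from the closed collapsed set is saturated.
    · have hO' : IsOpen {q : X × (A × unitInterval) | f ((q.1, q.2.1), q.2.2) ∈ W} :=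
        hW.preimage (hf.comp (by fun_prop))
      obtain ⟨u, v, hu, hv, hxu, hav, huv⟩ := isOpen_prod_iff.1 hO' x (a, t) hs
      have hK := (susp_collapse_isClosed hA).isOpen_compl
      refine ⟨u, suspMk A '' (v ∩ {p | p.1 = A.pt ∨ p.2 = 0 ∨ p.2 = 1}ᶜ), hu, ?_, hxu,
        ⟨(a, t), ⟨hav, hp⟩, rfl⟩, ?_⟩
      · rw [← suspMk_isQuotientMap.isOpen_preimage]
        convert hv.inter hK using 1
        ext q
        refine ⟨?_, fun h => ⟨q, h, rfl⟩⟩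
        rintro ⟨q', ⟨hq', hn⟩, h⟩
        rcases collapseProj_eq_iff.1 h with rfl | ⟨h | h, -⟩
        · exact ⟨hq', hn⟩
        · exact absurd (Or.inl (congrArg Prod.fst h)) hn
        · exact absurd h hn
      · rintro ⟨y, _⟩ ⟨hy, ⟨⟨b, r⟩, hb, rfl⟩⟩
        exact huv (Set.mk_mem_prod hy hb.1)
  obtain ⟨k, hk, hk'⟩ := exists_collapse_prod_lift (X := ⟨X × A, (X.pt, A.pt)⟩)
    (A := {p : X × A | p.1 = X.pt ∨ p.2 = A.pt})
    (fun p : (X × A) × unitInterval => (smashSlice p.1.1 (susp A)).map (suspMk A (p.1.2, p.2)))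
    (continuous_smashSlice.comp (f := fun p : (X × A) × unitInterval =>
      (p.1.1, suspMk A (p.1.2, p.2))) (by fun_prop)) (by
      rintro ⟨x, a⟩ h t
      simp only [smashSlice_pt]
      rcases h with h | h
      · obtain rfl : x = X.pt := h
        exact smashSlice_pt _
      · rw [suspMk_eq_pt (Or.inl h)]
        exact PTop.Hom.map_pt _)
  replace hk' : ∀ x a t, k ((smashSlice x A).map a, t) =
    (smashSlice x (susp A)).map (suspMk A (a, t)) := fun x a t => hk' (x, a) t
  let u : susp (Resonance.smash X A) ⟶ Resonance.smash X (susp A) := suspDesc k hk (by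
    rintro ⟨p, t⟩ h
    obtain ⟨x, a, rfl⟩ := smash_cases p
    refine (hk' x a t).trans ?_
    rcases h with h | h
    · have h' : x = X.pt ∨ a = A.pt := by
        rcases collapseProj_eq_iff.1 h with h | ⟨h | h, -⟩
        · exact Or.inl (congrArg Prod.fst h)
        · exact Or.inl (congrArg Prod.fst h)
        · exact h
      rcases h' with rfl | h'
      · exact smashSlice_pt _
      · rw [suspMk_eq_pt (Or.inl h')]
        exact PTop.Hom.map_pt _
    · rw [suspMk_eq_pt (X := A) (p := (a, t)) (Or.inr h)]
      exact PTop.Hom.map_pt _)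
  let v : Resonance.smash X (susp A) ⟶ susp (Resonance.smash X A) :=
    smashDesc g hg (by
      intro s
      obtain ⟨⟨a, t⟩, rfl⟩ := suspMk_surjective s
      exact suspMk_eq_pt (Or.inl (smashSlice_pt _))) fun x => PTop.Hom.map_pt _
  refine ⟨v, u, ?_, ?_⟩
  · refine PHomotopic.trans (.of_eq ?_) (((PHomotopic.refl (𝟙 X)).smash
      (suspStretch_phomotopic A)).trans (.of_eq ?_))
    · intro p
      obtain ⟨x, s, rfl⟩ := smash_cases p
      obtain ⟨⟨a, t⟩, rfl⟩ := suspMk_surjective s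
      exact hk' _ _ _
    · intro p
      obtain ⟨x, s, rfl⟩ := smash_cases p
      rfl
  · refine PHomotopic.trans (.of_eq ?_) (suspStretch_phomotopic _)
    intro q
    obtain ⟨⟨p, t⟩, rfl⟩ := suspMk_surjective q
    obtain ⟨x, a, rfl⟩ := smash_cases p
    exact congrArg v.map (hk' x a t)

end Smash

/-! ### Closures of set partitions -/

section Reach

open Classical in
/-- The block of an element. -/
noncomputable def cls {n : ℕ} (τ : Setoid (Fin n)) (i : Fin n) : Finset (Fin n) :=
  Finset.univ.filter fun j => τ i j

/-- The finite set of the blocks of a set partition. -/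
noncomputable def blockSet {n : ℕ} (τ : Setoid (Fin n)) : Finset (Finset (Fin n)) :=
  Finset.univ.image (cls τ)

/-- The collection of the singletons of the elements of `B`. -/
def singles {n : ℕ} (B : Finset (Fin n)) : Multiset (Multiset (Fin n)) := B.val.map fun i => {i}

variable {n : ℕ} {S : Set (Fin n → SignType)} {A : Multiset (Multiset (Fin n))}
  {τ : Setoid (Fin n)}

theorem mem_cls {i j : Fin n} : j ∈ cls τ i ↔ τ i j := by simp [cls]

theorem mem_blockSet {t : Finset (Fin n)} : t ∈ blockSet τ ↔ ∃ i, cls τ i = t := by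
  simp [blockSet]

theorem blockSet_nonempty_of_mem {t : Finset (Fin n)} (h : t ∈ blockSet τ) : t.Nonempty := by
  obtain ⟨i, rfl⟩ := mem_blockSet.1 h
  exact ⟨i, mem_cls.2 (τ.refl i)⟩

theorem rel_of_mem_blockSet {t : Finset (Fin n)} (h : t ∈ blockSet τ) {i j : Fin n} (hi : i ∈ t)
    (hj : j ∈ t) : τ i j := by
  obtain ⟨k, rfl⟩ := mem_blockSet.1 h
  exact τ.trans (τ.symm (mem_cls.1 hi)) (mem_cls.1 hj)

theorem blocks_eq_map (τ : Setoid (Fin n)) : blocks τ = (blockSet τ).val.map Finset.val := by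
  unfold blocks blockSet cls
  congr!

theorem blocks_eq_sum (τ : Setoid (Fin n)) :
    blocks τ = ∑ t ∈ blockSet τ, ({t.val} : Multiset (Multiset (Fin n))) := by
  rw [blocks_eq_map, Finset.sum_eq_multiset_sum,
    ← Multiset.sum_map_singleton ((blockSet τ).val.map Finset.val), Multiset.map_map]
  rfl

theorem sum_blockSet {M : Type*} [AddCommMonoid M] (τ : Setoid (Fin n)) (f : Fin n → M) :
    ∑ t ∈ blockSet τ, ∑ i ∈ t, f i = ∑ i, f i := by
  have h : (blockSet τ).biUnion id = Finset.univ := by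
    ext i
    simp only [Finset.mem_biUnion, id, Finset.mem_univ, iff_true]
    exact ⟨cls τ i, mem_blockSet.2 ⟨i, rfl⟩, mem_cls.2 (τ.refl i)⟩
  rw [← h, Finset.sum_biUnion]
  · rfl
  · intro s hs t ht hst
    refine Finset.disjoint_left.2 fun i hi hi' => hst ?_
    obtain ⟨a, rfl⟩ := mem_blockSet.1 hs
    obtain ⟨b, rfl⟩ := mem_blockSet.1 ht
    have hab : τ a b := τ.trans (mem_cls.1 hi) (τ.symm (mem_cls.1 hi'))
    ext j
    rw [mem_cls, mem_cls]
    exact ⟨fun h => τ.trans (τ.symm hab) h, fun h => τ.trans hab h⟩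

theorem singles_eq_sum (B : Finset (Fin n)) :
    singles B = ∑ i ∈ B, ({{i}} : Multiset (Multiset (Fin n))) := by
  rw [Finset.sum_eq_multiset_sum, ← Multiset.sum_map_singleton (singles B), singles,
    Multiset.map_map]
  rfl

theorem sum_singles (B : Finset (Fin n)) : (singles B).sum = B.val :=
  Multiset.sum_map_singleton _

theorem singles_add_singles {B C : Finset (Fin n)} (h : Disjoint B C) :
    singles B + singles C = singles (B ∪ C) := by
  simp only [singles_eq_sum, Finset.sum_union h]

theorem singles_ne_zero {B : Finset (Fin n)} (h : B.Nonempty) : singles B ≠ 0 := by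
  simpa [singles] using h.ne_empty

theorem sum_blocks (τ : Setoid (Fin n)) : (blocks τ).sum = (Finset.univ : Finset (Fin n)).val := by
  have h := sum_blockSet τ fun i => ({i} : Multiset (Fin n))
  rw [blocks_eq_map, ← Finset.sum_eq_multiset_sum]
  simpa using h

theorem blocks_blockPart {B : Finset (Fin n)} (hB : B.Nonempty) :
    blocks (blockPart B) = B.val ::ₘ singles Bᶜ := by
  have h1 : B ∉ Bᶜ.map ⟨fun i => {i}, Finset.singleton_injective⟩ := by
    simp only [Finset.mem_map, Finset.mem_compl, Function.Embedding.coeFn_mk, not_exists, not_and]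
    rintro i hi rfl
    exact hi (Finset.mem_singleton_self i)
  have h2 : blockSet (blockPart B) = Finset.cons B _ h1 := by
    have h3 : ∀ i, cls (blockPart B) i = if i ∈ B then B else {i} := by
      intro i
      ext j
      rw [mem_cls]
      change i = j ∨ (i ∈ B ∧ j ∈ B) ↔ _
      split_ifs with h
      · refine ⟨?_, fun hj => Or.inr ⟨h, hj⟩⟩
        rintro (rfl | hj)
        exacts [h, hj.2]
      · simp [h, eq_comm]
    ext t
    simp only [mem_blockSet, h3, Finset.mem_cons, Finset.mem_map, Finset.mem_compl,
      Function.Embedding.coeFn_mk]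
    constructor
    · rintro ⟨i, rfl⟩
      split_ifs with h
      · exact Or.inl rfl
      · exact Or.inr ⟨i, h, rfl⟩
    · rintro (rfl | ⟨i, hi, rfl⟩)
      · obtain ⟨i, hi⟩ := hB
        exact ⟨i, if_pos hi⟩
      · exact ⟨i, if_neg hi⟩
  rw [blocks_eq_map, h2, Finset.cons_val, Multiset.map_cons, Finset.map_val, Multiset.map_map]
  rfl

theorem Reach.trans {B C : Multiset (Multiset (Fin n))} (h : Reach S A B) (k : Reach S B C) :
    Reach S A C := by
  induction k with
  | refl => exact h
  | merge B₁ B₂ C _ ih => exact ih.merge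
  | move B C x _ hx hle ih => exact ih.move _ _ x hx hle

theorem Reach.mono {T : Set (Fin n → SignType)} (hST : S ⊆ T) {B : Multiset (Multiset (Fin n))}
    (h : Reach S A B) : Reach T A B := by
  induction h with
  | refl => exact .refl
  | merge B₁ B₂ C _ ih => exact ih.merge
  | move B C x _ hx hle ih => exact ih.move _ _ x (hST hx) hle

/-- `D` must be nonempty, since merging nothing would create an empty member. -/
theorem Reach.merge_sum (D : Multiset (Multiset (Fin n))) (hD : D ≠ 0)
    (C : Multiset (Multiset (Fin n))) (h : Reach S A (D + C)) : Reach S A (D.sum ::ₘ C) := by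
  induction D using Multiset.induction generalizing C with
  | empty => exact absurd rfl hD
  | cons a D ih =>
    by_cases h0 : D = 0
    · subst h0
      simpa using h
    · have h1 := ih h0 (a ::ₘ C) (by simpa using h)
      rw [Multiset.cons_swap] at h1
      simpa using h1.merge

theorem Reach.merge_finset {ι : Type*} [DecidableEq ι] (K : Finset ι)
    (X : ι → Multiset (Multiset (Fin n))) (hX : ∀ t ∈ K, X t ≠ 0)
    (C : Multiset (Multiset (Fin n))) (h : Reach S A (∑ t ∈ K, X t + C)) :
    Reach S A (∑ t ∈ K, {(X t).sum} + C) := by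
  induction K using Finset.induction generalizing C with
  | empty => simpa using h
  | insert a K ha ih =>
    rw [Finset.sum_insert ha] at h ⊢
    have h1 := ih (fun t ht => hX t (Finset.mem_insert_of_mem ht)) (X a + C) (by
      rwa [add_left_comm, ← add_assoc])
    rw [add_left_comm] at h1
    have h2 := h1.merge_sum (X a) (hX a (Finset.mem_insert_self a K))
    rwa [← Multiset.singleton_add, ← add_assoc] at h2

/-- A set partition can be reached from the partition with only one nonsingleton block `B`, when
`B` lies in one of its blocks. -/
theorem reach_of_block {B : Finset (Fin n)} (hB : B.Nonempty) (h : ∀ i ∈ B, ∀ j ∈ B, τ i j) :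
    Reach S (blocks (blockPart B)) (blocks τ) := by
  obtain ⟨i₀, hi₀⟩ := hB
  have ht₀ : cls τ i₀ ∈ blockSet τ := mem_blockSet.2 ⟨i₀, rfl⟩
  have hBt : B ⊆ cls τ i₀ := fun j hj => mem_cls.2 (h i₀ hi₀ j hj)
  generalize cls τ i₀ = t₀ at ht₀ hBt
  -- The starting collection is sorted by the blocks of `τ` in which its members lie; merging each
  -- group yields `τ`.
  let X : Finset (Fin n) → Multiset (Multiset (Fin n)) := fun t =>
    if t = t₀ then B.val ::ₘ singles (t₀ \ B) else singles t
  have hX₀ : X t₀ = B.val ::ₘ singles (t₀ \ B) := if_pos rfl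
  have hX1 : ∀ t, t ≠ t₀ → X t = singles t := fun t ht => if_neg ht
  have hsum : ∑ t ∈ blockSet τ, X t = blocks (blockPart B) := by
    rw [blocks_blockPart ⟨i₀, hi₀⟩]
    refine add_left_cancel (a := singles B) ?_
    have h1 := sum_blockSet τ fun i => ({{i}} : Multiset (Multiset (Fin n)))
    simp only [← singles_eq_sum] at h1
    rw [← Finset.add_sum_erase _ _ ht₀] at h1 ⊢
    rw [hX₀, Finset.sum_congr rfl fun t ht => hX1 t (Finset.ne_of_mem_erase ht)]
    have h2 : singles B + singles (t₀ \ B) = singles t₀ := by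
      rw [singles_add_singles Finset.disjoint_sdiff, Finset.union_sdiff_of_subset hBt]
    have h3 : singles B + singles Bᶜ = singles Finset.univ := by
      rw [singles_add_singles disjoint_compl_right, Finset.union_compl]
    rw [Multiset.cons_add, Multiset.add_cons, Multiset.add_cons, ← add_assoc, h2, h1, h3]
  have h1 : Reach S (blocks (blockPart B)) (∑ t ∈ blockSet τ, X t + 0) := by
    rw [hsum, add_zero]
    exact .refl
  have h2 := h1.merge_finset (blockSet τ) X (fun t ht => by
    by_cases h : t = t₀
    · rw [h, hX₀]
      exact Multiset.cons_ne_zero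
    · rw [hX1 t h]
      exact singles_ne_zero (blockSet_nonempty_of_mem ht))
  rw [blocks_eq_sum τ]
  convert h2 using 1
  rw [add_zero]
  refine Finset.sum_congr rfl fun t ht => ?_
  by_cases h : t = t₀
  · subst h
    rw [hX₀, Multiset.sum_cons, sum_singles,
      show B.val + (t \ B).val = (B.disjUnion _ Finset.disjoint_sdiff).val from rfl,
      Finset.disjUnion_eq_union, Finset.union_sdiff_of_subset hBt]
  · rw [hX1 t h, sum_singles]

/-- The sign vector with given positive and negative coordinates. -/
def signVec (P M : Finset (Fin n)) : Fin n → SignType := fun i =>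
  if i ∈ P then 1 else if i ∈ M then -1 else 0

theorem mem_plus {x : Fin n → SignType} {i : Fin n} : i ∈ plus x ↔ x i = 1 := by simp [plus]

theorem mem_minus {x : Fin n → SignType} {i : Fin n} : i ∈ minus x ↔ x i = -1 := by simp [minus]

theorem plus_signVec (P M : Finset (Fin n)) : plus (signVec P M) = P := by
  ext i
  simp only [mem_plus, signVec]
  split_ifs <;> simp_all

theorem minus_signVec {P M : Finset (Fin n)} (h : Disjoint P M) : minus (signVec P M) = M := by
  ext i
  have : i ∈ P → i ∉ M := fun hi => Finset.disjoint_left.1 h hi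
  simp only [mem_minus, signVec]
  split_ifs <;> simp_all

/-- Exchanging an element of a block for a set of singletons. -/
theorem reach_exchange {B C : Finset (Fin n)} {q : Fin n} (hq : q ∈ B) (hC : C.Nonempty)
    (hBC : Disjoint B C) (h1 : signVec {q} C ∈ S) (h2 : signVec C {q} ∈ S) :
    Reach S (blocks (blockPart B)) (blocks (blockPart (B.erase q ∪ C))) := by
  have hqC : q ∉ C := Finset.disjoint_left.1 hBC hq
  have hqC' : Disjoint {q} C := Finset.disjoint_singleton_left.2 hqC
  have hd : Disjoint (B.erase q) C := hBC.mono_left (Finset.erase_subset _ _)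
  rw [blocks_blockPart ⟨q, hq⟩, blocks_blockPart (hC.mono Finset.subset_union_right)]
  have e1 : Bᶜ = C ∪ (B ∪ C)ᶜ := by
    ext i
    have : i ∈ B → i ∉ C := fun hi => Finset.disjoint_left.1 hBC hi
    simp only [Finset.mem_compl, Finset.mem_union]
    tauto
  have e2 : (B.erase q ∪ C)ᶜ = {q} ∪ (B ∪ C)ᶜ := by
    ext i
    by_cases h : i = q
    · subst h
      simp [hqC]
    · simp [h]
  -- After this move the elements of `C` occur twice and `q` not at all, which is why multisets are
  -- needed.
  have r1 := (Reach.refl (S := S) (A := B.val ::ₘ singles Bᶜ)).move _ _ _ h1 (by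
    rw [plus_signVec]
    simpa using hq)
  rw [plus_signVec, minus_signVec hqC'] at r1
  have e3 : B.val - ({q} : Finset (Fin n)).val + C.val = (B.erase q ∪ C).val := by
    rw [← Finset.disjUnion_eq_union _ _ hd, Finset.disjUnion_val, Finset.erase_val,
      Finset.singleton_val, Multiset.sub_singleton]
  have e4 : singles Bᶜ = singles C + singles (B ∪ C)ᶜ := by
    rw [e1, singles_add_singles (Finset.disjoint_left.2 fun i hi hi' => by simp [hi] at hi')]
  rw [e3, e4] at r1
  replace r1 : Reach S (B.val ::ₘ singles Bᶜ)
      (singles C + (B.erase q ∪ C).val ::ₘ singles (B ∪ C)ᶜ) := by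
    rwa [Multiset.add_cons, e4]
  have r2 := r1.merge_sum (singles C) (singles_ne_zero hC)
  rw [sum_singles] at r2
  -- The spare singletons of `C`, merged to a block, are traded back for the missing singleton of
  -- `q`.
  have r3 := r2.move _ _ _ h2 (by rw [plus_signVec])
  rw [plus_signVec, minus_signVec hqC'.symm, tsub_self, zero_add, Multiset.cons_swap] at r3
  rw [e2, ← singles_add_singles (by simp [hq])]
  exact r3

end Reach

/-! ### Weights -/

section Weights

variable {n : ℕ}

/-- The points of `{-1,0,1}^n` orthogonal to a vector of weights. -/
def ortho (w : Fin n → ℕ) : Set (Fin n → SignType) := {x | ∑ i, vec x i * (w i : ℝ) = 0}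

theorem sum_vec_mul (x : Fin n → SignType) (w : Fin n → ℕ) :
    ∑ i, vec x i * (w i : ℝ) = ∑ i ∈ plus x, (w i : ℝ) - ∑ i ∈ minus x, (w i : ℝ) := by
  rw [plus, minus, Finset.sum_filter, Finset.sum_filter, ← Finset.sum_sub_distrib]
  refine Finset.sum_congr rfl fun i _ => ?_
  unfold vec
  cases x i <;> simp

theorem mem_ortho_iff {w : Fin n → ℕ} {x : Fin n → SignType} :
    x ∈ ortho w ↔ ∑ i ∈ plus x, w i = ∑ i ∈ minus x, w i := by
  change ∑ i, vec x i * (w i : ℝ) = 0 ↔ _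
  rw [sum_vec_mul, sub_eq_zero]
  exact_mod_cast Iff.rfl

theorem signVec_mem_ortho {w : Fin n → ℕ} {P M : Finset (Fin n)} (hd : Disjoint P M)
    (h : ∑ i ∈ P, w i = ∑ i ∈ M, w i) : signVec P M ∈ ortho w := by
  rw [mem_ortho_iff, plus_signVec, minus_signVec hd, h]

/-- The cut orthogonal to a vector of positive weights. -/
def weightCut (w : Fin n → ℕ) (hn : 0 < n) (hw : ∀ i, 0 < w i) : Cut n where
  carrier := ortho w
  pos := hn
  span_closed := by
    refine Set.Subset.antisymm (fun x hx => ?_) (subset_cubeSpan _)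
    let φ : (Fin n → ℝ) →ₗ[ℝ] ℝ := Fintype.linearCombination ℝ (fun i => (w i : ℝ))
    have h : Submodule.span ℝ (vec '' ortho w) ≤ LinearMap.ker φ := by
      refine Submodule.span_le.2 ?_
      rintro _ ⟨y, hy, rfl⟩
      simpa [φ, ortho, Fintype.linearCombination_apply] using hy
    simpa [φ, ortho, Fintype.linearCombination_apply] using h hx
  balanced := by
    intro x hx h0
    rw [mem_ortho_iff] at hx
    have key : (plus x).Nonempty ↔ (minus x).Nonempty := by
      have h : ∀ s : Finset (Fin n), s.Nonempty ↔ 0 < ∑ i ∈ s, w i := by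
        intro s
        refine ⟨fun h => Finset.sum_pos (fun i _ => hw i) h, fun h => ?_⟩
        rw [Finset.nonempty_iff_ne_empty]
        rintro rfl
        simp at h
      rw [h, h, hx]
    obtain ⟨i, hi⟩ := Function.ne_iff.1 h0
    rcases h : x i with _ | _ | _
    · exact absurd h hi
    · have : (minus x).Nonempty := ⟨i, mem_minus.2 h⟩
      exact ⟨key.2 this, this⟩
    · have : (plus x).Nonempty := ⟨i, mem_plus.2 h⟩
      exact ⟨this, key.1 this⟩

/-- The set partitions with a block that contains two or more elements of total weight `c`. -/
def theta (w : Fin n → ℕ) (c : ℕ) : Set (Setoid (Fin n)) :=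
  {τ | ∃ B : Finset (Fin n), 2 ≤ B.card ∧ ∑ i ∈ B, w i = c ∧ ∀ i ∈ B, ∀ j ∈ B, τ i j}

/-- The indices of weight `c`. -/
def tops (w : Fin n → ℕ) (c : ℕ) : Finset (Fin n) := Finset.univ.filter fun i => w i = c

theorem mem_tops {w : Fin n → ℕ} {c : ℕ} {i : Fin n} : i ∈ tops w c ↔ w i = c := by simp [tops]

/-- Two sets of the same total weight, of elements lighter than `c`: the heaviest element can be
exchanged. -/
def Exchange (w : Fin n → ℕ) (c : ℕ) : Prop :=
  ∀ A B : Finset (Fin n), (∀ i ∈ A ∪ B, w i < c) → ∑ i ∈ A, w i = ∑ i ∈ B, w i →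
    ∀ q ∈ A, (∀ i ∈ A ∪ B, w i ≤ w q) → ∃ B' ⊆ B, ∑ i ∈ B', w i = w q

/-- A set that is in balance with a set containing elements of weight `c` has a subset of total
weight `c`. -/
def Splits (w : Fin n → ℕ) (c : ℕ) : Prop :=
  ∀ (A B : Finset (Fin n)) (a : ℕ), (∀ i ∈ A ∪ B, w i ≠ c) → 1 ≤ a → a ≤ max 1 (tops w c).card →
    a * c + ∑ i ∈ A, w i = ∑ i ∈ B, w i → ∃ B' ⊆ B, ∑ i ∈ B', w i = c

variable {w : Fin n → ℕ} {c : ℕ}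

theorem lt_of_two_le_card (hw : ∀ i, 0 < w i) {B : Finset (Fin n)} (hB : 2 ≤ B.card)
    (hs : ∑ i ∈ B, w i = c) {i : Fin n} (hi : i ∈ B) : w i < c := by
  obtain ⟨j, hj, hne⟩ := Finset.exists_mem_ne (s := B) (by omega) i
  have h := Finset.add_sum_erase B w hi
  have h2 := Finset.single_le_sum (f := w) (fun k _ => Nat.zero_le _) (Finset.mem_erase.2 ⟨hne, hj⟩)
  have := hw j
  omega

theorem two_le_card_of_sum (hc : 0 < c) {B : Finset (Fin n)} (hB : ∀ i ∈ B, w i ≠ c)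
    (hs : ∑ i ∈ B, w i = c) : 2 ≤ B.card := by
  by_contra h
  have h' : B.card = 0 ∨ B.card = 1 := by omega
  rcases h' with h | h
  · rw [Finset.card_eq_zero.1 h, Finset.sum_empty] at hs
    omega
  · obtain ⟨i, rfl⟩ := Finset.card_eq_one.1 h
    rw [Finset.sum_singleton] at hs
    exact hB i (Finset.mem_singleton_self i) hs

theorem mem_theta_of_splits (hc : 0 < c) {B : Finset (Fin n)} (hB : ∀ i ∈ B, w i ≠ c)
    (hs : ∃ B' ⊆ B, ∑ i ∈ B', w i = c) {τ : Setoid (Fin n)}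
    (hτ : ∀ i ∈ B, ∀ j ∈ B, τ i j) : τ ∈ theta w c := by
  obtain ⟨B', hB', hs⟩ := hs
  exact ⟨B', two_le_card_of_sum hc (fun i hi => hB i (hB' hi)) hs, hs,
    fun i hi j hj => hτ i (hB' hi) j (hB' hj)⟩

theorem sum_eq_tops_add (g : Finset (Fin n)) :
    ∑ i ∈ g, w i = (g ∩ tops w c).card * c + ∑ i ∈ g \ tops w c, w i := by
  rw [← Finset.sum_inter_add_sum_sdiff g (tops w c),
    Finset.sum_const_nat fun i hi => mem_tops.1 (Finset.mem_inter.1 hi).2]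

theorem ne_of_mem_sdiff_tops {g : Finset (Fin n)} {i : Fin n} (h : i ∈ g \ tops w c) : w i ≠ c :=
  fun h' => (Finset.mem_sdiff.1 h).2 (mem_tops.2 h')

/-- Cancel equally many elements of weight `c` on both sides; the surplus is at least one and at
most the number of all elements of weight `c`. -/
theorem Splits.exists_of_card_lt (h : Splits w c) {g t : Finset (Fin n)}
    (hs : ∑ i ∈ g, w i = ∑ i ∈ t, w i) (hlt : (t ∩ tops w c).card < (g ∩ tops w c).card) :
    ∃ B' ⊆ t \ tops w c, ∑ i ∈ B', w i = c := by
  rw [sum_eq_tops_add (c := c) g, sum_eq_tops_add (c := c) t] at hs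
  refine h (g \ tops w c) (t \ tops w c) ((g ∩ tops w c).card - (t ∩ tops w c).card) ?_
    (by omega) ?_ ?_
  · intro i hi
    rcases Finset.mem_union.1 hi with hi | hi <;> exact ne_of_mem_sdiff_tops hi
  · have := Finset.card_le_card (Finset.inter_subset_right : g ∩ tops w c ⊆ tops w c)
    omega
  · obtain ⟨d, hd⟩ := Nat.exists_eq_add_of_lt hlt
    rw [hd] at hs ⊢
    have : (t ∩ tops w c).card + d + 1 - (t ∩ tops w c).card = d + 1 := by omega
    rw [this]
    nlinarith

/-- A collection that can be reached from a set partition: its members are matched with unions of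
blocks of the set partition of the same total weights. -/
theorem Reach.exists_matching {π : Setoid (Fin n)} {B : Finset (Fin n)} (hne : B.Nonempty)
    (hB : ∀ i ∈ B, ∀ j ∈ B, π i j) {C : Multiset (Multiset (Fin n))}
    (h : Reach (ortho w) (blocks π) C) :
    ∃ M : Multiset (Multiset (Fin n) × Multiset (Fin n)), M.map Prod.snd = C ∧
      (M.map Prod.fst).sum = (Finset.univ : Finset (Fin n)).val ∧
      (∀ p ∈ M, (p.1.map w).sum = (p.2.map w).sum) ∧ ∃ p ∈ M, B.val ≤ p.1 := by
  induction h with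
  | refl =>
    obtain ⟨i, hi⟩ := hne
    -- At the start every block is matched with itself. A merge joins two pairs, and a move changes
    -- only the second component, keeping its weight.
    refine ⟨(blocks π).map fun t => (t, t), by simp, by simp [sum_blocks], by simp, ?_⟩
    refine ⟨((cls π i).val, (cls π i).val), Multiset.mem_map_of_mem _ ?_, ?_⟩
    · rw [blocks_eq_map]
      exact Multiset.mem_map_of_mem _ (mem_blockSet.2 ⟨i, rfl⟩)
    · exact Finset.val_le_iff.2 fun j hj => mem_cls.2 (hB i hi j hj)
  | merge B₁ B₂ C _ ih =>
    obtain ⟨M, hM, hs, hw, p₀, hp₀, hp₀'⟩ := ih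
    obtain ⟨p₁, h₁, rfl, hM'⟩ := (Multiset.map_eq_cons _ _ _ _).2 hM
    obtain ⟨p₂, h₂, rfl, rfl⟩ := (Multiset.map_eq_cons _ _ _ _).2 hM'
    obtain ⟨M, rfl⟩ := Multiset.exists_cons_of_mem h₁
    rw [Multiset.erase_cons_head] at h₂ ⊢
    obtain ⟨M, rfl⟩ := Multiset.exists_cons_of_mem h₂
    rw [Multiset.erase_cons_head]
    refine ⟨(p₁.1 + p₂.1, p₁.2 + p₂.2) ::ₘ M, by simp, by simpa [add_assoc] using hs, ?_, ?_⟩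
    · intro p hp
      rcases Multiset.mem_cons.1 hp with rfl | hp
      · simp [hw p₁ (by simp), hw p₂ (by simp)]
      · exact hw p (by simp [hp])
    · rcases Multiset.mem_cons.1 hp₀ with rfl | hp₀
      · exact ⟨_, Multiset.mem_cons_self _ _, hp₀'.trans (Multiset.le_add_right _ _)⟩
      · rcases Multiset.mem_cons.1 hp₀ with rfl | hp₀
        · exact ⟨_, Multiset.mem_cons_self _ _, hp₀'.trans (Multiset.le_add_left _ _)⟩
        · exact ⟨p₀, Multiset.mem_cons_of_mem hp₀, hp₀'⟩
  | move B₁ C x _ hx hle ih =>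
    obtain ⟨M, hM, hs, hw, p₀, hp₀, hp₀'⟩ := ih
    obtain ⟨p₁, h₁, rfl, rfl⟩ := (Multiset.map_eq_cons _ _ _ _).2 hM
    obtain ⟨M, rfl⟩ := Multiset.exists_cons_of_mem h₁
    rw [Multiset.erase_cons_head]
    refine ⟨(p₁.1, p₁.2 - (plus x).val + (minus x).val) ::ₘ M, by simp, by simpa using hs, ?_, ?_⟩
    · intro p hp
      rcases Multiset.mem_cons.1 hp with rfl | hp
      · rw [hw p₁ (by simp)]
        obtain ⟨D, hD⟩ := Multiset.le_iff_exists_add.1 hle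
        simp only [hD, add_tsub_cancel_left, Multiset.map_add, Multiset.sum_add]
        rw [mem_ortho_iff] at hx
        change ∑ i ∈ plus x, w i + _ = _ + ∑ i ∈ minus x, w i
        rw [hx, add_comm]
      · exact hw p (by simp [hp])
    · rcases Multiset.mem_cons.1 hp₀ with rfl | hp₀
      · exact ⟨_, Multiset.mem_cons_self _ _, hp₀'⟩
      · exact ⟨p₀, Multiset.mem_cons_of_mem hp₀, hp₀'⟩

theorem IsDownClosed.of_subset {S : Set (Fin n → SignType)} {P : Set (Setoid (Fin n))}
    (h : ∀ π ∈ P, ∀ τ, Reach S (blocks π) (blocks τ) → τ ∈ P) : IsDownClosed S P :=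
  Set.Subset.antisymm (fun τ ⟨π, hπ, hr⟩ => h π hπ τ hr) fun π hπ => ⟨π, hπ, .refl⟩

theorem IsDownClosed.mono {S T : Set (Fin n → SignType)} {P : Set (Setoid (Fin n))}
    (h : IsDownClosed T P) (hST : S ⊆ T) : IsDownClosed S P :=
  .of_subset fun π hπ _ hr => h ▸ ⟨π, hπ, hr.mono hST⟩

theorem isDownClosed_empty (S : Set (Fin n → SignType)) : IsDownClosed S ∅ :=
  .of_subset fun _ h => h.elim

/-- Follow the decomposition `B` through the matching of blocks of `τ` with unions of blocks of `π`
of equal weight. Either some block of `τ` has fewer elements of weight `c` than its partner, or the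
numbers agree everywhere and `B` plays the role of one extra copy of `c`. `Splits` finds a
decomposition in both cases; the second may occur with no element of weight `c` present, which
explains the bound `max 1` there. -/
theorem theta_isDownClosed (hw : ∀ i, 0 < w i) (hc : 0 < c) (h : Splits w c) :
    IsDownClosed (ortho w) (theta w c) := by
  refine .of_subset ?_
  rintro π ⟨B, hB2, hBs, hB⟩ τ hr
  have hne : B.Nonempty := Finset.card_pos.1 (by omega)
  obtain ⟨M, hM, hs, hMw, p₀, hp₀, hp₀'⟩ := hr.exists_matching hne hB
  have hfin1 : ∀ p ∈ M, ∃ g : Finset (Fin n), g.val = p.1 := by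
    intro p hp
    have h1 : p.1 ≤ (Finset.univ : Finset (Fin n)).val := by
      rw [← hs]
      exact Multiset.le_sum_of_mem (Multiset.mem_map_of_mem _ hp)
    exact ⟨⟨p.1, Multiset.nodup_of_le h1 Finset.univ.nodup⟩, rfl⟩
  have hfin2 : ∀ p ∈ M, ∃ t ∈ blockSet τ, t.val = p.2 := by
    intro p hp
    have h1 : p.2 ∈ blocks τ := hM ▸ Multiset.mem_map_of_mem _ hp
    rw [blocks_eq_map] at h1
    exact Multiset.mem_map.1 h1
  have hcount : ∀ g : Finset (Fin n), g.val.countP (fun i => w i = c) = (g ∩ tops w c).card := by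
    intro g
    rw [Multiset.countP_eq_card_filter, ← Finset.filter_val, Finset.card_val]
    congr 1
    ext i
    simp [mem_tops]
  have key : ∀ t ∈ blockSet τ, (∃ B' ⊆ t \ tops w c, ∑ i ∈ B', w i = c) → τ ∈ theta w c :=
    fun t ht h' => mem_theta_of_splits hc (fun i hi => ne_of_mem_sdiff_tops hi) h'
      fun i hi j hj => rel_of_mem_blockSet ht (Finset.mem_sdiff.1 hi).1 (Finset.mem_sdiff.1 hj).1
  by_cases hlt : ∃ p ∈ M, p.2.countP (fun i => w i = c) < p.1.countP (fun i => w i = c)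
  · obtain ⟨p, hp, hlt⟩ := hlt
    obtain ⟨g, hg⟩ := hfin1 p hp
    obtain ⟨t, ht, ht'⟩ := hfin2 p hp
    have hwp := hMw p hp
    rw [← hg, ← ht'] at hwp hlt
    rw [hcount, hcount] at hlt
    exact key t ht (h.exists_of_card_lt hwp hlt)
  · push Not at hlt
    -- Both families have total sum the whole index set, so termwise inequalities with equal totals
    -- are equalities.
    have heq : p₀.1.countP (fun i => w i = c) = p₀.2.countP (fun i => w i = c) := by
      have htot : ((M.map Prod.fst).map (Multiset.countP fun i => w i = c)).sum =
          ((M.map Prod.snd).map (Multiset.countP fun i => w i = c)).sum := by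
        have hlin : ∀ D : Multiset (Multiset (Fin n)),
            (D.map (Multiset.countP fun i => w i = c)).sum = D.sum.countP fun i => w i = c := by
          intro D
          exact (map_multiset_sum (Multiset.countPAddMonoidHom fun i => w i = c) D).symm
        rw [hlin, hlin, hs, hM, sum_blocks]
      rw [Multiset.map_map, Multiset.map_map] at htot
      by_contra hne'
      exact htot.not_lt (Multiset.sum_lt_sum hlt ⟨p₀, hp₀, lt_of_le_of_ne (hlt p₀ hp₀) hne'⟩)
    obtain ⟨g, hg⟩ := hfin1 p₀ hp₀
    obtain ⟨t, ht, ht'⟩ := hfin2 p₀ hp₀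
    have hwp := hMw p₀ hp₀
    rw [← hg, ← ht'] at hwp heq
    rw [← hg, Finset.val_le_iff] at hp₀'
    rw [hcount, hcount] at heq
    replace hwp : ∑ i ∈ g, w i = ∑ i ∈ t, w i := hwp
    rw [sum_eq_tops_add (c := c) g, sum_eq_tops_add (c := c) t, heq, add_right_inj] at hwp
    have hBg : B ⊆ g \ tops w c := fun i hi => Finset.mem_sdiff.2 ⟨hp₀' hi, fun hi' =>
      (lt_of_two_le_card hw hB2 hBs hi).ne (mem_tops.1 hi')⟩
    -- `B` is replaced by a single copy of `c`.
    refine key t ht (h ((g \ tops w c) \ B) _ 1 ?_ le_rfl (le_max_left _ _) ?_)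
    · intro i hi
      rcases Finset.mem_union.1 hi with hi | hi
      · exact ne_of_mem_sdiff_tops (Finset.mem_sdiff.1 hi).1
      · exact ne_of_mem_sdiff_tops hi
    · rw [← hwp, ← Finset.sum_sdiff hBg, hBs]
      omega

/-- The lexicographically largest set of two or more indices of total weight `c`. -/
structure IsMaxRep (w : Fin n → ℕ) (c : ℕ) (J : Finset (Fin n)) : Prop where
  two_le : 2 ≤ J.card
  sum_eq : ∑ i ∈ J, w i = c
  max : ∀ B : Finset (Fin n), 2 ≤ B.card → ∑ i ∈ B, w i = c → toColex B ≤ toColex J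

theorem exists_isMaxRep (h : ∃ B : Finset (Fin n), 2 ≤ B.card ∧ ∑ i ∈ B, w i = c) :
    ∃ J, IsMaxRep w c J := by
  obtain ⟨B, hB⟩ := h
  obtain ⟨J, hJ, hmax⟩ := Finset.exists_max_image
    (Finset.univ.filter fun B : Finset (Fin n) => 2 ≤ B.card ∧ ∑ i ∈ B, w i = c)
    (fun B => toColex B) ⟨B, by simpa using hB⟩
  rw [Finset.mem_filter] at hJ
  exact ⟨J, hJ.2.1, hJ.2.2, fun B h1 h2 => hmax B (by simp [h1, h2])⟩

/-- Induction upwards in the lexicographic order: for `B ≠ J`, `Exchange` trades a subset `C` of `B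
∖ J` for the largest element `q` of the symmetric difference. The result is again a decomposition of
`c`, is larger than `B`, and reaches `B` by the reverse exchange. -/
theorem IsMaxRep.reach {J : Finset (Fin n)} (hJ : IsMaxRep w c J) (hw : ∀ i, 0 < w i)
    (hm : Monotone w) (hE : Exchange w c) (B : Finset (Fin n)) (hB : 2 ≤ B.card)
    (hs : ∑ i ∈ B, w i = c) :
    Reach (ortho w) (blocks (blockPart J)) (blocks (blockPart B)) := by
  have : Finite (Colex (Finset (Fin n))) := Finite.of_equiv _ toColex
  generalize hx : toColex B = x
  induction x using WellFoundedGT.induction generalizing B with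
  | ind x ih =>
  subst hx
  by_cases hBJ : B = J
  · subst hBJ
    exact .refl
  have hlt : toColex B < toColex J := lt_of_le_of_ne (hJ.max B hB hs) (by simpa using hBJ)
  obtain ⟨hne, hq⟩ := Finset.Colex.toColex_lt_toColex_iff_max'_mem.1 hlt
  set q := (symmDiff B J).max' (Finset.symmDiff_nonempty.2 hne) with hqdef
  have hqm := Finset.max'_mem _ (Finset.symmDiff_nonempty.2 hne)
  rw [← hqdef] at hqm
  have hqB : q ∉ B := by
    rcases Finset.mem_symmDiff.1 hqm with h | h
    · exact absurd hq h.2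
    · exact h.2
  have hle : ∀ i ∈ symmDiff B J, i ≤ q := fun i hi => Finset.le_max' _ i hi
  have hsd : ∀ i ∈ J \ B ∪ B \ J, i ∈ symmDiff B J := by
    intro i hi
    rw [Finset.mem_symmDiff]
    simp only [Finset.mem_union, Finset.mem_sdiff] at hi
    tauto
  have hltc : ∀ i ∈ J \ B ∪ B \ J, w i < c := by
    intro i hi
    rcases Finset.mem_union.1 hi with hi | hi
    · exact lt_of_two_le_card hw hJ.two_le hJ.sum_eq (Finset.mem_sdiff.1 hi).1
    · exact lt_of_two_le_card hw hB hs (Finset.mem_sdiff.1 hi).1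
  obtain ⟨C, hC, hCs⟩ := hE (J \ B) (B \ J) hltc
    (Finset.sum_sdiff_eq_sum_sdiff_iff.2 (hJ.sum_eq.trans hs.symm)) q
    (Finset.mem_sdiff.2 ⟨hq, hqB⟩) fun i hi => hm (hle i (hsd i hi))
  have hCB : C ⊆ B := hC.trans Finset.sdiff_subset
  have hqBC : q ∉ B \ C := fun h => hqB (Finset.mem_sdiff.1 h).1
  have hCne : C.Nonempty := by
    rw [Finset.nonempty_iff_ne_empty]
    rintro rfl
    have := hw q
    simp at hCs
    omega
  have hqC : q ∉ C := fun h => hqB (hCB h)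
  have hs1 : ∑ i ∈ insert q (B \ C), w i = c := by
    rw [Finset.sum_insert hqBC, ← hCs, add_comm, Finset.sum_sdiff hCB, hs]
  have hqc : w q < c := lt_of_two_le_card hw hJ.two_le hJ.sum_eq hq
  -- One element would not do, as `w q < c`.
  have h2 : 2 ≤ (insert q (B \ C)).card := by
    rw [Finset.card_insert_of_notMem hqBC]
    by_contra h
    have h0 : B \ C = ∅ := Finset.card_eq_zero.1 (by omega)
    rw [h0, insert_empty_eq, Finset.sum_singleton] at hs1
    omega
  have hgt : toColex B < toColex (insert q (B \ C)) := by
    rw [Finset.Colex.toColex_lt_toColex]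
    refine ⟨fun h => hqB (h ▸ Finset.mem_insert_self _ _), fun a ha ha' =>
      ⟨q, Finset.mem_insert_self _ _, hqB, ?_⟩⟩
    have haC : a ∈ C := by
      by_contra h
      exact ha' (Finset.mem_insert_of_mem (Finset.mem_sdiff.2 ⟨ha, h⟩))
    exact hle a (hsd a (Finset.mem_union_right _ (hC haC)))
  have r := reach_exchange (S := ortho w) (B := insert q (B \ C)) (Finset.mem_insert_self _ _) hCne
    (Finset.disjoint_insert_left.2 ⟨hqC, Finset.sdiff_disjoint⟩)
    (signVec_mem_ortho (Finset.disjoint_singleton_left.2 hqC) (by simp [hCs]))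
    (signVec_mem_ortho (Finset.disjoint_singleton_right.2 hqC) (by simp [hCs]))
  rw [Finset.erase_insert hqBC, Finset.sdiff_union_of_subset hCB] at r
  exact (ih _ hgt _ h2 hs1 rfl).trans r

theorem IsMaxRep.down_eq {J : Finset (Fin n)} (hJ : IsMaxRep w c J) (hw : ∀ i, 0 < w i)
    (hc : 0 < c) (hm : Monotone w) (hE : Exchange w c) (hS : Splits w c) :
    down (ortho w) {blockPart J} = theta w c := by
  refine Set.Subset.antisymm ?_ ?_
  · rintro τ ⟨_, rfl, hr⟩
    rw [← theta_isDownClosed hw hc hS]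
    exact ⟨blockPart J, ⟨J, hJ.two_le, hJ.sum_eq, fun i hi j hj => Or.inr ⟨hi, hj⟩⟩, hr⟩
  · rintro τ ⟨B, hB, hs, hτ⟩
    exact ⟨_, rfl, (hJ.reach hw hm hE B hB hs).trans
      (reach_of_block (Finset.card_pos.1 (by omega)) hτ)⟩

end Weights

/-! ### Gluing -/

section Glue

variable {n m : ℕ} {w : Fin n → ℕ} {c : ℕ} {π : OrdPart n m} {J : Finset (Fin n)}

/-- The weights of the blocks of an ordered set partition. -/
def push (π : OrdPart n m) (w : Fin n → ℕ) : Fin m → ℕ := fun j =>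
  ∑ i ∈ Finset.univ.filter fun i => π.block i = j, w i

theorem act_carrier_eq {S : Cut n} (hS : S.carrier = ortho w) (π : OrdPart n m) :
    (S.act π).carrier = ortho (push π w) := by
  ext x
  change x ∘ π.block ∈ S.carrier ↔ _
  rw [hS]
  change ∑ i, vec (x ∘ π.block) i * (w i : ℝ) = 0 ↔ ∑ j, vec x j * (push π w j : ℝ) = 0
  rw [← Finset.sum_fiberwise _ π.block]
  have : ∀ j, ∑ i ∈ Finset.univ.filter (fun i => π.block i = j),
      vec (x ∘ π.block) i * (w i : ℝ) = vec x j * (push π w j : ℝ) := by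
    intro j
    rw [push, Nat.cast_sum, Finset.mul_sum]
    refine Finset.sum_congr rfl fun i hi => ?_
    rw [← (Finset.mem_filter.1 hi).2]
    rfl
  simp only [this]

theorem push_pos (hw : ∀ i, 0 < w i) (j : Fin m) : 0 < push π w j := by
  obtain ⟨i, hi⟩ := π.surj j
  exact Finset.sum_pos (fun i _ => hw i) ⟨i, by simp [hi]⟩

/-- The indices in the blocks with numbers in `A`. -/
def pull (π : OrdPart n m) (A : Finset (Fin m)) : Finset (Fin n) :=
  Finset.univ.filter fun i => π.block i ∈ A

theorem mem_pull {A : Finset (Fin m)} {i : Fin n} : i ∈ pull π A ↔ π.block i ∈ A := by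
  simp [pull]

theorem sum_pull (A : Finset (Fin m)) : ∑ i ∈ pull π A, w i = ∑ j ∈ A, push π w j := by
  rw [← Finset.sum_fiberwise_of_maps_to (t := A) (g := π.block) fun i hi => mem_pull.1 hi]
  refine Finset.sum_congr rfl fun j hj => ?_
  rw [push]
  refine Finset.sum_congr ?_ fun _ _ => rfl
  ext i
  simp only [Finset.mem_filter, mem_pull, Finset.mem_univ, true_and]
  exact ⟨fun h => h.2, fun h => ⟨h ▸ hj, h⟩⟩

theorem block_eq_iff (hπ : π.un = blockPart J) {i j : Fin n} :
    π.block i = π.block j ↔ i = j ∨ (i ∈ J ∧ j ∈ J) := by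
  have : π.un i j ↔ blockPart J i j := by rw [hπ]
  exact this

theorem push_of_notMem (hπ : π.un = blockPart J) {i : Fin n} (hi : i ∉ J) :
    push π w (π.block i) = w i := by
  rw [push, show (Finset.univ.filter fun k => π.block k = π.block i) = {i} by
    ext k
    simp [block_eq_iff hπ, hi], Finset.sum_singleton]

theorem push_of_mem (hπ : π.un = blockPart J) {i : Fin n} (hi : i ∈ J) :
    push π w (π.block i) = ∑ k ∈ J, w k := by
  rw [push, show (Finset.univ.filter fun k => π.block k = π.block i) = J by
    ext k
    simp only [Finset.mem_filter, Finset.mem_univ, true_and, block_eq_iff hπ]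
    refine ⟨?_, fun h => Or.inr ⟨h, hi⟩⟩
    rintro (rfl | h)
    exacts [hi, h.1]]

theorem notMem_of_push_ne (hπ : π.un = blockPart J) (hs : ∑ i ∈ J, w i = c) {i : Fin n}
    (h : push π w (π.block i) ≠ c) : i ∉ J :=
  fun hi => h ((push_of_mem hπ hi).trans hs)

theorem push_block_of_ne (hπ : π.un = blockPart J) (hs : ∑ i ∈ J, w i = c) {i : Fin n}
    (h : push π w (π.block i) ≠ c) : w i = push π w (π.block i) :=
  (push_of_notMem hπ (notMem_of_push_ne hπ hs h)).symm

/-- A block of weight different from `c` is not the glued one, hence a singleton, so subsets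
upstairs and downstairs correspond. -/
theorem exists_subset_push (hπ : π.un = blockPart J) (hs : ∑ i ∈ J, w i = c) {B : Finset (Fin m)}
    (hB : ∀ j ∈ B, push π w j ≠ c) {d : ℕ} (h : ∃ B' ⊆ pull π B, ∑ i ∈ B', w i = d) :
    ∃ B' ⊆ B, ∑ j ∈ B', push π w j = d := by
  obtain ⟨B', hB', rfl⟩ := h
  have hne : ∀ i ∈ B', push π w (π.block i) ≠ c := fun i hi => hB _ (mem_pull.1 (hB' hi))
  refine ⟨B'.image π.block, fun j hj => ?_, ?_⟩
  · obtain ⟨i, hi, rfl⟩ := Finset.mem_image.1 hj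
    exact mem_pull.1 (hB' hi)
  · rw [Finset.sum_image]
    · exact Finset.sum_congr rfl fun i hi => (push_block_of_ne hπ hs (hne i hi)).symm
    · intro i hi j hj hij
      rcases (block_eq_iff hπ).1 hij with h | h
      · exact h
      · exact absurd h.1 (notMem_of_push_ne hπ hs (hne i hi))

/-- The glued block has weight `c`, while `Exchange` only concerns weights below `c`, so nothing new
arises. -/
theorem Exchange.push (hE : Exchange w c) (hπ : π.un = blockPart J) (hs : ∑ i ∈ J, w i = c) :
    Exchange (push π w) c := by
  intro A B hlt hAB q hq hmax
  have key : ∀ i ∈ pull π A ∪ pull π B, π.block i ∈ A ∪ B ∧ w i = Resonance.push π w (π.block i) := by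
    intro i hi
    have hi' : π.block i ∈ A ∪ B := by
      simpa [mem_pull] using hi
    exact ⟨hi', push_block_of_ne hπ hs (hlt _ hi').ne⟩
  obtain ⟨i, rfl⟩ := π.surj q
  have hi : i ∈ pull π A := mem_pull.2 hq
  have hwi := (key i (Finset.mem_union_left _ hi)).2
  rw [← hwi]
  refine exists_subset_push hπ hs (fun j hj => (hlt j (Finset.mem_union_right _ hj)).ne)
    (hE (pull π A) (pull π B) ?_ (by rw [sum_pull, sum_pull, hAB]) i hi ?_)
  · intro j hj
    rw [(key j hj).2]
    exact hlt _ (key j hj).1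
  · intro j hj
    rw [(key j hj).2, hwi]
    exact hmax _ (key j hj).1

/-- The glued block is a new element of weight `c`. The difference is needed because `J` may be a
single index of weight `c`. -/
theorem tops_push_card (hπ : π.un = blockPart J) (hJ : J.Nonempty) (hs : ∑ i ∈ J, w i = c) :
    (tops (push π w) c).card = (tops w c \ J).card + 1 := by
  obtain ⟨j, hj⟩ := hJ
  have h1 : tops (push π w) c = insert (π.block j) ((tops w c \ J).image π.block) := by
    ext k
    obtain ⟨i, rfl⟩ := π.surj k
    rw [mem_tops, Finset.mem_insert, Finset.mem_image]
    by_cases hi : i ∈ J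
    · rw [push_of_mem hπ hi]
      exact iff_of_true hs (Or.inl ((block_eq_iff hπ).2 (Or.inr ⟨hi, hj⟩)))
    · rw [push_of_notMem hπ hi]
      constructor
      · exact fun h => Or.inr ⟨i, Finset.mem_sdiff.2 ⟨mem_tops.2 h, hi⟩, rfl⟩
      · rintro (h | ⟨k, hk, h⟩)
        · rcases (block_eq_iff hπ).1 h with rfl | h
          · exact absurd hj hi
          · exact absurd h.1 hi
        · rcases (block_eq_iff hπ).1 h with rfl | h
          · exact mem_tops.1 (Finset.mem_sdiff.1 hk).1
          · exact absurd h.2 hi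
  rw [h1, Finset.card_insert_of_notMem, Finset.card_image_of_injOn]
  · intro i hi k hk h
    rcases (block_eq_iff hπ).1 h with h | h
    · exact h
    · exact absurd h.1 (Finset.mem_sdiff.1 hi).2
  · intro h
    obtain ⟨k, hk, h⟩ := Finset.mem_image.1 h
    rcases (block_eq_iff hπ).1 h with rfl | h
    · exact (Finset.mem_sdiff.1 hk).2 hj
    · exact (Finset.mem_sdiff.1 hk).2 h.1

/-- Reduces `Splits` after gluing to a statement about the elements outside `J`; the additional copy
of `c` allowed in `a` is the glued block. -/
theorem splits_push (hπ : π.un = blockPart J) (hJ : J.Nonempty) (hs : ∑ i ∈ J, w i = c)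
    (h : ∀ (A B : Finset (Fin n)) (a : ℕ), (∀ i ∈ A ∪ B, w i ≠ c ∧ i ∉ J) → 1 ≤ a →
      a ≤ (tops w c \ J).card + 1 → a * c + ∑ i ∈ A, w i = ∑ i ∈ B, w i →
      ∃ B' ⊆ B, ∑ i ∈ B', w i = c) : Splits (push π w) c := by
  intro A B a hne h1 ha hAB
  rw [tops_push_card hπ hJ hs, max_eq_right (by omega)] at ha
  refine exists_subset_push hπ hs (fun j hj => hne j (Finset.mem_union_right _ hj))
    (h (pull π A) (pull π B) a ?_ h1 ha (by rw [sum_pull, sum_pull, hAB]))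
  intro i hi
  have hi' : π.block i ∈ A ∪ B := by simpa [mem_pull] using hi
  refine ⟨?_, notMem_of_push_ne hπ hs (hne _ hi')⟩
  rw [push_block_of_ne hπ hs (hne _ hi')]
  exact hne _ hi'

theorem tops_sdiff_of_two_le (hw : ∀ i, 0 < w i) (hJ : 2 ≤ J.card) (hs : ∑ i ∈ J, w i = c) :
    tops w c \ J = tops w c :=
  Finset.sdiff_eq_self_of_disjoint (Finset.disjoint_left.2 fun _ hi hi' =>
    (lt_of_two_le_card hw hJ hs hi').ne (mem_tops.1 hi))

/-- If `a` exceeds the old multiplicity of `c`, one copy of `c` is replaced by the elements of `J`.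
There remains at least one copy because `c` already occurred. -/
theorem Splits.push (hS : Splits w c) (hw : ∀ i, 0 < w i) (ht : 1 ≤ (tops w c).card)
    (hπ : π.un = blockPart J) (hJ : 2 ≤ J.card) (hs : ∑ i ∈ J, w i = c) :
    Splits (push π w) c := by
  refine splits_push hπ (Finset.card_pos.1 (by omega)) hs ?_
  rw [tops_sdiff_of_two_le hw hJ hs]
  intro A B a hne h1 ha hAB
  by_cases ha' : a ≤ (tops w c).card
  · exact hS A B a (fun i hi => (hne i hi).1) h1 (ha'.trans (le_max_right _ _)) hAB
  · have hd : Disjoint A J :=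
      Finset.disjoint_left.2 fun i hi => (hne i (Finset.mem_union_left _ hi)).2
    refine hS (A ∪ J) B (a - 1) ?_ (by omega) ((Nat.sub_le_iff_le_add.2 ha).trans
      (le_max_right _ _)) ?_
    · intro i hi
      rw [Finset.mem_union, Finset.mem_union] at hi
      rcases hi with (hi | hi) | hi
      · exact (hne i (Finset.mem_union_left _ hi)).1
      · exact (lt_of_two_le_card hw hJ hs hi).ne
      · exact (hne i (Finset.mem_union_right _ hi)).1
    · rw [Finset.sum_union hd, hs, ← hAB]
      obtain ⟨b, rfl⟩ := Nat.exists_eq_add_of_le' h1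
      rw [Nat.add_sub_cancel]
      ring

/-- Every set partition underlies an ordered set partition with nondecreasing weights. -/
theorem exists_ordPart_monotone (τ : Setoid (Fin n)) (w : Fin n → ℕ) :
    ∃ (m : ℕ) (π : OrdPart n m), π.un = τ ∧ Monotone (push π w) := by
  classical
  let e := Fintype.equivFin (Quotient τ)
  let π₀ : OrdPart n (Fintype.card (Quotient τ)) :=
    ⟨fun i => e (Quotient.mk τ i), e.surjective.comp Quotient.mk_surjective⟩
  let σ := Tuple.sort (push π₀ w)
  refine ⟨_, ⟨fun i => σ.symm (π₀.block i), σ.symm.surjective.comp π₀.surj⟩, ?_, ?_⟩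
  · ext i j
    change σ.symm (e (Quotient.mk τ i)) = σ.symm (e (Quotient.mk τ j)) ↔ _
    rw [σ.symm.injective.eq_iff, e.injective.eq_iff]
    exact Quotient.eq
  · have h : push ⟨fun i => σ.symm (π₀.block i), σ.symm.surjective.comp π₀.surj⟩ w =
        push π₀ w ∘ σ := by
      funext j
      simp only [push, Function.comp_apply, Equiv.symm_apply_eq]
    rw [h]
    exact Tuple.monotone_sort _

theorem OrdPart.lt_of_two_le_card (hπ : π.un = blockPart J) (hJ : 2 ≤ J.card) : m < n := by
  obtain ⟨i, hi, j, hj, hij⟩ := Finset.one_lt_card.1 hJ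
  have h1 : ¬ Function.Injective π.block := fun h =>
    hij (h ((block_eq_iff hπ).2 (Or.inr ⟨hi, hj⟩)))
  have h2 := Fintype.card_lt_of_surjective_not_injective π.block π.surj h1
  simpa using h2

end Glue

/-! ### Restriction of weights -/

section Comp

variable {n k : ℕ} {v : Fin n → ℕ} {c : ℕ}

theorem Splits.comp (h : Splits v c) (e : Fin k ↪ Fin n) : Splits (v ∘ e) c := by
  intro A B a hne h1 ha hAB
  obtain ⟨B', hB', hs⟩ := h (A.map e) (B.map e) a (by
      intro i hi
      rw [← Finset.map_union] at hi
      obtain ⟨j, hj, rfl⟩ := Finset.mem_map.1 hi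
      exact hne j hj) h1 (ha.trans (max_le_max le_rfl (by
        rw [← Finset.card_map e]
        refine Finset.card_le_card fun i hi => ?_
        obtain ⟨j, hj, rfl⟩ := Finset.mem_map.1 hi
        exact mem_tops.2 ((mem_tops (w := v ∘ e)).1 hj)))) (by simpa using hAB)
  obtain ⟨C, hC, rfl⟩ := Finset.subset_map_iff.1 hB'
  exact ⟨C, hC, by simpa using hs⟩

theorem Exchange.comp (h : Exchange v c) (e : Fin k ↪ Fin n) : Exchange (v ∘ e) c := by
  intro A B hlt hAB q hq hmax
  obtain ⟨B', hB', hs⟩ := h (A.map e) (B.map e) (by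
      intro i hi
      rw [← Finset.map_union] at hi
      obtain ⟨j, hj, rfl⟩ := Finset.mem_map.1 hi
      exact hlt j hj) (by simpa using hAB) (e q) (Finset.mem_map_of_mem e hq) (by
      intro i hi
      rw [← Finset.map_union] at hi
      obtain ⟨j, hj, rfl⟩ := Finset.mem_map.1 hi
      exact hmax j hj)
  obtain ⟨C, hC, rfl⟩ := Finset.subset_map_iff.1 hB'
  exact ⟨C, hC, by simpa using hs⟩

/-- The members of a decomposition of `c` are lighter than `c`, so the range of `e` contains all
that matter. -/
theorem comap_mem_theta_iff (hv : ∀ i, 0 < v i) (e : Fin k ↪ Fin n)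
    (he : ∀ i, v i < c → i ∈ Set.range e) {τ : Setoid (Fin n)} :
    Setoid.comap e τ ∈ theta (v ∘ e) c ↔ τ ∈ theta v c := by
  constructor
  · rintro ⟨B, hB, hs, hτ⟩
    refine ⟨B.map e, by simpa using hB, by simpa using hs, ?_⟩
    intro i hi j hj
    obtain ⟨i', hi', rfl⟩ := Finset.mem_map.1 hi
    obtain ⟨j', hj', rfl⟩ := Finset.mem_map.1 hj
    exact hτ i' hi' j' hj'
  · rintro ⟨B, hB, hs, hτ⟩
    have h1 : B ⊆ Finset.univ.map e := by
      intro i hi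
      obtain ⟨j, rfl⟩ := he i (lt_of_two_le_card hv hB hs hi)
      exact Finset.mem_map_of_mem e (Finset.mem_univ j)
    obtain ⟨C, -, rfl⟩ := Finset.subset_map_iff.1 h1
    exact ⟨C, by simpa using hB, by simpa using hs, fun i hi j hj =>
      hτ _ (Finset.mem_map_of_mem e hi) _ (Finset.mem_map_of_mem e hj)⟩

theorem comap_signPart (e : Fin k ↪ Fin n) (x : Fin n → SignType) :
    Setoid.comap e (signPart x) = signPart (x ∘ e) := by
  ext i j
  change e i = e j ∨ _ ↔ i = j ∨ _
  rw [e.injective.eq_iff]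
  rfl

theorem comp_mem_ortho_iff (σ : Equiv.Perm (Fin n)) {x : Fin n → SignType} :
    x ∘ σ ∈ ortho (v ∘ σ) ↔ x ∈ ortho v := by
  change ∑ i, vec x (σ i) * (v (σ i) : ℝ) = 0 ↔ ∑ i, vec x i * (v i : ℝ) = 0
  rw [Equiv.sum_comp σ fun i => vec x i * (v i : ℝ)]

theorem ortho_const (hc : 0 < c) : ortho (fun _ : Fin n => c) = ortho fun _ => 1 := by
  ext x
  change ∑ i, vec x i * (c : ℝ) = 0 ↔ ∑ i, vec x i * ((1 : ℕ) : ℝ) = 0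
  rw [← Finset.sum_mul, ← Finset.sum_mul]
  have : (c : ℝ) ≠ 0 := by exact_mod_cast hc.ne'
  simp [this]

/-- The side with fewer elements of weight `c` must contain a decomposition of `c`. -/
theorem mem_theta_of_card_lt (hc : 0 < c) (h : Splits v c) {s : Fin n → SignType}
    (hs : s ∈ ortho v)
    (hne : (plus s ∩ tops v c).card ≠ (minus s ∩ tops v c).card) : signPart s ∈ theta v c := by
  rw [mem_ortho_iff] at hs
  rcases lt_or_gt_of_ne hne with hlt | hlt
  · refine mem_theta_of_splits hc (fun i hi => ne_of_mem_sdiff_tops hi)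
      (h.exists_of_card_lt hs.symm hlt) fun i hi j hj => Or.inr ?_
    rw [mem_plus.1 (Finset.mem_sdiff.1 hi).1, mem_plus.1 (Finset.mem_sdiff.1 hj).1]
    decide
  · refine mem_theta_of_splits hc (fun i hi => ne_of_mem_sdiff_tops hi)
      (h.exists_of_card_lt hs hlt) fun i hi j hj => Or.inr ?_
    rw [mem_minus.1 (Finset.mem_sdiff.1 hi).1, mem_minus.1 (Finset.mem_sdiff.1 hj).1]
    decide

end Comp

/-! ### Separating the coordinates of weight `c` -/

section Product

variable {k m : ℕ} {v : Fin (k + m) → ℕ} {c : ℕ}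

theorem mem_range_castAdd_of_lt (h2 : ∀ j, v (Fin.natAdd k j) = c) (i : Fin (k + m)) (hi : v i < c) :
    i ∈ Set.range (Fin.castAddEmb m : Fin k ↪ Fin (k + m)) := by
  induction i using Fin.addCases with
  | left i => exact ⟨i, rfl⟩
  | right j => exact absurd (h2 j) hi.ne

theorem theta_eq_prodInf (hv : ∀ i, 0 < v i) (h2 : ∀ j, v (Fin.natAdd k j) = c) :
    theta v c = prodInf (theta (v ∘ Fin.castAdd m) c) (∅ : Set (Setoid (Fin m))) := by
  ext τ
  rw [← comap_mem_theta_iff hv (Fin.castAddEmb m) (mem_range_castAdd_of_lt h2)]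
  simp only [prodInf, Set.mem_ofPred_eq, Set.mem_empty_iff_false, or_false]
  rfl

theorem mem_ortho_add_iff (h2 : ∀ j, v (Fin.natAdd k j) = c) {s : Fin (k + m) → SignType}
    (hs : s ∘ Fin.natAdd k ∈ ortho fun _ => 1) :
    s ∘ Fin.castAdd m ∈ ortho (v ∘ Fin.castAdd m) ↔ s ∈ ortho v := by
  change ∑ j, vec s (Fin.natAdd k j) * ((1 : ℕ) : ℝ) = 0 at hs
  change ∑ i, vec s (Fin.castAdd m i) * (v (Fin.castAdd m i) : ℝ) = 0 ↔ ∑ i, vec s i * (v i : ℝ) = 0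
  rw [Nat.cast_one, ← Finset.sum_mul, mul_one] at hs
  simp only [Fin.sum_univ_add, h2]
  rw [← Finset.sum_mul, hs, zero_mul, add_zero]

/-- A survivor has equally many elements of weight `c` with either sign. So its last `m` coordinates
balance by themselves, and then so do the others. -/
theorem remove_theta_eq_prodSet (hv : ∀ i, 0 < v i) (hc : 0 < c) (hS : Splits v c)
    (h1 : ∀ i, v (Fin.castAdd m i) ≠ c) (h2 : ∀ j, v (Fin.natAdd k j) = c) :
    remove (ortho v) (theta v c) =
      prodSet (remove (ortho (v ∘ Fin.castAdd m)) (theta (v ∘ Fin.castAdd m) c))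
        (ortho fun _ : Fin m => 1) := by
  ext s
  have hθ : signPart s ∈ theta v c ↔
      signPart (s ∘ Fin.castAdd m) ∈ theta (v ∘ Fin.castAdd m) c := by
    rw [← comap_mem_theta_iff hv (Fin.castAddEmb m) (mem_range_castAdd_of_lt h2), comap_signPart]
    rfl
  constructor
  · rintro ⟨hs, hθs⟩
    have hone : s ∘ Fin.natAdd k ∈ ortho fun _ : Fin m => 1 := by
      have hcard : (plus s ∩ tops v c).card = (minus s ∩ tops v c).card := by
        by_contra hne
        exact hθs (mem_theta_of_card_lt hc hS hs hne)
      have e1 : ∀ a : SignType, (Finset.univ.filter fun i => s i = a) ∩ tops v c =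
          (Finset.univ.filter fun j => (s ∘ Fin.natAdd k) j = a).map (Fin.natAddEmb k) := by
        intro a
        ext i
        simp only [Finset.mem_inter, Finset.mem_filter, Finset.mem_univ, true_and, mem_tops,
          Finset.mem_map, Function.comp_apply]
        constructor
        · rintro ⟨hi, hi'⟩
          induction i using Fin.addCases with
          | left i => exact absurd hi' (h1 i)
          | right j => exact ⟨j, hi, rfl⟩
        · rintro ⟨j, hj, rfl⟩
          exact ⟨hj, h2 j⟩
      rw [mem_ortho_iff, ← Finset.card_eq_sum_ones, ← Finset.card_eq_sum_ones]
      unfold plus minus at hcard ⊢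
      rwa [e1, e1, Finset.card_map, Finset.card_map] at hcard
    exact ⟨⟨(mem_ortho_add_iff h2 hone).2 hs, fun h => hθs (hθ.2 h)⟩, hone⟩
  · rintro ⟨⟨hs, hθs⟩, hone⟩
    exact ⟨(mem_ortho_add_iff h2 hone).1 hs, fun h => hθs (hθ.1 h)⟩

end Product

/-! ### Values of resonance functors -/

section Functor

variable {F : ResCat ⥤ PTop.{u}}

theorem cubeSpan_remove_subset {n : ℕ} (S : Cut n) (P : Set (Setoid (Fin n))) :
    cubeSpan (remove S.carrier P) ⊆ S.carrier := by
  intro x hx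
  rw [← S.span_closed]
  exact Submodule.span_mono (Set.image_mono fun s hs => hs.1) hx

theorem remove_cubeSpan_remove {n : ℕ} (S : Cut n) (P : Set (Setoid (Fin n))) :
    remove (cubeSpan (remove S.carrier P)) P = remove S.carrier P :=
  Set.Subset.antisymm (fun _ hx => ⟨cubeSpan_remove_subset S P hx.1, hx.2⟩)
    fun _ hx => ⟨subset_cubeSpan _ hx, hx.2⟩

/-- The relative cut `Q(S, Π)`. -/
def Cut.rel {n : ℕ} (S : Cut n) (P : Set (Setoid (Fin n))) (hP : IsDownClosed S.carrier P) :
    RelCut n where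
  surv := remove S.carrier P
  inf := P
  pos := S.pos
  balanced := fun x hx => S.balanced x (cubeSpan_remove_subset S P hx)
  remove_eq := remove_cubeSpan_remove S P
  closed := hP.mono (cubeSpan_remove_subset S P)

/-- (A2) with the identity permutation: only the surviving elements and the partitions at infinity
matter. This allows a cut to be replaced by the possibly smaller span of its survivors. -/
theorem IsResonanceFunctor.quot_congr (hF : IsResonanceFunctor F) {n : ℕ} (S T : Cut n)
    {P : Set (Setoid (Fin n))} (hS : IsDownClosed S.carrier P) (hT : IsDownClosed T.carrier P)
    (h : remove S.carrier P = remove T.carrier P) : PHE (quot F S P) (quot F T P) :=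
  hF.relative S T P P hS hT ⟨Equiv.refl _, by rw [← h]; rfl, rfl⟩

theorem IsResonanceFunctor.quot_rel (hF : IsResonanceFunctor F) {n : ℕ} (S : Cut n)
    {P : Set (Setoid (Fin n))} (hP : IsDownClosed S.carrier P) :
    PHE (quot F (S.rel P hP).span (S.rel P hP).inf) (quot F S P) :=
  hF.quot_congr _ S (S.rel P hP).closed hP (remove_cubeSpan_remove S P)

theorem quot_empty {n : ℕ} (S : Cut n) : PHE (quot F S ∅) (F.obj S.obj) := by
  have h : (⋃ (m : ℕ) (π : OrdPart n m) (_ : π.un ∈ (∅ : Set (Setoid (Fin n)))),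
      Set.range (F.map (S.incl π)).map) = ∅ := by simp
  unfold quot
  rw [h]
  exact PHE.collapse_empty _

/-- If the indices of weight `c` come last, the quotient by the partitions in which `c` is
decomposed is a smash product. -/
theorem IsResonanceFunctor.quot_theta_phe_smash (hF : IsResonanceFunctor F) {k m : ℕ}
    {v : Fin (k + m) → ℕ} {c : ℕ} (hv : ∀ i, 0 < v i) (hc : 0 < c) (hS : Splits v c)
    (h1 : ∀ i, v (Fin.castAdd m i) ≠ c) (h2 : ∀ j, v (Fin.natAdd k j) = c)
    (S : Cut (k + m)) (hSc : S.carrier = ortho v) (T : Cut k)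
    (hT : T.carrier = ortho (v ∘ Fin.castAdd m)) (hm : 0 < m) :
    PHE (quot F S (theta v c)) (smash (quot F T (theta (v ∘ Fin.castAdd m) c))
      ((NumPart.ones m hm).space F)) := by
  have hdS : IsDownClosed S.carrier (theta v c) := hSc ▸ theta_isDownClosed hv hc hS
  have hdT : IsDownClosed T.carrier (theta (v ∘ Fin.castAdd m) c) :=
    hT ▸ theta_isDownClosed (fun i => hv _) hc (hS.comp (Fin.castAddEmb m))
  let U := (NumPart.ones m hm).cut
  have hdU : IsDownClosed U.carrier (∅ : Set (Setoid (Fin m))) := isDownClosed_empty _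
  have hprod := hF.product (T.rel _ hdT) (U.rel ∅ hdU)
  have hU : remove U.carrier ∅ = ortho fun _ => 1 := by
    ext x
    exact and_iff_left fun h => h
  have hinf : prodInf (T.rel _ hdT).inf (U.rel ∅ hdU).inf = theta v c :=
    (theta_eq_prodInf hv h2).symm
  have hcar : ((T.rel _ hdT).prodSpan (U.rel ∅ hdU)).carrier =
      cubeSpan (remove S.carrier (theta v c)) := by
    change cubeSpan (prodSet (remove T.carrier _) (remove U.carrier ∅)) = _
    rw [hSc, remove_theta_eq_prodSet hv hc hS h1 h2, hU, hT]
  rw [hinf] at hprod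
  -- (A3) yields the span of the survivors; (A2) returns from it to `S`.
  have hcongr : PHE (quot F ((T.rel _ hdT).prodSpan (U.rel ∅ hdU)) (theta v c))
      (quot F S (theta v c)) := by
    refine hF.quot_congr _ S ?_ hdS ?_
    · rw [hcar]
      exact hdS.mono (cubeSpan_remove_subset S _)
    · rw [hcar]
      exact remove_cubeSpan_remove S _
  exact ((hprod.trans hcongr).symm).trans ((hF.quot_rel T hdT).smash
    ((hF.quot_rel U hdU).trans (quot_empty U)))

theorem exists_equiv_last {n : ℕ} (s : Finset (Fin n)) :
    ∃ (k m : ℕ) (e : Fin n ≃ Fin (k + m)), m = s.card ∧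
      (∀ i, e.symm (Fin.castAdd m i) ∉ s) ∧ ∀ j, e.symm (Fin.natAdd k j) ∈ s := by
  let e₁ := Fintype.equivFin {i // i ∉ s}
  let e₂ := Fintype.equivFin {i // i ∈ s}
  let e : Fin n ≃ Fin (Fintype.card {i // i ∉ s} + Fintype.card {i // i ∈ s}) :=
    (((Equiv.sumCompl fun i => i ∈ s).symm.trans (Equiv.sumComm _ _)).trans
      (Equiv.sumCongr e₁ e₂)).trans finSumFinEquiv
  refine ⟨_, _, e, by simp, fun i => ?_, fun j => ?_⟩
  · have : e.symm (Fin.castAdd _ i) = (e₁.symm i : Fin n) := by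
      rw [Equiv.symm_apply_eq]
      simp [e]
    rw [this]
    exact (e₁.symm i).2
  · have : e.symm (Fin.natAdd _ j) = (e₂.symm j : Fin n) := by
      rw [Equiv.symm_apply_eq]
      simp [e]
    rw [this]
    exact (e₂.symm j).2

/-- Collapsing a contractible cofibrant subspace does not change the homotopy type, and (A1)
identifies the collapse with the quotient by everything below `J`. If `c` has no decomposition,
nothing is collapsed. -/
theorem IsResonanceFunctor.phe_quot_theta (hF : IsResonanceFunctor F) {n : ℕ} {w : Fin n → ℕ}
    {c : ℕ} (hw : ∀ i, 0 < w i) (hm : Monotone w) (hc : 0 < c) (hE : Exchange w c)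
    (hS : Splits w c) (S : Cut n) (hSc : S.carrier = ortho w)
    (hglue : ∀ (J : Finset (Fin n)) (m : ℕ) (π : OrdPart n m), IsMaxRep w c J →
      π.un = blockPart J → Monotone (push π w) → PContractible (F.obj (S.act π).obj)) :
    PHE (F.obj S.obj) (quot F S (theta w c)) := by
  by_cases h : ∃ B : Finset (Fin n), 2 ≤ B.card ∧ ∑ i ∈ B, w i = c
  · obtain ⟨J, hJ⟩ := exists_isMaxRep h
    obtain ⟨m, π, hπ, hmono⟩ := exists_ordPart_monotone (blockPart J) w
    have h1 : PHE (F.obj S.obj) (collapse (F.obj S.obj) (Set.range (F.map (S.incl π)).map)) :=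
      ⟨_, isPHE_collapseProj _ (hF.inclusion S π) (hglue J m π hJ hπ hmono)⟩
    have h2 := hF.inclusion_quot S π
    rw [hπ, hSc, hJ.down_eq hw hc hm hE hS] at h2
    exact h1.trans h2
  · have : theta w c = ∅ := by
      refine Set.eq_empty_iff_forall_notMem.2 ?_
      rintro τ ⟨B, hB, hs, -⟩
      exact h ⟨B, hB, hs⟩
    rw [this]
    exact (quot_empty S).symm

/-- The value on the cut of weights in which a weight `c` is repeated and is the only way to
balance `c` up to decompositions. -/
theorem IsResonanceFunctor.pContractible_of_splits (hF : IsResonanceFunctor F)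
    (hcontr : ∀ (l : ℕ) (hl : 0 < l), 2 ≤ l →
      ContractibleSpace (NumPart.space F (NumPart.ones l hl)))
    {n : ℕ} {w : Fin n → ℕ} {c : ℕ} (hw : ∀ i, 0 < w i) (hm : Monotone w) (hc : 0 < c)
    (hE : Exchange w c) (hS : Splits w c) (ht : 2 ≤ (tops w c).card) (S : Cut n)
    (hSc : S.carrier = ortho w) : PContractible (F.obj S.obj) := by
  induction n using Nat.strong_induction_on with
  | _ n ih =>
  have hones : ∀ l (hl : 0 < l), 2 ≤ l → PContractible (NumPart.space F (NumPart.ones l hl)) :=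
    fun l hl h => (hF.wellPointed _).pContractible (h := hcontr l hl h)
  -- The induction hypothesis applies to the glued cut: fewer coordinates, and `c` occurs once more.
  have h1 := hF.phe_quot_theta hw hm hc hE hS S hSc (by
    intro J m π hJ hπ hmono
    refine ih m (OrdPart.lt_of_two_le_card hπ hJ.two_le) (push_pos hw) hmono
      (hE.push hπ hJ.sum_eq) (hS.push hw (by omega) hπ hJ.two_le hJ.sum_eq) ?_ (S.act π)
      (act_carrier_eq hSc π)
    rw [tops_push_card hπ (Finset.card_pos.1 (by have := hJ.two_le; omega)) hJ.sum_eq,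
      tops_sdiff_of_two_le hw hJ.two_le hJ.sum_eq]
    omega)
  obtain ⟨k, m, e, hmc, hk, hme⟩ := exists_equiv_last (tops w c)
  obtain rfl : n = k + m := by simpa using Fintype.card_congr e
  -- Cuts have at least one coordinate, so the case in which all weights equal `c` is separate;
  -- there the cut is that of a partition into ones.
  rcases Nat.eq_zero_or_pos k with rfl | hkpos
  · have hall : w = fun _ => c := by
      funext i
      obtain ⟨j, rfl⟩ := e.symm.surjective i
      induction j using Fin.addCases with
      | left j => exact j.elim0
      | right j => exact mem_tops.1 (hme j)
    have hS1 : S = (NumPart.ones (0 + m) S.pos).cut := by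
      refine Cut.ext ?_
      rw [hSc, hall, ortho_const hc]
      rfl
    rw [hS1]
    exact hones (0 + m) S.pos (by omega)
  · let v := w ∘ e.symm
    have hvw : w = v ∘ e := by
      funext i
      simp [v]
    have hv : ∀ i, 0 < v i := fun i => hw _
    have hSv : Splits v c := hS.comp e.symm.toEmbedding
    let Sv := weightCut v S.pos hv
    -- (A2) permits permuting the indices of weight `c` to the end.
    have hrel : PHE (quot F S (theta w c)) (quot F Sv (theta v c)) := by
      have hθ : ∀ τ, Setoid.comap e τ ∈ theta w c ↔ τ ∈ theta v c := by
        intro τ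
        rw [hvw]
        exact comap_mem_theta_iff hv e.toEmbedding fun i _ => e.surjective i
      refine hF.relative S Sv _ _ (hSc ▸ theta_isDownClosed hw hc hS)
        (theta_isDownClosed hv hc hSv) ⟨e, ?_, ?_⟩
      · ext x
        change x ∈ ortho v ∧ _ ↔ x ∘ e ∈ S.carrier ∧ _
        rw [hSc, ← hθ, show Setoid.comap e (signPart x) = signPart (x ∘ e) from
          comap_signPart e.toEmbedding x, ← comp_mem_ortho_iff e, ← hvw]
      · ext τ
        exact (hθ τ).symm
    have hsm := hF.quot_theta_phe_smash hv hc hSv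
      (fun i h => hk i (mem_tops.2 h)) (fun j => (mem_tops (w := w)).1 (hme j)) Sv rfl
      (weightCut (v ∘ Fin.castAdd m) hkpos fun i => hv _) rfl (by omega)
    exact ((hones m (by omega) (by omega)).smash_right _).of_phe ((h1.trans hrel).trans hsm).symm

end Functor

/-! ### Sequential partitions -/

section Sequential

variable {n : ℕ}

/-- Sequentiality speaks of the largest index; here `q` only has the largest weight. If the largest
index lies in `B`, it is itself the required subset. -/
theorem NumPart.IsSequential.exists_subset {lam : NumPart n} (h : lam.IsSequential)
    {A B : Finset (Fin n)} (hAB : ∑ i ∈ A, lam.part i = ∑ i ∈ B, lam.part i) {q : Fin n}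
    (hq : q ∈ A) (hmax : ∀ i ∈ A ∪ B, lam.part i ≤ lam.part q) :
    ∃ B' ⊆ B, ∑ i ∈ B', lam.part i = lam.part q := by
  have hne : (A ∪ B).Nonempty := ⟨q, Finset.mem_union_left _ hq⟩
  have hr := Finset.max'_mem _ hne
  have hle : ∀ i ∈ A ∪ B, i ≤ (A ∪ B).max' hne := fun i hi => Finset.le_max' _ i hi
  generalize (A ∪ B).max' hne = r at hr hle
  have hqr : lam.part r = lam.part q :=
    le_antisymm (hmax r hr) (lam.mono (hle q (Finset.mem_union_left _ hq)))
  rcases Finset.mem_union.1 hr with hrA | hrB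
  · obtain ⟨B', hB', hs⟩ := h A B hAB r hrA hle
    exact ⟨B', hB', hs.symm.trans hqr⟩
  · exact ⟨{r}, Finset.singleton_subset_iff.2 hrB, by simpa using hqr⟩

theorem NumPart.IsSequential.exchange {lam : NumPart n} (h : lam.IsSequential) (c : ℕ) :
    Exchange lam.part c :=
  fun _ _ _ hAB _ hq hmax => h.exists_subset hAB hq hmax

theorem NumPart.part_le_last (lam : NumPart (n + 1)) (i : Fin (n + 1)) :
    lam.part i ≤ lam.part (Fin.last n) := lam.mono (Fin.le_last i)

/-- The copies of the largest part are realised by actual indices, one of which serves as the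
heaviest element in sequentiality. -/
theorem NumPart.IsSequential.splits {lam : NumPart (n + 1)} (h : lam.IsSequential) :
    Splits lam.part (lam.part (Fin.last n)) := by
  intro A B a hne h1 ha hAB
  have hlast : Fin.last n ∈ tops lam.part (lam.part (Fin.last n)) := mem_tops.2 rfl
  have hpos : 0 < (tops lam.part (lam.part (Fin.last n))).card := Finset.card_pos.2 ⟨_, hlast⟩
  rw [max_eq_right (by omega)] at ha
  obtain ⟨X, hX, rfl⟩ := Finset.exists_subset_card_eq ha
  obtain ⟨q, hq⟩ := Finset.card_pos.1 h1
  have hqc : lam.part q = lam.part (Fin.last n) := mem_tops.1 (hX hq)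
  have hd : Disjoint X A := Finset.disjoint_left.2 fun i hi hi' =>
    hne i (Finset.mem_union_left _ hi') (mem_tops.1 (hX hi))
  rw [← hqc]
  refine h.exists_subset (A := X ∪ A) ?_ (Finset.mem_union_left _ hq)
    fun i _ => hqc ▸ lam.part_le_last i
  rw [Finset.sum_union hd, Finset.sum_const_nat fun i hi => mem_tops.1 (hX hi), hAB]

variable {lam : NumPart (n + 1)} {J : Finset (Fin (n + 1))}

theorem NumPart.part_lt_last (hmm : lam.mm = 1) {i : Fin (n + 1)} (hi : i ≠ Fin.last n) :
    lam.part i < lam.part (Fin.last n) := by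
  refine lt_of_le_of_ne (lam.part_le_last i) fun h => hi ?_
  exact Finset.card_le_one.1 hmm.le i (by simpa using h) _ (by simp)

theorem map_initSet {B : Finset (Fin (n + 1))} (hB : Fin.last n ∉ B) :
    (initSet B).map Fin.castSuccEmb = B := by
  ext i
  simp only [initSet, Finset.mem_map, Finset.mem_filter, Finset.mem_univ, true_and]
  constructor
  · rintro ⟨j, hj, rfl⟩
    exact hj
  · intro hi
    induction i using Fin.lastCases with
    | last => exact absurd hi hB
    | cast j => exact ⟨j, hi, rfl⟩

theorem mem_initSet {B : Finset (Fin (n + 1))} {i : Fin n} : i ∈ initSet B ↔ i.castSucc ∈ B := by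
  simp [initSet]

theorem sum_initSet {B : Finset (Fin (n + 1))} (hB : Fin.last n ∉ B) (f : Fin (n + 1) → ℕ) :
    ∑ i ∈ initSet B, f i.castSucc = ∑ i ∈ B, f i := by
  rw [← map_initSet hB, Finset.sum_map, map_initSet hB]
  rfl

theorem NumPart.IsI.isMaxRep_initSet (hJ : lam.IsI J) :
    IsMaxRep (fun i : Fin n => lam.part i.castSucc) (lam.part (Fin.last n)) (initSet J) where
  two_le := by
    rw [← Finset.card_map Fin.castSuccEmb, map_initSet hJ.last_notMem]
    exact hJ.two_le
  sum_eq := (sum_initSet hJ.last_notMem _).trans hJ.sum_eq.symm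
  max B hB hs := by
    have h := hJ.max (B.map Fin.castSuccEmb) (by rwa [Finset.card_map])
      (by rw [Finset.sum_map]; exact hs.symm)
    rw [← map_initSet hJ.last_notMem, Finset.map_eq_image, Finset.map_eq_image] at h
    exact (Finset.Colex.toColex_image_le_toColex_image Fin.strictMono_castSucc).1 h

theorem NumPart.IsI.glue_un (hJ : lam.IsI J) : hJ.glue.un = blockPart (initSet J) := by
  have hinj : ∀ i j : Fin (n + 1), ∀ (hi : i ∉ J) (hj : j ∉ J),
      complIndex J i hi = complIndex J j hj → i = j := by
    intro i j hi hj h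
    rw [← orderEmb_complIndex J i hi, ← orderEmb_complIndex J j hj, h]
  ext i j
  change dite _ _ _ = dite _ _ _ ↔ i = j ∨ (i ∈ initSet J ∧ j ∈ initSet J)
  rw [mem_initSet, mem_initSet]
  split_ifs with hi hj hj
  · exact iff_of_true rfl (Or.inr ⟨hi, hj⟩)
  · refine iff_of_false (fun h => (Fin.castSucc_lt_last j).ne' (hinj _ _ _ _ h)) ?_
    rintro (rfl | h)
    exacts [hj hi, hj h.2]
  · refine iff_of_false (fun h => (Fin.castSucc_lt_last i).ne (hinj _ _ _ _ h)) ?_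
    rintro (rfl | h)
    exacts [hi hj, hi h.1]
  · constructor
    · exact fun h => Or.inl (Fin.castSucc_injective n (hinj _ _ _ _ h))
    · rintro (rfl | h)
      exacts [rfl, absurd h.1 hi]

/-- A part heavier than all the parts in `I(λ)` and different from the last one has no
decomposition that meets `I(λ)`. -/
theorem NumPart.IsI.disjoint_of_sum_eq (hJ : lam.IsI J) (hseq : lam.IsSequential)
    (hmm : lam.mm = 1) {q p : Fin (n + 1)} (hmax : ∀ i ∈ J, i ≤ q)
    (hqp : lam.part q < lam.part p) (hp : p ≠ Fin.last n) {R : Finset (Fin (n + 1))}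
    (hR : Fin.last n ∉ R) (hs : ∑ i ∈ R, lam.part i = lam.part p) : Disjoint R J := by
  refine Finset.disjoint_left.2 fun r hr hrJ => ?_
  have hlt : ∀ i ∈ J, lam.part i < lam.part p := fun i hi => (lam.mono (hmax i hi)).trans_lt hqp
  have hpJ : p ∉ J := fun h => (hlt p h).ne rfl
  have h1 := Finset.sum_inter_add_sum_sdiff J R lam.part
  have h2 := Finset.sum_inter_add_sum_sdiff R J lam.part
  rw [Finset.inter_comm] at h2
  have hs1 := hJ.sum_eq
  -- Both sides have the weight of `J ∪ R`, since `J` sums to the last part and `R` to that of `p`.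
  obtain ⟨B, hB, hBs⟩ := hseq (insert (Fin.last n) (R \ J)) (insert p (J \ R)) (by
    rw [Finset.sum_insert (fun h => hR (Finset.mem_sdiff.1 h).1),
      Finset.sum_insert (fun h => hpJ (Finset.mem_sdiff.1 h).1)]
    omega) (Fin.last n) (Finset.mem_insert_self _ _) fun i _ => Fin.le_last i
  -- If `B` contains `p`, it is lexicographically larger than `J`; otherwise it lies in `J` without
  -- `r` and is too light.
  by_cases hpB : p ∈ B
  · have h2B : 2 ≤ B.card := by
      by_contra hcard
      obtain rfl : B = {p} := (Finset.eq_of_subset_of_card_le (Finset.singleton_subset_iff.2 hpB)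
        (by rw [Finset.card_singleton]; omega)).symm
      rw [Finset.sum_singleton] at hBs
      exact (NumPart.part_lt_last hmm hp).ne hBs.symm
    obtain ⟨b, hb, -, hpb⟩ :=
      Finset.Colex.toColex_le_toColex.1 (hJ.max B h2B hBs) hpB hpJ
    exact (hlt b hb).not_ge (lam.mono hpb)
  · have h3 : B ⊆ J.erase r := by
      intro i hi
      rcases Finset.mem_insert.1 (hB hi) with rfl | h
      · exact absurd hi hpB
      · have := Finset.mem_sdiff.1 h
        exact Finset.mem_erase.2 ⟨fun h => this.2 (h ▸ hr), this.1⟩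
    have h4 := Finset.sum_le_sum_of_subset (f := lam.part) h3
    have h5 := Finset.add_sum_erase J lam.part hrJ
    have := lam.part_pos r
    omega

/-- Parts heavier than `λ_q` are eliminated one at a time, heaviest first: sequentiality decomposes
such a part on the opposite side, and the part and its decomposition are deleted. The set `X` is
never touched, and once no heavier part is left, sequentiality applies to `q` itself. -/
theorem NumPart.IsI.exists_subset_of_balance (hJ : lam.IsI J) (hseq : lam.IsSequential)
    (hmm : lam.mm = 1) {q : Fin (n + 1)} (hq : q ∈ J) (hmax : ∀ i ∈ J, i ≤ q)
    {X : Finset (Fin (n + 1))} (hqX : q ∈ X) (hXJ : ∀ i ∈ X, i ∈ J ∨ lam.part i = lam.part q)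
    (hXl : Fin.last n ∉ X) (A B : Finset (Fin (n + 1))) (hAl : Fin.last n ∉ A)
    (hBl : Fin.last n ∉ B) (hAX : Disjoint A X)
    (hs : ∑ i ∈ A, lam.part i + ∑ i ∈ X, lam.part i = ∑ i ∈ B, lam.part i) :
    ∃ B' ⊆ B, ∑ i ∈ B', lam.part i = lam.part q := by
  generalize hN : A.card + B.card = N
  induction N using Nat.strong_induction_on generalizing A B with
  | _ N ih =>
  subst hN
  have hXq : ∀ i ∈ X, lam.part i ≤ lam.part q := by
    intro i hi
    rcases hXJ i hi with h | h
    exacts [lam.mono (hmax i h), h.le]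
  by_cases hbig : ((A ∪ B).filter fun p => lam.part q < lam.part p).Nonempty
  · obtain ⟨p, hp, hpmax⟩ := Finset.exists_max_image _ lam.part hbig
    rw [Finset.mem_filter] at hp
    obtain ⟨hpAB, hqp⟩ := hp
    have hple : ∀ i ∈ A ∪ X ∪ B, lam.part i ≤ lam.part p := by
      intro i hi
      by_cases hqi : lam.part q < lam.part i
      · refine hpmax i (Finset.mem_filter.2 ⟨?_, hqi⟩)
        simp only [Finset.mem_union] at hi ⊢
        rcases hi with (hi | hi) | hi
        · exact Or.inl hi
        · exact absurd hqi (hXq i hi).not_gt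
        · exact Or.inr hi
      · omega
    rcases Finset.mem_union.1 hpAB with hpA | hpB
    · obtain ⟨R, hR, hRs⟩ := hseq.exists_subset (A := A ∪ X) (B := B)
        (by rw [Finset.sum_union hAX, hs]) (Finset.mem_union_left _ hpA) hple
      have e1 := Finset.add_sum_erase A lam.part hpA
      have e2 := Finset.sum_sdiff hR (f := lam.part)
      obtain ⟨B', hB', hB's⟩ := ih _ (by
          have := Finset.card_erase_lt_of_mem hpA
          have := Finset.card_le_card (Finset.sdiff_subset : B \ R ⊆ B)
          omega) (A.erase p) (B \ R) (fun h => hAl (Finset.mem_of_mem_erase h))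
        (fun h => hBl (Finset.mem_sdiff.1 h).1) (hAX.mono_left (Finset.erase_subset _ _))
        (by omega) rfl
      exact ⟨B', hB'.trans Finset.sdiff_subset, hB's⟩
    · obtain ⟨R, hR, hRs⟩ := hseq.exists_subset (A := B) (B := A ∪ X)
        (by rw [Finset.sum_union hAX, hs]) hpB (by rwa [Finset.union_comm])
      have hpl : p ≠ Fin.last n := fun h => hBl (h ▸ hpB)
      have hRl : Fin.last n ∉ R := fun h =>
        (Finset.mem_union.1 (hR h)).elim hAl hXl
      have hRJ := hJ.disjoint_of_sum_eq hseq hmm hmax hqp hpl hRl hRs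
      have hqR : q ∉ R := fun h => Finset.disjoint_left.1 hRJ h hq
      have hRA : R ⊆ A := by
        intro i hi
        refine (Finset.mem_union.1 (hR hi)).resolve_right fun hiX => ?_
        rcases hXJ i hiX with h | h
        · exact Finset.disjoint_left.1 hRJ hi h
        -- Swapping `i` for `q`, of equal weight, would give a decomposition of `λ_p` that meets
        -- `I(λ)`.
        · have hqR' : q ∉ R.erase i := fun h => hqR (Finset.mem_of_mem_erase h)
          have hRJ' := hJ.disjoint_of_sum_eq hseq hmm hmax hqp hpl
            (R := insert q (R.erase i)) (by
              rw [Finset.mem_insert, not_or]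
              exact ⟨fun h => hXl (h ▸ hqX), fun h => hRl (Finset.mem_of_mem_erase h)⟩)
            (by rw [Finset.sum_insert hqR', ← h, Finset.add_sum_erase R lam.part hi, hRs])
          exact Finset.disjoint_left.1 hRJ' (Finset.mem_insert_self _ _) hq
      have e1 := Finset.add_sum_erase B lam.part hpB
      have e2 := Finset.sum_sdiff hRA (f := lam.part)
      obtain ⟨B', hB', hB's⟩ := ih _ (by
          have := Finset.card_erase_lt_of_mem hpB
          have := Finset.card_le_card (Finset.sdiff_subset : A \ R ⊆ A)
          omega) (A \ R) (B.erase p) (fun h => hAl (Finset.mem_sdiff.1 h).1)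
        (fun h => hBl (Finset.mem_of_mem_erase h)) (hAX.mono_left Finset.sdiff_subset)
        (by omega) rfl
      exact ⟨B', hB'.trans (Finset.erase_subset _ _), hB's⟩
  · rw [Finset.not_nonempty_iff_eq_empty, Finset.filter_eq_empty_iff] at hbig
    refine hseq.exists_subset (A := A ∪ X) (by rw [Finset.sum_union hAX, hs])
      (Finset.mem_union_right _ hqX) fun i hi => ?_
    simp only [Finset.mem_union] at hi hbig
    rcases hi with (hi | hi) | hi
    · exact not_lt.1 (hbig (Or.inl hi))
    · exact hXq i hi
    · exact not_lt.1 (hbig (Or.inr hi))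

/-- Let `q` be the largest index in `I(λ)`. After a decomposition of `λ_q` inside `I(λ)` has been
glued to a block, the weight `λ_q` splits off. -/
theorem NumPart.IsI.splits_push (hJ : lam.IsI J) (hseq : lam.IsSequential) (hmm : lam.mm = 1)
    {q : Fin n} (hq : q.castSucc ∈ J) (hmax : ∀ i ∈ J, i ≤ q.castSucc) {K : Finset (Fin n)}
    (hK : K ⊆ initSet J) (hqK : q ∉ K)
    (hs : ∑ i ∈ K, lam.part i.castSucc = lam.part q.castSucc) {m : ℕ} {π : OrdPart n m}
    (hπ : π.un = blockPart K) :
    Splits (push π fun i => lam.part i.castSucc) (lam.part q.castSucc) := by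
  have hKne : K.Nonempty := by
    rw [Finset.nonempty_iff_ne_empty]
    rintro rfl
    have := lam.part_pos q.castSucc
    simp only [Finset.sum_empty] at hs
    omega
  refine Resonance.splits_push hπ hKne hs fun A B a hne h1 ha hAB => ?_
  set w : Fin n → ℕ := fun i => lam.part i.castSucc with hw
  have hqT : q ∈ tops w (lam.part q.castSucc) \ K := Finset.mem_sdiff.2 ⟨mem_tops.2 rfl, hqK⟩
  -- `X` realises `a` copies of `λ_q` and contains `q`: indices of that weight outside `K`, and, if
  -- these are too few, also `K` itself as one copy.
  obtain ⟨X, hqX, hXK, hXs⟩ : ∃ X : Finset (Fin n), q ∈ X ∧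
      (∀ i ∈ X, i ∈ K ∨ w i = lam.part q.castSucc) ∧ ∑ i ∈ X, w i = a * lam.part q.castSucc := by
    by_cases ha' : a ≤ (tops w (lam.part q.castSucc) \ K).card
    · obtain ⟨X, hX1, hX2, rfl⟩ := Finset.exists_subsuperset_card_eq
        (Finset.singleton_subset_iff.2 hqT) (by simpa using h1) ha'
      have hXc : ∀ i ∈ X, w i = lam.part q.castSucc := fun i hi =>
        mem_tops.1 (Finset.mem_sdiff.1 (hX2 hi)).1
      exact ⟨X, Finset.singleton_subset_iff.1 hX1, fun i hi => Or.inr (hXc i hi),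
        Finset.sum_const_nat hXc⟩
    · refine ⟨tops w (lam.part q.castSucc) \ K ∪ K, Finset.mem_union_left _ hqT, ?_, ?_⟩
      · intro i hi
        rcases Finset.mem_union.1 hi with hi | hi
        · exact Or.inr (mem_tops.1 (Finset.mem_sdiff.1 hi).1)
        · exact Or.inl hi
      · rw [Finset.sum_union Finset.sdiff_disjoint, hs,
          Finset.sum_const_nat fun i hi => mem_tops.1 (Finset.mem_sdiff.1 hi).1]
        obtain rfl : a = (tops w (lam.part q.castSucc) \ K).card + 1 := by omega
        ring
  have hl : ∀ C : Finset (Fin n), Fin.last n ∉ C.map Fin.castSuccEmb := by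
    intro C h
    obtain ⟨i, -, hi⟩ := Finset.mem_map.1 h
    exact (Fin.castSucc_lt_last i).ne hi
  have hsum : ∀ C : Finset (Fin n), ∑ i ∈ C.map Fin.castSuccEmb, lam.part i = ∑ i ∈ C, w i :=
    fun C => Finset.sum_map _ _ _
  obtain ⟨B', hB', hB's⟩ := hJ.exists_subset_of_balance hseq hmm hq hmax
    (X := X.map Fin.castSuccEmb) (Finset.mem_map_of_mem Fin.castSuccEmb hqX) (by
      intro i hi
      obtain ⟨j, hj, rfl⟩ := Finset.mem_map.1 hi
      exact (hXK j hj).imp (fun h => mem_initSet.1 (hK h)) id)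
    (hl _) (A.map Fin.castSuccEmb) (B.map Fin.castSuccEmb) (hl _) (hl _) (by
      rw [Finset.disjoint_map]
      refine Finset.disjoint_left.2 fun i hi hiX => ?_
      obtain ⟨h1, h2⟩ := hne i (Finset.mem_union_left _ hi)
      exact (hXK i hiX).elim h2 h1) (by rw [hsum, hsum, hsum, hXs, add_comm, hAB])
  obtain ⟨C, hC, rfl⟩ := Finset.subset_map_iff.1 hB'
  exact ⟨C, hC, (hsum C).symm.trans hB's⟩

end Sequential

/-! ### The smash decomposition and the null-homotopy of `i` -/

section Main

variable {F : ResCat ⥤ PTop.{u}} {n : ℕ} {lam : NumPart (n + 1)} {J : Finset (Fin (n + 1))}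

/-- Transports (A1) along an equality of cuts, as the source of `glueHom` is the cut of `μ` and only
propositionally the glued cut. -/
theorem IsResonanceFunctor.inclusion_of_act_eq (hF : IsResonanceFunctor F) {n m : ℕ} {S : Cut n}
    {π : OrdPart n m} {U : Cut m} (h : S.act π = U) (f : U.obj ⟶ S.obj)
    (hf : ResCat.Hom.part f = π) :
    IsClosedCofibration (F.map f).map ∧
      PHE (collapse (F.obj S.obj) (Set.range (F.map f).map))
        (quot F S (down S.carrier {π.un})) := by
  subst h
  obtain rfl : f = S.incl π := ResCat.Hom.ext hf
  exact ⟨hF.inclusion S π, hF.inclusion_quot S π⟩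

/-- Gluing a decomposition of the unique largest part makes it occur twice, so the collapsed
subspace is contractible; then the last coordinate splits off. -/
theorem NumPart.IsI.phe_smash (hJ : lam.IsI J) (hF : IsResonanceFunctor F)
    (hcontr : ∀ (l : ℕ) (hl : 0 < l), 2 ≤ l →
      ContractibleSpace (NumPart.space F (NumPart.ones l hl)))
    (hseq : lam.IsSequential) (hmm : lam.mm = 1) :
    PHE (lam.space F)
      (smash (quot F (lam.init hJ.pos).cut
          (down (lam.init hJ.pos).cut.carrier {blockPart (initSet J)}))
        ((NumPart.ones 1 Nat.one_pos).space F)) := by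
  have hc := lam.part_pos (Fin.last n)
  have hcard : (tops lam.part (lam.part (Fin.last n))).card = 1 := hmm
  have h1 := hF.phe_quot_theta lam.part_pos lam.mono hc (hseq.exchange _) hseq.splits lam.cut rfl (by
    intro K m π hK hπ hmono
    refine hF.pContractible_of_splits hcontr (push_pos lam.part_pos) hmono hc
      ((hseq.exchange _).push hπ hK.sum_eq)
      (hseq.splits.push lam.part_pos hcard.ge hπ hK.two_le hK.sum_eq) ?_ _
      (act_carrier_eq rfl π)
    rw [tops_push_card hπ (Finset.card_pos.1 (by have := hK.two_le; omega)) hK.sum_eq,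
      tops_sdiff_of_two_le lam.part_pos hK.two_le hK.sum_eq, hcard])
  have h2 := hF.quot_theta_phe_smash (k := n) (m := 1) lam.part_pos hc hseq.splits
    (fun i => (NumPart.part_lt_last hmm (Fin.castSucc_lt_last i).ne).ne)
    (fun j => by
      rw [Subsingleton.elim j 0]
      rfl) lam.cut rfl (lam.init hJ.pos).cut rfl Nat.one_pos
  have h3 : down (lam.init hJ.pos).cut.carrier {blockPart (initSet J)} =
      theta (lam.part ∘ Fin.castAdd 1) (lam.part (Fin.last n)) :=
    hJ.isMaxRep_initSet.down_eq (fun i => lam.part_pos _) hc (lam.init hJ.pos).mono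
      ((hseq.exchange _).comp Fin.castSuccEmb) (hseq.splits.comp Fin.castSuccEmb)
  rw [h3]
  exact h1.trans h2

/-- Gluing `I(λ)` can be done in two stages, starting with a subset that sums to `λ_q`. After the
first stage `λ_q` occurs twice, and the value there is contractible. -/
theorem NumPart.IsI.phomotopic_trivialMap (hJ : lam.IsI J) (hF : IsResonanceFunctor F)
    (hcontr : ∀ (l : ℕ) (hl : 0 < l), 2 ≤ l →
      ContractibleSpace (NumPart.space F (NumPart.ones l hl)))
    (hseq : lam.IsStronglySequential) (hmm : lam.mm = 1) :
    PHomotopic (F.map hJ.glueHom)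
      (trivialMap ((lam.delete J hJ.compl_card_pos).space F) ((lam.init hJ.pos).space F)) := by
  have hJne : J.Nonempty := Finset.card_pos.1 (by have := hJ.two_le; omega)
  obtain ⟨q, hq, hmax⟩ : ∃ q ∈ J, ∀ i ∈ J, i ≤ q :=
    ⟨J.max' hJne, J.max'_mem hJne, fun i hi => J.le_max' i hi⟩
  obtain ⟨B, hB, hBs⟩ := hseq.2 J hJ q hq hmax
  have hBJ : B ⊆ J := hB.trans Finset.sdiff_subset
  have hqB : q ∉ B := fun h => by simpa using hB h
  have hBl : Fin.last n ∉ B := fun h => hJ.last_notMem (hBJ h)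
  induction q using Fin.lastCases with
  | last => exact absurd hq hJ.last_notMem
  | cast q =>
  have hK : initSet B ⊆ initSet J := fun i hi => mem_initSet.2 (hBJ (mem_initSet.1 hi))
  have hqK : q ∉ initSet B := fun h => hqB (mem_initSet.1 h)
  have hs : ∑ i ∈ initSet B, lam.part i.castSucc = lam.part q.castSucc :=
    (sum_initSet hBl _).trans hBs.symm
  have hKne : (initSet B).Nonempty := by
    rw [Finset.nonempty_iff_ne_empty]
    intro h
    have := lam.part_pos q.castSucc
    rw [h, Finset.sum_empty] at hs
    omega
  let T := (lam.init hJ.pos).cut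
  obtain ⟨m, π, hπ, hmono⟩ := exists_ordPart_monotone (initSet B |> blockPart)
    fun i : Fin n => lam.part i.castSucc
  have hmid : PContractible (F.obj (T.act π).obj) := by
    refine hF.pContractible_of_splits hcontr (push_pos fun i => lam.part_pos _) hmono
      (lam.part_pos q.castSucc) (((hseq.1.exchange _).comp Fin.castSuccEmb).push hπ hs)
      (hJ.splits_push hseq.1 hmm hq hmax hK hqK hs hπ) ?_ _ (act_carrier_eq rfl π)
    rw [tops_push_card hπ hKne hs]
    have : 0 < (tops (fun i : Fin n => lam.part i.castSucc) (lam.part q.castSucc) \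
        initSet B).card :=
      Finset.card_pos.2 ⟨q, Finset.mem_sdiff.2 ⟨mem_tops.2 rfl, hqK⟩⟩
    omega
  -- The second stage is defined on chosen representatives of the blocks of `π`; the choice is
  -- immaterial as `π` glues only inside `I(λ)`.
  have hfac : ∀ i, hJ.glue.block (Function.surjInv π.surj (π.block i)) = hJ.glue.block i := by
    intro i
    have h1 : π.block (Function.surjInv π.surj (π.block i)) = π.block i :=
      Function.surjInv_eq π.surj _
    rw [block_eq_iff hJ.glue_un]
    exact ((block_eq_iff hπ).1 h1).imp_right fun h => ⟨hK h.1, hK h.2⟩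
  let α : OrdPart m Jᶜ.card := ⟨fun j => hJ.glue.block (Function.surjInv π.surj j), by
    intro s
    obtain ⟨i, rfl⟩ := hJ.glue.surj s
    exact ⟨π.block i, hfac i⟩⟩
  let f : (lam.delete J hJ.compl_card_pos).cut.obj ⟶ (T.act π).obj :=
    ResCat.Hom.mk α (by
      intro t ht
      have h1 : t ∘ hJ.glue.block ∈ T.carrier := ResCat.Hom.le hJ.glueHom ht
      have h2 : (t ∘ α.block) ∘ π.block = t ∘ hJ.glue.block :=
        funext fun i => congrArg t (hfac i)
      change (t ∘ α.block) ∘ π.block ∈ T.carrier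
      rwa [h2])
  have hcomp : hJ.glueHom = f ≫ T.incl π :=
    ResCat.Hom.ext (OrdPart.ext (funext fun i => (hfac i).symm))
  rw [hcomp, F.map_comp]
  exact hmid.comp_phomotopic_trivialMap _ _

end Main

end Resonance

theorem theorem4p13 (F : ResCat ⥤ PTop.{u}) (hF : IsResonanceFunctor F)
    (hcontr : ∀ (l : ℕ) (hl : 2 ≤ l),
      ContractibleSpace (NumPart.space F (NumPart.ones l (by omega))))
    {n : ℕ} (lam : NumPart (n + 1)) (hseq : lam.IsSequential)
    (J : Finset (Fin (n + 1))) (hJ : lam.IsI J) :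
    (2 ≤ lam.mm → ContractibleSpace (lam.space F)) ∧
    (lam.mm = 1 →
      PHE (lam.space F)
        (smash
          (quot F (lam.init hJ.pos).cut
            (down (lam.init hJ.pos).cut.carrier {blockPart (initSet J)}))
          ((NumPart.ones 1 Nat.one_pos).space F)) ∧
      (∃ p : (lam.init hJ.pos).space F ⟶
          quot F (lam.init hJ.pos).cut
            (down (lam.init hJ.pos).cut.carrier {blockPart (initSet J)}),
        IsInclusionTriple (F.map hJ.glueHom) p) ∧
      (lam.IsStronglySequential →
        PHomotopic (F.map hJ.glueHom)
          (trivialMap ((lam.delete J hJ.compl_card_pos).space F) ((lam.init hJ.pos).space F)) ∧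
        PHE (lam.space F)
          (wedge
            (smash ((NumPart.ones 1 Nat.one_pos).space F) ((lam.init hJ.pos).space F))
            (susp (smash ((NumPart.ones 1 Nat.one_pos).space F)
              ((lam.delete J hJ.compl_card_pos).space F)))))) := by
  have hcontr' := fun (l : ℕ) (_ : 0 < l) (h : 2 ≤ l) => hcontr l h
  refine ⟨fun hmm => ?_, fun hmm => ?_⟩
  · exact (hF.pContractible_of_splits hcontr' lam.part_pos lam.mono (lam.part_pos (Fin.last n))
      (hseq.exchange _) hseq.splits hmm lam.cut rfl).contractibleSpace
  · have hsm := hJ.phe_smash hF hcontr' hseq hmm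
    obtain ⟨hcof, hquot⟩ := hF.inclusion_of_act_eq hJ.glue_act hJ.glueHom rfl
    rw [hJ.glue_un] at hquot
    refine ⟨hsm, ?_, fun hstrong => ?_⟩
    · obtain ⟨e, he⟩ := hquot
      exact ⟨collapseProj _ _ ≫ e, hcof, e, he, rfl⟩
    · have hnull := hJ.phomotopic_trivialMap hF hcontr' hstrong hmm
      refine ⟨hnull, ?_⟩
      have hA := (hF.wellPointed (lam.delete J hJ.compl_card_pos).cut.obj).isClosed_pt
      have hY := (hF.wellPointed (lam.init hJ.pos).cut.obj).isClosed_pt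
      have hsplit := PHE.collapse_of_phomotopic_trivialMap _ hcof hnull
      -- The quotient factor is replaced by the collapse of the image of `i`, hence by a wedge, over
      -- which the smash product distributes.
      exact ((hsm.trans (PHE.smash_comm _ _)).trans
        ((PHE.refl _).smash (hquot.symm.trans hsplit))).trans
        ((PHE.smash_wedge _ hY (susp_isClosed_pt hA)).trans
          ((PHE.refl _).wedge (PHE.smash_susp _ hA)))
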